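/- **Setting.** Let $V$ be a continuous Euclidean vector bundle (of finite rank) over a compact metric space $X$, and let $T\colon X\to X$ be a homeomorphism. A linear cocycle on $V$ over $T$ is a continuous map $\mathcal A\colon V\to V$ that maps each fiber $V_x$ to $V_{Tx}$ by a linear isomorphism. Let $E\subset V$ be a continuous subbundle of rank $2$ with a continuous orientation. **Skew-products and rotation numbers.** The projectivization $\mathbb PE=\bigsqcup_x\mathbb P(E_x)$ is an oriented circle bundle; give each circle $\mathbb P(E_x)$ length $1$ (the angle between lines divided by $\pi$). Let $Sk^+_{\mathbb PE,T}$ be the set of continuous maps $f\colon\mathbb PE\to\mathbb PE$ that send each circle $\mathbb P(E_x)$ onto $\mathbb P(E_{Tx})$ by an orientation-preserving homeomorphism, with the topology of uniform convergence. The winding number $w(\gamma)$ of a path $\gamma$ in a circle $\mathbb P(E_x)$ is the signed length $\tilde\gamma(1)-\tilde\gamma(0)$ of a lift of $\gamma$ to the universal cover. For a path $\phi=(f_t)_{t\in[0,1]}$ in $Sk^+_{\mathbb PE,T}$, let $\rho(x,\phi)=\lim_{n\to\infty}\frac1n\,w\big((f_t^n u)_{t\in[0,1]}\big)$ with $u\in\mathbb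 P(E_x)$, and let $\rho(\mu,\phi)=\int_X\rho(x,\phi)\,d\mu(x)$ for a $T$-invariant finite Borel measure $\mu$ (the limit exists for $\mu$-almost every $x$ and every $u\in \mathbb P(E_x)$, does not depend on $u$, and is integrable in $x$). If $\mathcal U$ is a simply connected neighborhood of $f$ in $Sk^+_{\mathbb PE,T}$, the rotation number of $g\in\mathcal U$ relative to $f$ is $\rho(\mu,\phi)$ for any path $\phi$ in $\mathcal U$ from $f$ to $g$. The skew-product $f$ is *mode-locked over $\mu$* if, in such a neighborhood $\mathcal U$, this relative rotation number vanishes for all $g$ in some neighborhood of $f$. **Dominated splittings.** For a $T$-invariant set $S\subset X$, a dominated splitting of $\mathcal A|_E$ over $S$ is a splitting $E_x=E_{1,x}\oplus\dots\oplus E_{k,x}$ ($x\in S$), with $k\ge2$, into $\mathcal A$-invariant continuous subbundles over $S$ of constant positive dimension such that, for some $N\in\mathbb N$, for all $x\in S$, all $1\le i<k$ and all unit vectors $u\in E_{i,x}$, $v\in E_{i+1,x}$, one has $\|\mathcal A^Nu\|<\frac12\|\mathcal A^Nv\|$. (As $E$ has rank $2$, over a nonempty $S$ this is a splitting into two line bundles.)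 **Proposition.** Let $\mathcal A$ be a linear cocycle on $V$ over $T$ that preserves $E$ and its orientation, and let $\mu$ be a $T$-invariant finite Borel measure on $X$. Then the following are equivalent: (i) the projectivization $\mathbb P(\mathcal A|_E)\in Sk^+_{\mathbb PE,T}$ is mode-locked over $\mu$; (ii) the restriction $\mathcal A|_E$ admits a dominated splitting over the support $\operatorname{supp}(\mu)$. -/

import Mathlib

open Bundle Filter MeasureTheory Set
open scoped Topology LinearAlgebra.Projectivization

noncomputable section

section Cocycles

variable {X : Type*} [TopologicalSpace X]
  (F : Type*)
  (V : X → Type*) [TopologicalSpace (TotalSpace F V)]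
  [∀ x, NormedAddCommGroup (V x)] [∀ x, InnerProductSpace ℝ (V x)]

/-- A linear cocycle on the vector bundle `V` over the homeomorphism `T` of the base: a continuous
map of the total space that sends each fiber `V x` to `V (T x)` by a linear isomorphism. -/
structure LinearCocycle (T : X ≃ₜ X) where
  /-- the action on the fibers -/
  onFiber : ∀ x, V x ≃ₗ[ℝ] V (T x)
  continuous_total : Continuous fun v : TotalSpace F V =>
    (⟨T v.proj, onFiber v.proj v.snd⟩ : TotalSpace F V)

/-- A continuous subbundle of rank two of `V`, endowed with a continuous orientation: the fibers
are the planes spanned, near each point, by a continuous frame of two sections of `V`, and this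
frame is positively oriented. -/
structure OrientedPlaneBundle where
  /-- the planes -/
  fiber : ∀ x, Submodule ℝ (V x)
  /-- the orientations of the planes -/
  orient : ∀ x, Orientation ℝ (fiber x) (Fin 2)
  exists_frame : ∀ x₀, ∃ U ∈ 𝓝 x₀, ∃ e : ∀ x, Module.Basis (Fin 2) ℝ (fiber x),
    (∀ i, ContinuousOn (fun x => (⟨x, (e x i : V x)⟩ : TotalSpace F V)) U) ∧
      ∀ x ∈ U, (e x).orientation = orient x

/-- `L` restricts to a continuous vector subbundle of constant rank `r` over the set `S`: near
each point of `S` it is spanned over `S` by a continuous frame of `r` sections of `V`. -/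
def IsContinuousSubbundle {V : X → Type*} [TopologicalSpace (TotalSpace F V)]
    [∀ x, NormedAddCommGroup (V x)] [∀ x, InnerProductSpace ℝ (V x)]
    (S : Set X) (r : ℕ) (L : ∀ x, Submodule ℝ (V x)) : Prop :=
  ∀ x₀ ∈ S, ∃ U ∈ 𝓝 x₀, ∃ e : Fin r → ∀ x, V x,
    (∀ i, ContinuousOn (fun x => (⟨x, e i x⟩ : TotalSpace F V)) (U ∩ S)) ∧
      ∀ x ∈ U ∩ S, LinearIndependent ℝ (fun i => e i x) ∧
        Submodule.span ℝ (range fun i => e i x) = L x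

variable {F V}

namespace LinearCocycle

variable {T : X ≃ₜ X} (A : LinearCocycle F V T) (E : OrientedPlaneBundle F V)

/-- The cocycle as a map of the total space. -/
def total (v : TotalSpace F V) : TotalSpace F V :=
  ⟨T v.proj, A.onFiber v.proj v.snd⟩

/-- The norm of the image of the vector `u` of `V x` under the `n`-th iterate of the cocycle. -/
def iterNorm (n : ℕ) {x : X} (u : V x) : ℝ :=
  ‖(A.total^[n] ⟨x, u⟩).snd‖

/-- The cocycle preserves the subbundle `E` and its orientation. -/
structure PreservesOrientation : Prop where
  map_fiber : ∀ x, (E.fiber x).map (A.onFiber x : V x →ₗ[ℝ] V (T x)) = E.fiber (T x)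
  map_orient : ∀ x, Orientation.map (Fin 2)
    ((A.onFiber x).ofSubmodules (E.fiber x) (E.fiber (T x)) (map_fiber x)) (E.orient x)
      = E.orient (T x)

/-- The restriction to `E` of the cocycle admits a (nontrivial) dominated splitting over the set
`S`: over `S`, the bundle `E` is the direct sum of at least two continuous invariant subbundles
of constant positive rank, each of which is dominated by the next one. -/
def HasDominatedSplitting (S : Set X) : Prop :=
  ∃ k : ℕ, 2 ≤ k ∧ ∃ (r : Fin k → ℕ) (L : Fin k → ∀ x, Submodule ℝ (V x)),
    (∀ i, 0 < r i ∧ IsContinuousSubbundle F S (r i) (L i)) ∧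
    (∀ x ∈ S, iSupIndep (fun i => L i x) ∧ ⨆ i, L i x = E.fiber x) ∧
    (∀ i, ∀ x ∈ S, (L i x).map (A.onFiber x : V x →ₗ[ℝ] V (T x)) = L i (T x)) ∧
    ∃ N : ℕ, ∀ x ∈ S, ∀ i j : Fin k, (j : ℕ) = (i : ℕ) + 1 →
      ∀ u ∈ L i x, ∀ v ∈ L j x, ‖u‖ = 1 → ‖v‖ = 1 →
        A.iterNorm N u < 1 / 2 * A.iterNorm N v

end LinearCocycle

namespace OrientedPlaneBundle

variable (E : OrientedPlaneBundle F V)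

/-- The total space of the projectivization of `E`: pairs of a base point and of a line of the
plane above it. -/
@[ext]
structure Proj where
  /-- the base point -/
  base : X
  /-- the line -/
  line : ℙ ℝ (E.fiber base)

/-- The line spanned by a nonzero vector of `E`. -/
def Proj.mk' (v : {v : TotalSpace F V // v.snd ∈ E.fiber v.proj ∧ v.snd ≠ 0}) : E.Proj :=
  ⟨v.1.proj, Projectivization.mk ℝ (⟨v.1.snd, v.2.1⟩ : E.fiber v.1.proj)
    (fun h => v.2.2 (congrArg Subtype.val h))⟩

/-- The topology of the projective bundle: the quotient topology of the set of nonzero vectors of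
`E`, seen in the total space of `V`. -/
instance : TopologicalSpace E.Proj :=
  TopologicalSpace.coinduced (Proj.mk' E) inferInstance

/-- The positively oriented orthonormal bases of the plane of `E` above `x`. -/
def Frame (x : X) : Type _ :=
  {b : OrthonormalBasis (Fin 2) ℝ (E.fiber x) // b.toBasis.orientation = E.orient x}

variable {E}

theorem cover_ne_zero {x : X} (b : E.Frame x) (t : ℝ) :
    Real.cos (Real.pi * t) • b.1 0 + Real.sin (Real.pi * t) • b.1 1 ≠ 0 := by
  intro h
  have h0 : inner ℝ (b.1 0) (Real.cos (Real.pi * t) • b.1 0 + Real.sin (Real.pi * t) • b.1 1)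
      = Real.cos (Real.pi * t) := by
    simp [inner_add_right, inner_smul_right]
  have h1 : inner ℝ (b.1 1) (Real.cos (Real.pi * t) • b.1 0 + Real.sin (Real.pi * t) • b.1 1)
      = Real.sin (Real.pi * t) := by
    simp [inner_add_right, inner_smul_right]
  rw [h, inner_zero_right] at h0 h1
  have := Real.cos_sq_add_sin_sq (Real.pi * t)
  rw [← h0, ← h1] at this
  norm_num at this

/-- The universal cover `ℝ → ℙ (E x)` of the circle of lines of the plane above `x`, oriented, and
normalized so that the circle has length one: `t` is sent to the line that makes the angle `π t`
with the first vector of the frame. -/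
def cover {x : X} (b : E.Frame x) (t : ℝ) : E.Proj :=
  ⟨x, Projectivization.mk ℝ
    (Real.cos (Real.pi * t) • b.1 0 + Real.sin (Real.pi * t) • b.1 1) (cover_ne_zero b t)⟩

variable (E)

/-- A continuous map of the projective bundle of `E` is a skew-product of orientation-preserving
circle homeomorphisms over `T` if it maps the circle above `x` to the circle above `T x`, with a
lift to the universal covers that is an increasing homeomorphism of the line commuting with the
unit translation. -/
def IsSkewProduct (T : X ≃ₜ X) (f : C(E.Proj, E.Proj)) : Prop :=
  (∀ p, (f p).base = T p.base) ∧
    ∀ (x : X) (b : E.Frame x) (b' : E.Frame (T x)), ∃ G : ℝ → ℝ,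
      Continuous G ∧ StrictMono G ∧ (∀ t, G (t + 1) = G t + 1) ∧
        ∀ t, f (cover b t) = cover b' (G t)

/-- The space of skew-products of orientation-preserving circle homeomorphisms of the projective
bundle of `E` over `T`. Its topology is the compact-open topology, which is that of uniform
convergence since the projective bundle over a compact base is compact. -/
abbrev SkewProduct (T : X ≃ₜ X) : Type _ :=
  {f : C(E.Proj, E.Proj) // E.IsSkewProduct T f}

variable {E}

/-- `w` is the winding number of the path `γ` in a fiber of the projective bundle: the
algebraic length of a lift of `γ` to the universal cover of this fiber. -/
def IsWindingNumber (γ : unitInterval → E.Proj) (w : ℝ) : Prop :=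
  ∃ (x : X) (b : E.Frame x) (θ : C(unitInterval, ℝ)),
    (∀ t, γ t = cover b (θ t)) ∧ w = θ 1 - θ 0

variable {T : X ≃ₜ X}

/-- The rotation number at `x` of the path `φ` of skew-products exists and is `r`: for all `u`
above `x`, the winding number of the path `t ↦ (φ t)ⁿ u`, divided by `n`, tends to `r`. -/
def HasRotationNumberAt {f g : E.SkewProduct T} (φ : Path f g) (x : X) (r : ℝ) : Prop :=
  ∀ u : E.Proj, u.base = x → ∃ w : ℕ → ℝ,
    (∀ n, IsWindingNumber (fun t => (φ t).1^[n] u) (w n)) ∧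
      Tendsto (fun n : ℕ => w n / n) atTop (𝓝 r)

/-- The rotation number of the path `φ` above the measure `μ` is `r`: the rotation number exists
at `μ`-almost every point, it is integrable, and its integral is `r`. -/
def HasRotationNumber [MeasurableSpace X] (μ : Measure X) {f g : E.SkewProduct T} (φ : Path f g)
    (r : ℝ) : Prop :=
  ∃ ρ : X → ℝ, (∀ᵐ x ∂μ, HasRotationNumberAt φ x (ρ x)) ∧ Integrable ρ μ ∧ ∫ x, ρ x ∂μ = r

/-- The rotation number above `μ` of `g` relative to `f` in the neighborhood `U` (which is meant to
be simply connected) is `r`: the paths from `f` to `g` in `U` have rotation number `r`. -/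
def HasRelativeRotationNumber [MeasurableSpace X] (μ : Measure X) (U : Set (E.SkewProduct T))
    (f g : E.SkewProduct T) (r : ℝ) : Prop :=
  ∀ φ : Path f g, (∀ t, φ t ∈ U) → HasRotationNumber μ φ r

/-- The skew-product `f` is mode-locked over `μ`: in a simply connected neighborhood of `f`, the
rotation number relative to `f` vanishes on a neighborhood of `f`. -/
def IsModeLocked [MeasurableSpace X] (μ : Measure X) (f : E.SkewProduct T) : Prop :=
  ∃ U ∈ 𝓝 f, IsSimplyConnected U ∧
    ∃ W ∈ 𝓝 f, W ⊆ U ∧ ∀ g ∈ W, HasRelativeRotationNumber μ U f g 0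

end OrientedPlaneBundle

/-- A real `2 × 2` matrix with positive determinant acts on the lines of the plane with an
increasing lift. -/
theorem exists_lift_of_det_pos {a b c d : ℝ} (h : 0 < a * d - b * c) :
    ∃ G : ℝ → ℝ, Continuous G ∧ StrictMono G ∧ (∀ t, G (t + 1) = G t + 1) ∧
      ∀ t, ∃ r : ℝ, 0 < r ∧
        a * Real.cos (Real.pi * t) + b * Real.sin (Real.pi * t) = r * Real.cos (Real.pi * G t) ∧
        c * Real.cos (Real.pi * t) + d * Real.sin (Real.pi * t)
          = r * Real.sin (Real.pi * G t) := by
  -- in complex notation, the matrix sends `e ^ {i s}` to `α e ^ {i s} + β e ^ {- i s}`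
  obtain ⟨α, hα⟩ : ∃ α : ℂ, α = ⟨(a + d) / 2, (c - b) / 2⟩ := ⟨_, rfl⟩
  obtain ⟨β, hβ⟩ : ∃ β : ℂ, β = ⟨(a - d) / 2, (c + b) / 2⟩ := ⟨_, rfl⟩
  have hsq : Complex.normSq α - Complex.normSq β = a * d - b * c := by
    rw [hα, hβ, Complex.normSq_mk, Complex.normSq_mk]; ring
  have hlt : ‖β‖ < ‖α‖ := by
    rw [Complex.normSq_eq_norm_sq, Complex.normSq_eq_norm_sq] at hsq
    nlinarith [norm_nonneg α, norm_nonneg β]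
  have hα0 : α ≠ 0 := by
    rintro rfl
    rw [norm_zero] at hlt
    exact absurd hlt (not_lt.2 (norm_nonneg β))
  let w : ℝ → ℂ := fun t => 1 + β / α * Complex.exp (((-2 * (Real.pi * t) : ℝ) : ℂ) * Complex.I)
  have hwre : ∀ t, 0 < (w t).re := by
    intro t
    have h1 : ‖β / α * Complex.exp (((-2 * (Real.pi * t) : ℝ) : ℂ) * Complex.I)‖ < 1 := by
      rw [norm_mul, Complex.norm_exp_ofReal_mul_I, mul_one, norm_div,
        div_lt_one (norm_pos_iff.2 hα0)]
      exact hlt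
    have h2 := (abs_le.1 ((Complex.abs_re_le_norm _).trans h1.le)).1
    have h3 := (abs_lt.1 ((Complex.abs_re_le_norm _).trans_lt h1)).1
    simp only [w, Complex.add_re, Complex.one_re]
    linarith
  have hwc : Continuous w := by
    simp only [w]; fun_prop
  have hargc : Continuous fun t => Complex.arg (w t) := by
    rw [continuous_iff_continuousAt]
    intro t
    exact (Complex.continuousAt_arg (Or.inl (hwre t))).comp hwc.continuousAt
  let G : ℝ → ℝ := fun t => (Complex.arg α + Complex.arg (w t)) / Real.pi + t
  have hGc : Continuous G := by
    simp only [G]; fun_prop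
  have hw1 : ∀ t, w (t + 1) = w t := by
    intro t
    have : (((-2 * (Real.pi * (t + 1)) : ℝ) : ℂ) * Complex.I)
        = ((-2 * (Real.pi * t) : ℝ) : ℂ) * Complex.I - 2 * Real.pi * Complex.I := by
      push_cast; ring
    simp only [w]
    rw [this, Complex.exp_sub, Complex.exp_two_pi_mul_I, div_one]
  have hG1 : ∀ t, G (t + 1) = G t + 1 := by
    intro t
    simp only [G, hw1]; ring
  have hpol : ∀ t, α * Complex.exp (((Real.pi * t : ℝ) : ℂ) * Complex.I)
      + β * Complex.exp (((-(Real.pi * t) : ℝ) : ℂ) * Complex.I)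
        = ((‖α‖ * ‖w t‖ : ℝ) : ℂ) * Complex.exp (((Real.pi * G t : ℝ) : ℂ) * Complex.I) := by
    intro t
    have e1 : Real.pi * G t = Complex.arg α + Complex.arg (w t) + Real.pi * t := by
      simp only [G]
      field_simp
    have e2 : Complex.exp (((Real.pi * G t : ℝ) : ℂ) * Complex.I)
        = Complex.exp (Complex.arg α * Complex.I) * Complex.exp (Complex.arg (w t) * Complex.I)
          * Complex.exp (((Real.pi * t : ℝ) : ℂ) * Complex.I) := by
      rw [e1, ← Complex.exp_add, ← Complex.exp_add]
      congr 1; push_cast; ring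
    have e3 : Complex.exp (((-(Real.pi * t) : ℝ) : ℂ) * Complex.I)
        = Complex.exp (((-2 * (Real.pi * t) : ℝ) : ℂ) * Complex.I)
          * Complex.exp (((Real.pi * t : ℝ) : ℂ) * Complex.I) := by
      rw [← Complex.exp_add]
      congr 1; push_cast; ring
    have e4 : ((‖α‖ * ‖w t‖ : ℝ) : ℂ) * (Complex.exp (Complex.arg α * Complex.I)
        * Complex.exp (Complex.arg (w t) * Complex.I)) = α * w t := by
      calc _ = ((‖α‖ : ℂ) * Complex.exp (Complex.arg α * Complex.I))
            * ((‖w t‖ : ℂ) * Complex.exp (Complex.arg (w t) * Complex.I)) := by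
              push_cast; ring
        _ = _ := by rw [Complex.norm_mul_exp_arg_mul_I, Complex.norm_mul_exp_arg_mul_I]
    rw [e2, ← mul_assoc, e4, e3]
    simp only [w]
    field_simp
  have hcoord : ∀ t, a * Real.cos (Real.pi * t) + b * Real.sin (Real.pi * t)
        = ‖α‖ * ‖w t‖ * Real.cos (Real.pi * G t) ∧
      c * Real.cos (Real.pi * t) + d * Real.sin (Real.pi * t)
        = ‖α‖ * ‖w t‖ * Real.sin (Real.pi * G t) := by
    intro t
    have key := hpol t
    have hre := congrArg Complex.re key
    have him := congrArg Complex.im key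
    simp only [Complex.add_re, Complex.add_im, Complex.mul_re, Complex.mul_im,
      Complex.exp_ofReal_mul_I_re, Complex.exp_ofReal_mul_I_im, Complex.ofReal_re,
      Complex.ofReal_im, Real.cos_neg, Real.sin_neg, zero_mul, sub_zero, add_zero] at hre him
    rw [← hre, ← him, hα, hβ]
    constructor <;> ring
  have hr : ∀ t, 0 < ‖α‖ * ‖w t‖ := by
    intro t
    have : w t ≠ 0 := by
      intro h0
      have := hwre t
      rw [h0] at this
      simp at this
    exact mul_pos (norm_pos_iff.2 hα0) (norm_pos_iff.2 this)
  have hinj : Function.Injective G := by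
    intro s t hst
    obtain ⟨hs1, hs2⟩ := hcoord s
    obtain ⟨ht1, ht2⟩ := hcoord t
    rw [hst] at hs1 hs2
    have hrs := hr s
    have hrt := hr t
    set p := ‖α‖ * ‖w s‖
    set q := ‖α‖ * ‖w t‖
    have hD : a * d - b * c ≠ 0 := h.ne'
    have hc : q * Real.cos (Real.pi * s) = p * Real.cos (Real.pi * t) := by
      apply mul_left_cancel₀ hD
      linear_combination d * q * hs1 - b * q * hs2 - d * p * ht1 + b * p * ht2
    have hsn : q * Real.sin (Real.pi * s) = p * Real.sin (Real.pi * t) := by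
      apply mul_left_cancel₀ hD
      linear_combination a * q * hs2 - c * q * hs1 - a * p * ht2 + c * p * ht1
    have hpq : p = q := by
      have h1 := Real.cos_sq_add_sin_sq (Real.pi * s)
      have h2 := Real.cos_sq_add_sin_sq (Real.pi * t)
      have h3 : q ^ 2 = p ^ 2 := by
        linear_combination (q * Real.cos (Real.pi * s) + p * Real.cos (Real.pi * t)) * hc
          + (q * Real.sin (Real.pi * s) + p * Real.sin (Real.pi * t)) * hsn
          - q ^ 2 * h1 + p ^ 2 * h2
      nlinarith
    rw [hpq] at hc hsn
    have hc' := mul_left_cancel₀ hrt.ne' hc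
    have hs' := mul_left_cancel₀ hrt.ne' hsn
    have hang := Real.Angle.cos_sin_inj hc' hs'
    obtain ⟨k, hk⟩ := Real.Angle.angle_eq_iff_two_pi_dvd_sub.1 hang
    have hk' : s = t + (2 * k : ℤ) := by
      have : Real.pi * (s - t - 2 * k) = 0 := by linear_combination hk
      rcases mul_eq_zero.1 this with h0 | h0
      · exact absurd h0 Real.pi_ne_zero
      · push_cast; linarith
    have hGk : ∀ (m : ℤ) (y : ℝ), G (y + m) = G y + m := by
      intro m y
      induction m using Int.induction_on with
      | zero => simp
      | succ n ih =>
        have := hG1 (y + ((n : ℤ) : ℝ))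
        push_cast at this ih ⊢
        rw [← add_assoc, this, ih, add_assoc]
      | pred n ih =>
        have := hG1 (y + (((-(n : ℤ) - 1 : ℤ)) : ℝ))
        have e : y + (((-(n : ℤ) - 1 : ℤ)) : ℝ) + 1 = y + ((-(n : ℤ) : ℤ) : ℝ) := by
          push_cast; ring
        rw [e, ih] at this
        push_cast at this ⊢
        linarith
    rw [hk', hGk] at hst
    have : ((2 * k : ℤ) : ℝ) = 0 := by linarith
    rw [hk', this, add_zero]
  refine ⟨G, hGc, ?_, hG1, fun t => ⟨_, hr t, hcoord t⟩⟩
  rcases hGc.strictMono_of_inj hinj with h1 | h1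
  · exact h1
  · have h2 := h1 (lt_add_one (0 : ℝ))
    rw [hG1] at h2
    linarith

namespace LinearCocycle

open OrientedPlaneBundle

variable {T : X ≃ₜ X} (A : LinearCocycle F V T) {E : OrientedPlaneBundle F V}

/-- The map induced by the restriction of the cocycle to `E` on the projective bundle of `E`. -/
def projMap (h : A.PreservesOrientation E) (p : E.Proj) : E.Proj :=
  ⟨T p.base, Projectivization.map
    (((A.onFiber p.base).ofSubmodules (E.fiber p.base) (E.fiber (T p.base))
      (h.map_fiber p.base) : E.fiber p.base ≃ₗ[ℝ] E.fiber (T p.base)) :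
        E.fiber p.base →ₗ[ℝ] E.fiber (T p.base))
    (LinearEquiv.injective _) p.line⟩

theorem continuous_projMap (h : A.PreservesOrientation E) : Continuous (A.projMap h) := by
  rw [continuous_coinduced_dom]
  let f : {v : TotalSpace F V // v.snd ∈ E.fiber v.proj ∧ v.snd ≠ 0} →
      {v : TotalSpace F V // v.snd ∈ E.fiber v.proj ∧ v.snd ≠ 0} := fun v =>
    ⟨A.total v.1, by
      refine ⟨?_, fun h0 => v.2.2 ((LinearEquiv.map_eq_zero_iff _).1 h0)⟩
      change A.onFiber v.1.proj v.1.snd ∈ E.fiber (T v.1.proj)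
      rw [← h.map_fiber]
      exact Submodule.mem_map_of_mem v.2.1⟩
  have hf : Continuous f :=
    Continuous.subtype_mk (A.continuous_total.comp continuous_subtype_val) _
  have hcomp : A.projMap h ∘ Proj.mk' E = Proj.mk' E ∘ f := rfl
  rw [hcomp]
  exact continuous_coinduced_rng.comp hf

theorem isSkewProduct_projMap (h : A.PreservesOrientation E) :
    E.IsSkewProduct T ⟨A.projMap h, A.continuous_projMap h⟩ := by
  refine ⟨fun p => rfl, fun x b b' => ?_⟩
  obtain ⟨L, hL⟩ : ∃ L : E.fiber x ≃ₗ[ℝ] E.fiber (T x), L = (A.onFiber x).ofSubmodules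
    (E.fiber x) (E.fiber (T x)) (h.map_fiber x) := ⟨_, rfl⟩
  have hor : b'.1.toBasis.orientation = (b.1.toBasis.map L).orientation := by
    rw [Module.Basis.orientation_map, b.2, b'.2, hL, h.map_orient]
  rw [Module.Basis.orientation_eq_iff_det_pos, Module.Basis.det_apply, Matrix.det_fin_two] at hor
  simp only [Module.Basis.toMatrix_apply, Module.Basis.map_apply, OrthonormalBasis.coe_toBasis,
    OrthonormalBasis.coe_toBasis_repr_apply, mul_comm (b'.1.repr (L (b.1 1)) 0)] at hor
  obtain ⟨G, hGc, hGm, hG1, hG⟩ := exists_lift_of_det_pos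
    (a := b'.1.repr (L (b.1 0)) 0) (b := b'.1.repr (L (b.1 1)) 0)
    (c := b'.1.repr (L (b.1 0)) 1) (d := b'.1.repr (L (b.1 1)) 1) (by linarith)
  refine ⟨G, hGc, hGm, hG1, fun t => ?_⟩
  obtain ⟨r, hr, h1, h2⟩ := hG t
  have e0 := b'.1.sum_repr (L (b.1 0))
  have e1 := b'.1.sum_repr (L (b.1 1))
  rw [Fin.sum_univ_two] at e0 e1
  have key : L (Real.cos (Real.pi * t) • b.1 0 + Real.sin (Real.pi * t) • b.1 1)
      = r • (Real.cos (Real.pi * G t) • b'.1 0 + Real.sin (Real.pi * G t) • b'.1 1) := by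
    rw [map_add, map_smul, map_smul, smul_add, smul_smul, smul_smul, ← h1, ← h2]
    nth_rewrite 1 [← e0]
    nth_rewrite 1 [← e1]
    module
  have goal : Projectivization.map (L : E.fiber x →ₗ[ℝ] E.fiber (T x)) L.injective
      (Projectivization.mk ℝ
        (Real.cos (Real.pi * t) • b.1 0 + Real.sin (Real.pi * t) • b.1 1) (cover_ne_zero b t))
      = Projectivization.mk ℝ
        (Real.cos (Real.pi * G t) • b'.1 0 + Real.sin (Real.pi * G t) • b'.1 1)
        (cover_ne_zero b' (G t)) := by
    rw [Projectivization.map_mk, Projectivization.mk_eq_mk_iff']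
    exact ⟨r, key.symm⟩
  subst hL
  exact congrArg (Proj.mk (T x)) goal

/-- The projectivization of the restriction of the cocycle to `E`, as a skew-product. -/
def projectivization (h : A.PreservesOrientation E) : E.SkewProduct T :=
  ⟨⟨A.projMap h, A.continuous_projMap h⟩, A.isSkewProduct_projMap h⟩

end LinearCocycle

end Cocycles

end

/-!
The restriction of the cocycle to the planes of `E` is compared with its projective action by means
of two functions of the lines of `E`: `rate`, the square of the stretching of a line divided by the
area scaling of its plane, and `growth`, the product of the rates along an orbit. The basic fact is
the chord identity `chord_sq_eq_growth_mul`: the squared chord between two lines of the same plane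
is the squared chord between their images times the product of their growths. So the growth is the
inverse of the derivative of the projective action, and a dominated splitting is a pair of
continuous invariant sections of the projective bundle whose growths have, after some time, a ratio
larger than `4` (the square of the `2` in the definition of domination).

*Domination implies mode-locking.* By the chord identity, a closed cone around the dominating line
is mapped by the iterates into its interior, and this persists for all nearby skew-products. Hence,
along all paths in a small uniform ball, the orbit of the dominating line avoids the dominated one
(`LinearCocycle.exists_uniformBall_avoid`). So its winding numbers are bounded, and the rotation
numbers vanish. The uniform balls are contractible along short arcs
(`OrientedPlaneBundle.isSimplyConnected_uniformBall`), so they are admissible neighborhoods.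

*Mode-locking implies domination.* The projective action `f` is composed with the rotations of
angles between `-π θ` and `π θ`, all of which have rotation number zero. The `spread` of an orbit is
the difference between the lifts of its extreme perturbations. Once the spread is at least one at a
given time for all lines above a set of base points, each visit to this set adds one turn to it,
so the set has measure zero (`OrientedPlaneBundle.measure_eq_zero_of_one_le_spread`). By
compactness, above each point of the support and for each length there is an orbit whose spread
stays below one (`OrientedPlaneBundle.IsModeLocked.exists_spread_lt_one`). It is surrounded by arcs
each of which is mapped by `f` into the next one, with a margin `θ` on both sides. To such an arc is
attached the quadratic form `arcForm`, which is positive on the lines inside the arc and negative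
outside. The cocycle transports this form up to the rates, and adding the margins to an arc
increases the form by a factor at least `1 + sin (π θ)` where it is positive, and decreases its
absolute value by such a factor outside the widened arc. This gives an exponential expansion
inside the arcs (`LinearCocycle.le_growth_of_strip`) and an exponential contraction along an orbit outside
(`LinearCocycle.exists_growth_le_of_strip`). The constants do not depend on the length, so by
compactness there are, in each plane above the support, a line which is contracted for all future
times and a line which has been expanded for all past times. The chord identity makes them unique,
hence continuous and invariant (`LinearCocycle.exists_sections`).
-/

noncomputable section

set_option linter.unusedSectionVars false

/-! ### Angles on the circle and frames of an oriented plane -/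

/-- The point of the unit circle at `s` turns from `1`. -/
def turn (s : ℝ) : Circle := Circle.exp (2 * Real.pi * s)

theorem turn_add (s t : ℝ) : turn (s + t) = turn s * turn t := by
  simp only [turn, mul_add, Circle.exp_add]

theorem turn_sub (s t : ℝ) : turn (s - t) = turn s / turn t := by
  rw [eq_div_iff_mul_eq', mul_comm, ← turn_add]; simp

theorem turn_eq_turn {s t : ℝ} : turn s = turn t ↔ ∃ n : ℤ, t = s + n := by
  rw [turn, turn, Circle.exp_eq_exp]
  have hp := Real.pi_pos
  constructor
  · rintro ⟨m, hm⟩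
    refine ⟨-m, ?_⟩
    have : 2 * Real.pi * (s - t - m) = 0 := by linear_combination hm
    rcases mul_eq_zero.1 this with h | h
    · linarith
    · push_cast; linarith
  · rintro ⟨n, rfl⟩
    exact ⟨-n, by push_cast; ring⟩

theorem turn_surjective (z : Circle) : ∃ s, turn s = z := by
  refine ⟨Complex.arg z / (2 * Real.pi), ?_⟩
  rw [turn, mul_div_cancel₀ _ (by positivity), Circle.exp_arg]

theorem dist_turn (s t : ℝ) : dist (turn s) (turn t) = 2 * |Real.sin (Real.pi * (t - s))| := by
  have h1 : dist (turn s) (turn t) = ‖((turn s : Circle) : ℂ) - (turn t : Circle)‖ := by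
    rw [← dist_eq_norm]; rfl
  have h2 : ((turn s : Circle) : ℂ) - (turn t : Circle)
      = Complex.exp (((Real.pi * (s + t) : ℝ) : ℂ) * Complex.I) *
        (-(2 * (Real.sin (Real.pi * (t - s)) : ℝ)) * Complex.I) := by
    have e1 : (((2 * Real.pi * s : ℝ) : ℂ) * Complex.I) = ((Real.pi * (s + t) : ℝ) : ℂ) * Complex.I
        + (-((Real.pi * (t - s) : ℝ) : ℂ)) * Complex.I := by push_cast; ring
    have e2 : (((2 * Real.pi * t : ℝ) : ℂ) * Complex.I) = ((Real.pi * (s + t) : ℝ) : ℂ) * Complex.I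
        + ((Real.pi * (t - s) : ℝ) : ℂ) * Complex.I := by push_cast; ring
    simp only [turn, Circle.coe_exp]
    rw [e1, e2, Complex.exp_add, Complex.exp_add, ← mul_sub]
    congr 1
    rw [Complex.exp_mul_I, Complex.exp_mul_I, Complex.cos_neg, Complex.sin_neg]
    push_cast; ring
  rw [h1, h2, norm_mul, Complex.norm_exp_ofReal_mul_I, norm_mul, norm_neg, norm_mul,
    Complex.norm_real, Complex.norm_I, Real.norm_eq_abs]
  simp

/-- Real-valued functions on a connected space that take integer values only are constant. -/
theorem eq_of_continuous_of_forall_int {Y : Type*} [TopologicalSpace Y] [PreconnectedSpace Y]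
    {d : Y → ℝ} (hd : Continuous d) (h : ∀ y, ∃ n : ℤ, d y = n) (y z : Y) : d y = d z := by
  wlog hyz : d y < d z generalizing y z
  · rcases lt_trichotomy (d y) (d z) with h1 | h1 | h1
    · exact absurd h1 hyz
    · exact h1
    · exact (this z y h1).symm
  obtain ⟨m, hm⟩ := h y
  obtain ⟨n, hn⟩ := h z
  have hmn : m + 1 ≤ n := by
    rw [hm, hn] at hyz; exact_mod_cast hyz
  have hmn' : (m : ℝ) + 1 ≤ n := by exact_mod_cast hmn
  obtain ⟨w, hw⟩ := intermediate_value_univ y z hd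
    (show d y + 1 / 2 ∈ Icc (d y) (d z) by constructor <;> linarith)
  obtain ⟨k, hk⟩ := h w
  rw [hk, hm] at hw
  have h1 : ((2 * k : ℤ) : ℝ) = ((2 * m + 1 : ℤ) : ℝ) := by push_cast; linarith
  have h2 : 2 * k = 2 * m + 1 := by exact_mod_cast h1
  omega

/-- A continuous function on a connected space that takes no integer value
varies by less than one. -/
theorem abs_sub_lt_one_of_forall_ne_int {Y : Type*} [TopologicalSpace Y] [PreconnectedSpace Y]
    {d : Y → ℝ} (hd : Continuous d) (h : ∀ y, ∀ n : ℤ, d y ≠ n) (y z : Y) : |d y - d z| < 1 := by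
  wlog hyz : d z ≤ d y generalizing y z
  · rw [abs_sub_comm]; exact this z y (le_of_not_ge hyz)
  rw [abs_of_nonneg (by linarith)]
  by_contra! hcon
  obtain ⟨w, hw⟩ := intermediate_value_univ z y hd
    (show ((⌊d z⌋ + 1 : ℤ) : ℝ) ∈ Icc (d z) (d y) by
      push_cast
      constructor
      · exact (Int.lt_floor_add_one _).le
      · linarith [Int.floor_le (d z)])
  exact h w _ hw

/-- Gram-Schmidt orthonormalization of a basis of a plane, with an explicit formula. -/
theorem exists_orthonormalBasis_of_basis {W : Type*} [NormedAddCommGroup W]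
    [InnerProductSpace ℝ W] (e : Module.Basis (Fin 2) ℝ W) :
    ∃ b : OrthonormalBasis (Fin 2) ℝ W, b.toBasis.orientation = e.orientation ∧ ∃ w : W,
      w = ‖e 0‖ ^ 2 • e 1 - (inner ℝ (e 0) (e 1) : ℝ) • e 0 ∧ w ≠ 0 ∧
      b 0 = ‖e 0‖⁻¹ • e 0 ∧ b 1 = ‖w‖⁻¹ • w := by
  obtain ⟨r, hr⟩ : ∃ r, r = ‖e 0‖ := ⟨_, rfl⟩
  have hr0 : r ≠ 0 := hr ▸ norm_ne_zero_iff.2 (e.ne_zero 0)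
  have hrpos : 0 < r := lt_of_le_of_ne (hr ▸ norm_nonneg _) hr0.symm
  rw [← hr]
  obtain ⟨w, hw⟩ : ∃ w : W, w = r ^ 2 • e 1 - (inner ℝ (e 0) (e 1) : ℝ) • e 0 := ⟨_, rfl⟩
  have hw0 : w ≠ 0 := by
    intro h0
    have h1 := congrArg (fun v => e.repr v 1) (hw.symm.trans h0)
    simp [hr0] at h1
  have hwn : ‖w‖ ≠ 0 := norm_ne_zero_iff.2 hw0
  have hwpos : 0 < ‖w‖ := lt_of_le_of_ne (norm_nonneg _) hwn.symm
  have horth : inner ℝ (e 0) w = (0 : ℝ) := by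
    rw [hw, inner_sub_right, real_inner_smul_right, real_inner_smul_right,
      real_inner_self_eq_norm_sq, hr]
    ring
  have hn0 : ‖r⁻¹ • e 0‖ = 1 := by
    rw [norm_smul, norm_inv, ← hr, Real.norm_of_nonneg hrpos.le, inv_mul_cancel₀ hr0]
  have hn1 : ‖‖w‖⁻¹ • w‖ = 1 := by
    rw [norm_smul, norm_inv, norm_norm, inv_mul_cancel₀ hwn]
  have hon : Orthonormal ℝ ![r⁻¹ • e 0, ‖w‖⁻¹ • w] := by
    refine ⟨fun i => ?_, fun i j hij => ?_⟩
    · fin_cases i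
      · exact hn0
      · exact hn1
    · have h01 : inner ℝ (r⁻¹ • e 0) (‖w‖⁻¹ • w) = (0 : ℝ) := by
        rw [real_inner_smul_left, real_inner_smul_right, horth, mul_zero, mul_zero]
      fin_cases i <;> fin_cases j
      · exact absurd rfl hij
      · exact h01
      · exact (real_inner_comm _ _).trans h01
      · exact absurd rfl hij
  have hfin : Module.finrank ℝ W = 2 := by
    simpa using Module.finrank_eq_card_basis e
  have : FiniteDimensional ℝ W := e.finiteDimensional_of_finite
  let B := basisOfOrthonormalOfCardEqFinrank hon (by simp [hfin])
  have hB : ⇑B = ![r⁻¹ • e 0, ‖w‖⁻¹ • w] := coe_basisOfOrthonormalOfCardEqFinrank hon _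
  have hBo : Orthonormal ℝ B := by rw [hB]; exact hon
  have hor : e.orientation = B.orientation := by
    rw [Module.Basis.orientation_eq_iff_det_pos, Module.Basis.det_apply, Matrix.det_fin_two]
    have hB0 : B 0 = r⁻¹ • e 0 := by rw [hB]; rfl
    have hB1 : B 1 = ‖w‖⁻¹ • w := by rw [hB]; rfl
    simp only [Module.Basis.toMatrix_apply, hB0, hB1, hw, map_smul, map_sub, Finsupp.smul_apply,
      Finsupp.sub_apply, Module.Basis.repr_self, Finsupp.single_apply, smul_eq_mul]
    rw [← hw]
    simp
    positivity
  refine ⟨B.toOrthonormalBasis hBo, ?_, w, hw, hw0, ?_, ?_⟩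
  · rw [Module.Basis.toBasis_toOrthonormalBasis, hor]
  · rw [Module.Basis.coe_toOrthonormalBasis, hB]; rfl
  · rw [Module.Basis.coe_toOrthonormalBasis, hB]; rfl

namespace OrientedPlaneBundle

variable {X : Type*} [TopologicalSpace X] {F : Type*}
  {V : X → Type*} [TopologicalSpace (TotalSpace F V)]
  [∀ x, NormedAddCommGroup (V x)] [∀ x, InnerProductSpace ℝ (V x)]
  {E : OrientedPlaneBundle F V} {x : X}

/-- The unit vector at angle `π t` from the first vector of the frame `b`. -/
def ray (b : E.Frame x) (t : ℝ) : E.fiber x :=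
  Real.cos (Real.pi * t) • b.1 0 + Real.sin (Real.pi * t) • b.1 1

theorem inner_zero_ray (b : E.Frame x) (t : ℝ) :
    inner ℝ (b.1 0) (ray b t) = Real.cos (Real.pi * t) := by
  simp [ray, inner_add_right, inner_smul_right]

theorem inner_one_ray (b : E.Frame x) (t : ℝ) :
    inner ℝ (b.1 1) (ray b t) = Real.sin (Real.pi * t) := by
  simp [ray, inner_add_right, inner_smul_right]

theorem ray_ne_zero (b : E.Frame x) (t : ℝ) : ray b t ≠ 0 := cover_ne_zero b t

theorem eq_inner_smul_add (b : E.Frame x) (v : E.fiber x) :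
    v = (inner ℝ (b.1 0) v : ℝ) • b.1 0 + (inner ℝ (b.1 1) v : ℝ) • b.1 1 := by
  conv_lhs => rw [← b.1.sum_repr' v]
  rw [Fin.sum_univ_two]

theorem ext_inner (b : E.Frame x) {v w : E.fiber x}
    (h0 : inner ℝ (b.1 0) v = (inner ℝ (b.1 0) w : ℝ))
    (h1 : inner ℝ (b.1 1) v = (inner ℝ (b.1 1) w : ℝ)) : v = w := by
  rw [eq_inner_smul_add b v, eq_inner_smul_add b w, h0, h1]

theorem inner_eq_coord (b : E.Frame x) (v w : E.fiber x) :
    (inner ℝ v w : ℝ) = inner ℝ (b.1 0) v * inner ℝ (b.1 0) w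
      + inner ℝ (b.1 1) v * inner ℝ (b.1 1) w := by
  conv_lhs => rw [eq_inner_smul_add b v]
  rw [inner_add_left, real_inner_smul_left, real_inner_smul_left]

theorem norm_ray (b : E.Frame x) (t : ℝ) : ‖ray b t‖ = 1 := by
  have h : ‖ray b t‖ ^ 2 = 1 := by
    rw [← real_inner_self_eq_norm_sq, inner_eq_coord b, inner_zero_ray, inner_one_ray]
    linarith [Real.cos_sq_add_sin_sq (Real.pi * t)]
  exact (pow_eq_one_iff_of_nonneg (norm_nonneg _) two_ne_zero).1 h

theorem exists_eq_norm_smul_ray (b : E.Frame x) (v : E.fiber x) : ∃ t, v = ‖v‖ • ray b t := by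
  set z : ℂ := ⟨inner ℝ (b.1 0) v, inner ℝ (b.1 1) v⟩ with hz
  have hn : ‖z‖ = ‖v‖ := by
    rw [← sq_eq_sq₀ (norm_nonneg _) (norm_nonneg _), ← Complex.normSq_eq_norm_sq,
      ← real_inner_self_eq_norm_sq, inner_eq_coord b, hz, Complex.normSq_mk]
  refine ⟨z.arg / Real.pi, ext_inner b ?_ ?_⟩
  · rw [real_inner_smul_right, inner_zero_ray, mul_div_cancel₀ _ Real.pi_ne_zero, ← hn,
      Complex.norm_mul_cos_arg]
  · rw [real_inner_smul_right, inner_one_ray, mul_div_cancel₀ _ Real.pi_ne_zero, ← hn,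
      Complex.norm_mul_sin_arg]

theorem ray_add_int (b : E.Frame x) (t : ℝ) (n : ℤ) : ray b (t + n) = (-1 : ℝ) ^ n • ray b t := by
  have h1 : Real.pi * (t + n) = Real.pi * t + n * Real.pi := by ring
  rw [ray, ray, h1, Real.cos_add_int_mul_pi, Real.sin_add_int_mul_pi, smul_add, smul_smul,
    smul_smul]

theorem cover_eq_cover (b : E.Frame x) {s t : ℝ} :
    cover b s = cover b t ↔ ∃ n : ℤ, t = s + n := by
  constructor
  · intro h
    have h1 : Projectivization.mk ℝ (ray b s) (ray_ne_zero b s)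
        = Projectivization.mk ℝ (ray b t) (ray_ne_zero b t) :=
      eq_of_heq (Proj.mk.inj h).2
    rw [Projectivization.mk_eq_mk_iff'] at h1
    obtain ⟨r, hr⟩ := h1
    have hr0 := congrArg (fun v => (inner ℝ (b.1 0) v : ℝ)) hr
    have hr1 := congrArg (fun v => (inner ℝ (b.1 1) v : ℝ)) hr
    simp only [real_inner_smul_right, inner_zero_ray, inner_one_ray] at hr0 hr1
    have h2 : Real.sin (Real.pi * (t - s)) = 0 := by
      rw [mul_sub, Real.sin_sub, ← hr0, ← hr1]; ring
    obtain ⟨n, hn⟩ := Real.sin_eq_zero_iff.1 h2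
    refine ⟨n, ?_⟩
    have : Real.pi * (t - s - n) = 0 := by linear_combination -hn
    rcases mul_eq_zero.1 this with h0 | h0
    · exact absurd h0 Real.pi_ne_zero
    · linarith
  · rintro ⟨n, rfl⟩
    refine congrArg (Proj.mk x) ?_
    change Projectivization.mk ℝ (ray b s) (ray_ne_zero b s)
      = Projectivization.mk ℝ (ray b (s + n)) (ray_ne_zero b _)
    rw [Projectivization.mk_eq_mk_iff']
    refine ⟨(-1 : ℝ) ^ n, ?_⟩
    rw [ray_add_int, smul_smul, ← zpow_add₀ (by norm_num), ← two_mul, zpow_mul]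
    simp

theorem cover_eq_cover_iff_turn (b : E.Frame x) {s t : ℝ} :
    cover b s = cover b t ↔ turn s = turn t := by
  rw [cover_eq_cover, turn_eq_turn]

/-- The line spanned by `v` is the one at the angle of `v`. -/
theorem mk_smul_ray_eq_cover (b : E.Frame x) {v : E.fiber x} (hv : v ≠ 0) {r t : ℝ}
    (h : v = r • ray b t) :
    (⟨x, Projectivization.mk ℝ v hv⟩ : E.Proj) = cover b t := by
  refine congrArg (Proj.mk x) ?_
  change Projectivization.mk ℝ v hv = Projectivization.mk ℝ (ray b t) (ray_ne_zero b t)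
  rw [Projectivization.mk_eq_mk_iff']
  exact ⟨r, h.symm⟩

theorem exists_cover_eq (b : E.Frame x) {p : E.Proj} (hp : p.base = x) : ∃ t, cover b t = p := by
  obtain ⟨y, l⟩ := p
  obtain rfl : y = x := hp
  induction l using Projectivization.ind with
  | h v hv =>
    obtain ⟨t, ht⟩ := exists_eq_norm_smul_ray b v
    exact ⟨t, (mk_smul_ray_eq_cover b hv ht).symm⟩

/-- Two positively oriented orthonormal frames of a plane differ by a rotation. -/
theorem exists_ray_eq_ray_add (b b' : E.Frame x) : ∃ c, ∀ s, ray b' s = ray b (s + c) := by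
  obtain ⟨c, hc⟩ := exists_eq_norm_smul_ray b (b'.1 0)
  obtain ⟨d, hd⟩ := exists_eq_norm_smul_ray b (b'.1 1)
  rw [OrthonormalBasis.norm_eq_one, one_smul] at hc hd
  have hor : b.1.toBasis.orientation = b'.1.toBasis.orientation := b.2.trans b'.2.symm
  rw [Module.Basis.orientation_eq_iff_det_pos, Module.Basis.det_apply, Matrix.det_fin_two] at hor
  simp only [Module.Basis.toMatrix_apply, OrthonormalBasis.coe_toBasis,
    OrthonormalBasis.coe_toBasis_repr_apply, OrthonormalBasis.repr_apply_apply] at hor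
  have horth : inner ℝ (b'.1 0) (b'.1 1) = (0 : ℝ) := by
    simp
  rw [hc, hd] at horth hor
  rw [inner_eq_coord b] at horth
  simp only [inner_zero_ray, inner_one_ray] at hor horth
  have hcos : Real.cos (Real.pi * (d - c)) = 0 := by
    rw [mul_sub, Real.cos_sub]; linarith
  have hsin : 0 < Real.sin (Real.pi * (d - c)) := by
    rw [mul_sub, Real.sin_sub]; linarith
  have hsin1 : Real.sin (Real.pi * (d - c)) = 1 := by
    have := Real.cos_sq_add_sin_sq (Real.pi * (d - c))
    rw [hcos] at this
    nlinarith
  have hdc : Real.pi * d = Real.pi * c + Real.pi * (d - c) := by ring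
  have hcd : Real.cos (Real.pi * d) = -Real.sin (Real.pi * c) := by
    rw [hdc, Real.cos_add, hcos, hsin1]; ring
  have hsd : Real.sin (Real.pi * d) = Real.cos (Real.pi * c) := by
    rw [hdc, Real.sin_add, hcos, hsin1]; ring
  refine ⟨c, fun s => ?_⟩
  rw [ray, hc, hd]
  apply ext_inner b
  · simp only [inner_add_right, real_inner_smul_right, inner_zero_ray, hcd]
    rw [mul_add, Real.cos_add]; ring
  · simp only [inner_add_right, real_inner_smul_right, inner_one_ray, hsd]
    rw [mul_add, Real.sin_add]; ring

theorem exists_cover_eq_cover_add (b b' : E.Frame x) : ∃ c, ∀ s, cover b' s = cover b (s + c) := by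
  obtain ⟨c, hc⟩ := exists_ray_eq_ray_add b b'
  refine ⟨c, fun s => congrArg (Proj.mk x) ?_⟩
  change Projectivization.mk ℝ (ray b' s) (ray_ne_zero b' s)
    = Projectivization.mk ℝ (ray b (s + c)) (ray_ne_zero b _)
  congr 1
  exact hc s

instance : Nonempty (E.Frame x) := by
  obtain ⟨U, hU, e, -, he⟩ := E.exists_frame x
  obtain ⟨b, hb, -⟩ := exists_orthonormalBasis_of_basis (e x)
  exact ⟨⟨b, hb.trans (he x (mem_of_mem_nhds hU))⟩⟩

end OrientedPlaneBundle

/-! ### Charts and topology of the projective bundle -/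

/-- Linear combinations of continuous sections along a map into the base are continuous. -/
theorem ContinuousWithinAt.smul_add_smul_bundle {X : Type*} [TopologicalSpace X] {F : Type*}
    [NormedAddCommGroup F] [NormedSpace ℝ F] {V : X → Type*} [TopologicalSpace (TotalSpace F V)]
    [∀ x, AddCommGroup (V x)] [∀ x, Module ℝ (V x)] [∀ x, TopologicalSpace (V x)]
    [FiberBundle F V] [VectorBundle ℝ F V]
    {M : Type*} [TopologicalSpace M] {g : M → X} {v w : ∀ m, V (g m)} {c d : M → ℝ} {s : Set M}
    {m₀ : M} (hc : ContinuousWithinAt c s m₀) (hd : ContinuousWithinAt d s m₀)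
    (hv : ContinuousWithinAt (fun m => (⟨g m, v m⟩ : TotalSpace F V)) s m₀)
    (hw : ContinuousWithinAt (fun m => (⟨g m, w m⟩ : TotalSpace F V)) s m₀) :
    ContinuousWithinAt (fun m => (⟨g m, c m • v m + d m • w m⟩ : TotalSpace F V)) s m₀ := by
  rw [FiberBundle.continuousWithinAt_totalSpace] at hv hw ⊢
  refine ⟨hv.1, ?_⟩
  have hmem : ∀ᶠ m in 𝓝[s] m₀, g m ∈ (trivializationAt F V (g m₀)).baseSet :=
    hv.1 ((trivializationAt F V (g m₀)).open_baseSet.mem_nhds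
      (FiberBundle.mem_baseSet_trivializationAt F V (g m₀)))
  have key : ∀ m, g m ∈ (trivializationAt F V (g m₀)).baseSet →
      ((trivializationAt F V (g m₀)) ⟨g m, c m • v m + d m • w m⟩).2 =
        c m • ((trivializationAt F V (g m₀)) ⟨g m, v m⟩).2
          + d m • ((trivializationAt F V (g m₀)) ⟨g m, w m⟩).2 := by
    intro m hm
    have hl := (trivializationAt F V (g m₀)).linear ℝ hm
    rw [hl.map_add, hl.map_smul, hl.map_smul]
  refine ((hc.smul hv.2).add (hd.smul hw.2)).congr_of_eventuallyEq ?_ ?_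
  · filter_upwards [hmem] with m hm using key m hm
  · exact key m₀ (FiberBundle.mem_baseSet_trivializationAt F V (g m₀))

namespace OrientedPlaneBundle

section Pointwise

variable {X : Type*} [TopologicalSpace X] {F : Type*}
  {V : X → Type*} [TopologicalSpace (TotalSpace F V)]
  [∀ x, NormedAddCommGroup (V x)] [∀ x, InnerProductSpace ℝ (V x)]
  {E : OrientedPlaneBundle F V} {x : X}

/-- The angle of a line in the frame `b`, as a chosen real number. -/
def angleIn (b : ∀ x, E.Frame x) (p : E.Proj) : ℝ :=
  (exists_cover_eq (b p.base) (p := p) rfl).choose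

@[simp]
theorem cover_angleIn (b : ∀ x, E.Frame x) (p : E.Proj) :
    cover (b p.base) (angleIn b p) = p :=
  (exists_cover_eq (b p.base) (p := p) rfl).choose_spec

/-- The coordinate of a line in the circle, in the frame `b`. -/
def chart (b : ∀ x, E.Frame x) (p : E.Proj) : Circle := turn (angleIn b p)

@[simp]
theorem base_cover (b : E.Frame x) (t : ℝ) : (cover b t).base = x := rfl

@[simp]
theorem chart_cover (b : ∀ x, E.Frame x) (x : X) (t : ℝ) : chart b (cover (b x) t) = turn t := by
  rw [chart, ← cover_eq_cover_iff_turn (b x)]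
  exact cover_angleIn b (cover (b x) t)

theorem cover_eq_of_turn_eq (b : ∀ x, E.Frame x) {p : E.Proj} {t : ℝ} (h : turn t = chart b p) :
    cover (b p.base) t = p := by
  conv_rhs => rw [← cover_angleIn b p]
  rwa [cover_eq_cover_iff_turn]

variable (E) in
/-- A frame above each point of the base, without any continuity. -/
def someFrame (x : X) : E.Frame x := Classical.arbitrary _

/-- The difference of two lines of the same plane, as a point of the circle. -/
def rotTo (p q : E.Proj) : Circle := chart (someFrame E) q / chart (someFrame E) p

/-- The distance between two lines, measured by the chord of the circle. -/
def chord (p q : E.Proj) : ℝ := dist (chart (someFrame E) p) (chart (someFrame E) q)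

/-- The rotation by the angle `π t` in all planes. -/
def rotate (t : ℝ) (p : E.Proj) : E.Proj :=
  cover (someFrame E p.base) (angleIn (someFrame E) p + t)

@[simp]
theorem base_rotate (t : ℝ) (p : E.Proj) : (rotate t p).base = p.base := rfl

theorem rotate_cover (b : E.Frame x) (s t : ℝ) : rotate t (cover b s) = cover b (s + t) := by
  obtain ⟨c, hc⟩ := exists_cover_eq_cover_add (someFrame E x) b
  have h1 := cover_angleIn (someFrame E) (cover b s)
  rw [hc s] at h1
  change cover (someFrame E x) _ = cover (someFrame E x) _ at h1
  rw [cover_eq_cover] at h1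
  obtain ⟨n, hn⟩ := h1
  rw [hc (s + t), hc s]
  change cover (someFrame E x) _ = cover (someFrame E x) _
  rw [cover_eq_cover]
  exact ⟨n, by linarith⟩

theorem rotTo_cover (b : E.Frame x) (s t : ℝ) : rotTo (cover b s) (cover b t) = turn (t - s) := by
  obtain ⟨c, hc⟩ := exists_cover_eq_cover_add (someFrame E x) b
  rw [rotTo, hc, hc, chart_cover, chart_cover, ← turn_sub]
  congr 1; ring

theorem chord_cover (b : E.Frame x) (s t : ℝ) :
    chord (cover b s) (cover b t) = 2 * |Real.sin (Real.pi * (t - s))| := by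
  obtain ⟨c, hc⟩ := exists_cover_eq_cover_add (someFrame E x) b
  rw [chord, hc, hc, chart_cover, chart_cover, dist_turn]
  congr 4; ring

theorem chord_eq_dist_rotTo (p q : E.Proj) : chord p q = dist (rotTo p q) 1 := by
  rw [chord, rotTo, dist_comm]
  set z := chart (someFrame E) p
  set w := chart (someFrame E) q
  have h1 : ∀ a b : Circle, dist a b = ‖(a : ℂ) - b‖ := fun a b => by
    rw [← dist_eq_norm]; rfl
  rw [h1, h1]
  have h2 : ((w / z : Circle) : ℂ) - (1 : Circle) = (w - z) / (z : ℂ) := by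
    rw [Circle.coe_div, Circle.coe_one]
    field_simp
  rw [h2, norm_div, Circle.norm_coe, div_one]

theorem chord_nonneg (p q : E.Proj) : 0 ≤ chord p q := dist_nonneg

theorem chord_comm (p q : E.Proj) : chord p q = chord q p := dist_comm _ _

theorem chord_self (p : E.Proj) : chord p p = 0 := dist_self _

theorem chord_triangle (p q r : E.Proj) : chord p r ≤ chord p q + chord q r :=
  dist_triangle _ _ _

theorem chord_le_two (p q : E.Proj) : chord p q ≤ 2 := by
  obtain ⟨s, hs⟩ := turn_surjective (chart (someFrame E) p)
  obtain ⟨t, ht⟩ := turn_surjective (chart (someFrame E) q)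
  rw [chord, ← hs, ← ht, dist_turn]
  linarith [Real.abs_sin_le_one (Real.pi * (t - s))]

theorem eq_of_base_eq_of_chart_eq (b : ∀ x, E.Frame x) {p q : E.Proj} (h : p.base = q.base)
    (hc : chart b p = chart b q) : p = q := by
  obtain ⟨s, rfl⟩ := exists_cover_eq (b q.base) h
  obtain ⟨t, ht⟩ := exists_cover_eq (b q.base) (p := q) rfl
  have ht' := congrArg (chart b) ht
  rw [chart_cover] at ht' hc
  refine Eq.trans ?_ ht
  rw [cover_eq_cover_iff_turn, hc, ht']

theorem chord_eq_zero {p q : E.Proj} (h : p.base = q.base) : chord p q = 0 ↔ p = q := by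
  refine ⟨fun hc => eq_of_base_eq_of_chart_eq (someFrame E) h (dist_eq_zero.1 hc), ?_⟩
  rintro rfl
  exact chord_self p

theorem chord_pos {p q : E.Proj} (h : p.base = q.base) (hne : p ≠ q) : 0 < chord p q :=
  lt_of_le_of_ne (chord_nonneg p q) fun h0 => hne ((chord_eq_zero h).1 h0.symm)

/-- The difference of lines can be computed in any frame, because two positively oriented frames
differ by a rotation. -/
theorem rotTo_eq_chart_div (b : ∀ x, E.Frame x) {p q : E.Proj} (h : p.base = q.base) :
    rotTo p q = chart b q / chart b p := by
  obtain ⟨s, rfl⟩ := exists_cover_eq (b q.base) h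
  obtain ⟨t, ht⟩ := exists_cover_eq (b q.base) (p := q) rfl
  rw [← ht]
  exact (rotTo_cover (b q.base) s t).trans (by rw [chart_cover, chart_cover, turn_sub])

end Pointwise

section Topology

variable {X : Type*} [TopologicalSpace X] {F : Type*} [NormedAddCommGroup F] [NormedSpace ℝ F]
  {V : X → Type*} [TopologicalSpace (TotalSpace F V)]
  [∀ x, NormedAddCommGroup (V x)] [∀ x, InnerProductSpace ℝ (V x)]
  [FiberBundle F V] [VectorBundle ℝ F V] [IsContinuousRiemannianBundle F V]
  {E : OrientedPlaneBundle F V}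

theorem isQuotientMap_mk' : Topology.IsQuotientMap (Proj.mk' E) := by
  refine ⟨⟨rfl⟩, fun p => ?_⟩
  obtain ⟨x, l⟩ := p
  induction l using Projectivization.ind with
  | h v hv =>
    exact ⟨⟨⟨x, v⟩, v.2, fun h => hv (Subtype.ext h)⟩, rfl⟩

theorem continuous_base : Continuous (Proj.base : E.Proj → X) := by
  rw [continuous_coinduced_dom]
  exact (FiberBundle.continuous_proj F V).comp continuous_subtype_val

/-- The frame `b` depends continuously on the point of `U`. -/
def IsContinuousFrame (b : ∀ x, E.Frame x) (U : Set X) : Prop :=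
  ∀ i, ContinuousOn (fun x => (⟨x, ((b x).1 i : V x)⟩ : TotalSpace F V)) U

/-- Near each point there is a continuous positively oriented orthonormal frame. -/
theorem exists_isContinuousFrame (x₀ : X) :
    ∃ U, IsOpen U ∧ x₀ ∈ U ∧ ∃ b : ∀ x, E.Frame x, IsContinuousFrame b U := by
  obtain ⟨U, hU, e, hec, heo⟩ := E.exists_frame x₀
  have hb : ∀ x, ∃ b : E.Frame x, x ∈ U → ∃ w : E.fiber x,
      w = ‖e x 0‖ ^ 2 • e x 1 - (inner ℝ (e x 0) (e x 1) : ℝ) • e x 0 ∧ w ≠ 0 ∧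
      b.1 0 = ‖e x 0‖⁻¹ • e x 0 ∧ b.1 1 = ‖w‖⁻¹ • w := by
    intro x
    by_cases hx : x ∈ U
    · obtain ⟨b, hb, h⟩ := exists_orthonormalBasis_of_basis (e x)
      exact ⟨⟨b, hb.trans (heo x hx)⟩, fun _ => h⟩
    · exact ⟨Classical.arbitrary _, fun h => absurd h hx⟩
  choose b hb using hb
  choose! w hw hw0 hb0 hb1 using hb
  refine ⟨interior U, isOpen_interior, mem_interior_iff_mem_nhds.2 hU, b, ?_⟩
  have hsub : interior U ⊆ U := interior_subset
  have h0 := (hec 0).mono hsub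
  have h1 := (hec 1).mono hsub
  have hin : ∀ {v v' : ∀ x, V x} (_ : ContinuousOn (fun x => (⟨x, v x⟩ : TotalSpace F V))
      (interior U)) (_ : ContinuousOn (fun x => (⟨x, v' x⟩ : TotalSpace F V)) (interior U)),
      ContinuousOn (fun x => (inner ℝ (v x) (v' x) : ℝ)) (interior U) :=
    fun hv hv' => ContinuousOn.inner_bundle hv hv'
  have hnorm : ∀ {v : ∀ x, V x} (_ : ContinuousOn (fun x => (⟨x, v x⟩ : TotalSpace F V))
      (interior U)), ContinuousOn (fun x => ‖v x‖) (interior U) := by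
    intro v hv
    refine (Real.continuous_sqrt.comp_continuousOn (hin hv hv)).congr fun x _ => ?_
    exact norm_eq_sqrt_real_inner _
  have hwc : ContinuousOn (fun x => (⟨x, ((w x : E.fiber x) : V x)⟩ : TotalSpace F V))
      (interior U) := by
    have hc : ContinuousOn (fun x => (⟨x, ‖(e x 0 : V x)‖ ^ 2 • (e x 1 : V x)
        + (-(inner ℝ (e x 0 : V x) (e x 1 : V x) : ℝ)) • (e x 0 : V x)⟩ : TotalSpace F V))
        (interior U) := fun x hx =>
      ContinuousWithinAt.smul_add_smul_bundle (((hnorm h0).pow 2) x hx) ((hin h0 h1).neg x hx)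
        (h1 x hx) (h0 x hx)
    refine hc.congr fun x hx => ?_
    simp only [neg_smul, ← sub_eq_add_neg]
    rw [hw x (hsub hx)]
    rfl
  intro i
  fin_cases i
  · have hc : ContinuousOn (fun x => (⟨x, ‖(e x 0 : V x)‖⁻¹ • (e x 0 : V x)
        + (0 : ℝ) • (e x 0 : V x)⟩ : TotalSpace F V)) (interior U) := fun x hx =>
      ContinuousWithinAt.smul_add_smul_bundle
        ((hnorm h0 x hx).inv₀ (norm_ne_zero_iff.2 fun h => (e x).ne_zero 0 (Subtype.ext h)))
        continuousWithinAt_const (h0 x hx) (h0 x hx)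
    refine hc.congr fun x hx => ?_
    have := hb0 x (hsub hx)
    simp only [Fin.zero_eta, zero_smul, add_zero]
    rw [this]
    rfl
  · have hc : ContinuousOn (fun x => (⟨x, ‖(w x : V x)‖⁻¹ • (w x : V x)
        + (0 : ℝ) • (w x : V x)⟩ : TotalSpace F V)) (interior U) := fun x hx =>
      ContinuousWithinAt.smul_add_smul_bundle
        ((hnorm hwc x hx).inv₀ (norm_ne_zero_iff.2 fun h => hw0 x (hsub hx) (Subtype.ext h)))
        continuousWithinAt_const (hwc x hx) (hwc x hx)
    refine hc.congr fun x hx => ?_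
    have := hb1 x (hsub hx)
    simp only [Fin.mk_one, zero_smul, add_zero]
    rw [this]
    rfl

variable {b : ∀ x, E.Frame x} {U : Set X}

theorem IsContinuousFrame.continuousOn_ray (hb : IsContinuousFrame b U) :
    ContinuousOn (fun z : X × ℝ => (⟨z.1, (ray (b z.1) z.2 : V z.1)⟩ : TotalSpace F V))
      (U ×ˢ univ) := by
  intro z hz
  have hf : ContinuousWithinAt (Prod.fst : X × ℝ → X) (U ×ˢ univ) z :=
    continuous_fst.continuousWithinAt
  have hc : ∀ i, ContinuousWithinAt (fun z : X × ℝ =>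
      (⟨z.1, ((b z.1).1 i : V z.1)⟩ : TotalSpace F V)) (U ×ˢ univ) z := fun i =>
    ContinuousWithinAt.comp (t := U) (hb i z.1 hz.1) hf (fun y hy => hy.1)
  exact ContinuousWithinAt.smul_add_smul_bundle (c := fun z : X × ℝ => Real.cos (Real.pi * z.2))
    (d := fun z : X × ℝ => Real.sin (Real.pi * z.2))
    (by fun_prop) (by fun_prop) (hc 0) (hc 1)

theorem IsContinuousFrame.continuousOn_cover (hb : IsContinuousFrame b U) :
    ContinuousOn (fun z : X × ℝ => cover (b z.1) z.2) (U ×ˢ univ) := by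
  rw [continuousOn_iff_continuous_domRestrict]
  have h1 : Continuous fun z : (U ×ˢ univ : Set (X × ℝ)) =>
      (⟨⟨z.1.1, ray (b z.1.1) z.1.2⟩, (ray (b z.1.1) z.1.2).2,
        fun h => ray_ne_zero _ _ (Subtype.ext h)⟩ :
          {v : TotalSpace F V // v.snd ∈ E.fiber v.proj ∧ v.snd ≠ 0}) :=
    Continuous.subtype_mk (continuousOn_iff_continuous_domRestrict.1 hb.continuousOn_ray) _
  exact isQuotientMap_mk'.continuous.comp h1

/-- In complex coordinates, the chart sends the line of `z` to `z ^ 2 / |z| ^ 2`. -/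
theorem chart_mk' (b : ∀ x, E.Frame x)
    (v : {v : TotalSpace F V // v.snd ∈ E.fiber v.proj ∧ v.snd ≠ 0}) :
    ((chart b (Proj.mk' E v) : Circle) : ℂ) =
      ((inner ℝ ((b v.1.proj).1 0 : V v.1.proj) v.1.snd : ℝ)
        + (inner ℝ ((b v.1.proj).1 1 : V v.1.proj) v.1.snd : ℝ) * Complex.I) ^ 2
        / ((inner ℝ v.1.snd v.1.snd : ℝ) : ℂ) := by
  obtain ⟨⟨x, v⟩, hv, hv0⟩ := v
  have hv0' : (⟨v, hv⟩ : E.fiber x) ≠ 0 := fun h => hv0 (congrArg Subtype.val h)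
  obtain ⟨t, ht⟩ := exists_eq_norm_smul_ray (b x) ⟨v, hv⟩
  have h1 : Proj.mk' E ⟨⟨x, v⟩, hv, hv0⟩ = cover (b x) t := mk_smul_ray_eq_cover (b x) hv0' ht
  rw [h1, chart_cover, turn, Circle.coe_exp]
  set r := ‖(⟨v, hv⟩ : E.fiber x)‖ with hr
  have hr0 : (r : ℂ) ≠ 0 := by exact_mod_cast norm_ne_zero_iff.2 hv0'
  have e0 : (inner ℝ ((b x).1 0 : V x) v : ℝ) = r * Real.cos (Real.pi * t) := by
    have := congrArg (fun u => (inner ℝ ((b x).1 0) u : ℝ)) ht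
    simp only [real_inner_smul_right, inner_zero_ray] at this
    exact this
  have e1 : (inner ℝ ((b x).1 1 : V x) v : ℝ) = r * Real.sin (Real.pi * t) := by
    have := congrArg (fun u => (inner ℝ ((b x).1 1) u : ℝ)) ht
    simp only [real_inner_smul_right, inner_one_ray] at this
    exact this
  have e2 : (inner ℝ v v : ℝ) = r ^ 2 := by rw [real_inner_self_eq_norm_sq]; rfl
  simp only [e0, e1, e2]
  have e3 : (((r * Real.cos (Real.pi * t) : ℝ) : ℂ)
      + ((r * Real.sin (Real.pi * t) : ℝ) : ℂ) * Complex.I)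
      = r * Complex.exp (((Real.pi * t : ℝ) : ℂ) * Complex.I) := by
    rw [Complex.exp_mul_I]; push_cast; ring
  rw [e3, mul_pow, ← Complex.exp_nat_mul]
  push_cast
  rw [mul_div_cancel_left₀ _ (pow_ne_zero 2 hr0)]
  congr 1; ring

theorem IsContinuousFrame.continuousOn_chart (hb : IsContinuousFrame b U) (hU : IsOpen U) :
    ContinuousOn (chart b) (Proj.base ⁻¹' U) := by
  rw [continuousOn_iff_continuous_domRestrict]
  have hUo : IsOpen (Proj.base ⁻¹' U : Set E.Proj) := hU.preimage continuous_base
  rw [(isQuotientMap_mk'.restrictPreimage_isOpen hUo).continuous_iff]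
  refine Continuous.subtype_mk (f := fun v : (Proj.mk' E ⁻¹' (Proj.base ⁻¹' U)) =>
    ((chart b (Proj.mk' E v.1) : Circle) : ℂ)) ?_ _
  simp only [chart_mk']
  have hv : Continuous fun v : (Proj.mk' E ⁻¹' (Proj.base ⁻¹' U)) =>
      (⟨v.1.1.proj, v.1.1.snd⟩ : TotalSpace F V) :=
    continuous_subtype_val.comp continuous_subtype_val
  have hbi : ∀ i, Continuous fun v : (Proj.mk' E ⁻¹' (Proj.base ⁻¹' U)) =>
      (⟨v.1.1.proj, ((b v.1.1.proj).1 i : V v.1.1.proj)⟩ : TotalSpace F V) := by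
    intro i
    refine (hb i).comp_continuous ((FiberBundle.continuous_proj F V).comp hv) fun v => v.2
  have hi : ∀ i, Continuous fun v : (Proj.mk' E ⁻¹' (Proj.base ⁻¹' U)) =>
      (inner ℝ ((b v.1.1.proj).1 i : V v.1.1.proj) v.1.1.snd : ℝ) :=
    fun i => Continuous.inner_bundle (hbi i) hv
  have hn : Continuous fun v : (Proj.mk' E ⁻¹' (Proj.base ⁻¹' U)) =>
      (inner ℝ v.1.1.snd v.1.1.snd : ℝ) := Continuous.inner_bundle hv hv
  refine Continuous.div ?_ (Complex.continuous_ofReal.comp hn) ?_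
  · exact ((Complex.continuous_ofReal.comp (hi 0)).add
      ((Complex.continuous_ofReal.comp (hi 1)).mul continuous_const)).pow 2
  · intro v h
    exact v.1.2.2 (inner_self_eq_zero.1 (by exact_mod_cast h))

/-- Near a line, the angle in a continuous frame has a continuous determination. -/
theorem IsContinuousFrame.exists_continuousAt_angle (hb : IsContinuousFrame b U) (hU : IsOpen U)
    {p₀ : E.Proj} (hp₀ : p₀.base ∈ U) :
    ∃ s : E.Proj → ℝ, ContinuousAt s p₀ ∧ ∀ p, cover (b p.base) (s p) = p := by
  obtain ⟨s₀, hs₀⟩ := turn_surjective (chart b p₀)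
  refine ⟨fun p => s₀ + Complex.arg (chart b p / chart b p₀ : Circle) / (2 * Real.pi), ?_, ?_⟩
  · have h1 : ContinuousAt (chart b) p₀ :=
      (hb.continuousOn_chart hU).continuousAt ((hU.preimage continuous_base).mem_nhds hp₀)
    have h2 : ContinuousAt (fun p => ((chart b p / chart b p₀ : Circle) : ℂ)) p₀ :=
      continuous_subtype_val.continuousAt.comp (h1.div' continuousAt_const)
    have h3 : ContinuousAt Complex.arg ((chart b p₀ / chart b p₀ : Circle) : ℂ) := by
      rw [div_self', Circle.coe_one]
      exact Complex.continuousAt_arg Complex.one_mem_slitPlane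
    exact continuousAt_const.add ((ContinuousAt.comp (f := fun p =>
      ((chart b p / chart b p₀ : Circle) : ℂ)) h3 h2).div_const _)
  · intro p
    apply cover_eq_of_turn_eq
    rw [turn_add, hs₀, turn, mul_div_cancel₀ _ (by positivity), Circle.exp_arg,
      mul_div_cancel]

theorem continuous_rotate : Continuous fun z : ℝ × E.Proj => rotate z.1 z.2 := by
  rw [continuous_iff_continuousAt]
  rintro ⟨t₀, p₀⟩
  obtain ⟨U, hU, hxU, b, hb⟩ := exists_isContinuousFrame (E := E) p₀.base
  obtain ⟨s, hs, hsp⟩ := hb.exists_continuousAt_angle hU hxU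
  have h1 : ∀ z : ℝ × E.Proj, rotate z.1 z.2 = cover (b z.2.base) (s z.2 + z.1) := by
    intro z
    conv_lhs => rw [← hsp z.2]
    rw [rotate_cover]
  have h2 : ContinuousAt (fun z : ℝ × E.Proj => (z.2.base, s z.2 + z.1)) (t₀, p₀) := by
    refine ContinuousAt.prodMk (continuous_base.comp continuous_snd).continuousAt ?_
    exact (ContinuousAt.comp (f := fun z : ℝ × E.Proj => z.2) hs continuousAt_snd).add
      continuousAt_fst
  have h3 : ContinuousAt (fun z : X × ℝ => cover (b z.1) z.2) (p₀.base, s p₀ + t₀) :=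
    hb.continuousOn_cover.continuousAt ((hU.prod isOpen_univ).mem_nhds ⟨hxU, mem_univ _⟩)
  simp only [h1]
  exact ContinuousAt.comp (f := fun z : ℝ × E.Proj => (z.2.base, s z.2 + z.1))
    (g := fun z : X × ℝ => cover (b z.1) z.2) h3 h2

theorem continuousOn_rotTo :
    ContinuousOn (fun z : E.Proj × E.Proj => rotTo z.1 z.2) {z | z.1.base = z.2.base} := by
  rintro ⟨p, q⟩ hpq
  obtain ⟨U, hU, hxU, b, hb⟩ := exists_isContinuousFrame (E := E) p.base
  have hpq' : p.base = q.base := hpq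
  have hc : ∀ r : E.Proj, r.base ∈ U → ContinuousAt (chart b) r := fun r hr =>
    (hb.continuousOn_chart hU).continuousAt ((hU.preimage continuous_base).mem_nhds hr)
  have hq : ContinuousAt (fun z : E.Proj × E.Proj => chart b z.2) (p, q) :=
    ContinuousAt.comp (g := chart b) (f := Prod.snd) (hc q (hpq' ▸ hxU)) continuousAt_snd
  have hp : ContinuousAt (fun z : E.Proj × E.Proj => chart b z.1) (p, q) :=
    ContinuousAt.comp (g := chart b) (f := Prod.fst) (hc p hxU) continuousAt_fst
  have h1 : ContinuousAt (fun z : E.Proj × E.Proj => chart b z.2 / chart b z.1) (p, q) :=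
    hq.div' hp
  exact h1.continuousWithinAt.congr (fun z hz => rotTo_eq_chart_div b hz)
    (rotTo_eq_chart_div b hpq)

theorem continuousOn_chord :
    ContinuousOn (fun z : E.Proj × E.Proj => chord z.1 z.2) {z | z.1.base = z.2.base} := by
  simp only [chord_eq_dist_rotTo]
  exact fun z hz => (continuousOn_rotTo z hz).dist tendsto_const_nhds

theorem isClosed_setOf_base_eq [T2Space X] :
    IsClosed {z : E.Proj × E.Proj | z.1.base = z.2.base} :=
  isClosed_eq (continuous_base.comp continuous_fst) (continuous_base.comp continuous_snd)

instance [T2Space X] : T2Space E.Proj := by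
  rw [t2_iff_isClosed_diagonal]
  have h : diagonal E.Proj = {z : E.Proj × E.Proj | z.1.base = z.2.base} ∩
      (fun z : E.Proj × E.Proj => chord z.1 z.2) ⁻¹' {0} := by
    ext ⟨p, q⟩
    constructor
    · intro h
      obtain rfl : p = q := h
      exact ⟨rfl, chord_self p⟩
    · rintro ⟨h1, h2⟩
      exact (chord_eq_zero h1).1 h2
  rw [h]
  exact continuousOn_chord.preimage_isClosed_of_isClosed isClosed_setOf_base_eq isClosed_singleton

instance [CompactSpace X] [T2Space X] : CompactSpace E.Proj := by
  have hloc : ∀ x : X, ∃ K ∈ 𝓝 x, IsCompact (Proj.base ⁻¹' K : Set E.Proj) := by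
    intro x
    obtain ⟨U, hU, hxU, b, hb⟩ := exists_isContinuousFrame (E := E) x
    obtain ⟨K, hK, hKU, hKc⟩ := local_compact_nhds (hU.mem_nhds hxU)
    refine ⟨K, hK, ?_⟩
    have himg : (Proj.base ⁻¹' K : Set E.Proj)
        = (fun z : X × ℝ => cover (b z.1) z.2) '' (K ×ˢ Icc 0 1) := by
      ext p
      constructor
      · intro hp
        refine ⟨(p.base, Int.fract (angleIn b p)),
          ⟨hp, Int.fract_nonneg _, (Int.fract_lt_one _).le⟩, ?_⟩
        conv_rhs => rw [← cover_angleIn b p]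
        rw [cover_eq_cover]
        exact ⟨⌊angleIn b p⌋, (Int.fract_add_floor _).symm⟩
      · rintro ⟨z, hz, rfl⟩
        exact hz.1
    rw [himg]
    exact (hKc.prod isCompact_Icc).image_of_continuousOn
      (hb.continuousOn_cover.mono (prod_mono hKU (subset_univ _)))
  choose K hK hKc using hloc
  obtain ⟨t, -, ht⟩ := isCompact_univ.elim_nhds_subcover K fun x _ => hK x
  refine ⟨?_⟩
  have h : (univ : Set E.Proj) = ⋃ x ∈ t, Proj.base ⁻¹' K x := by
    ext p
    have := ht (mem_univ p.base)
    simpa using this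
  rw [h]
  exact t.isCompact_biUnion fun x _ => hKc x

end Topology

end OrientedPlaneBundle

/-! ### Uniform neighborhoods of skew-products -/

/-- An increasing map of the line that commutes with the unit translation commutes with the
integer translations. -/
theorem map_add_int_of_map_add_one {G : ℝ → ℝ} (hG : Monotone G) (h1 : ∀ t, G (t + 1) = G t + 1)
    (t : ℝ) (n : ℤ) : G (t + n) = G t + n :=
  CircleDeg1Lift.map_add_int ⟨⟨G, hG⟩, h1⟩ t n

namespace OrientedPlaneBundle

section Pointwise

variable {X : Type*} [TopologicalSpace X] {F : Type*}
  {V : X → Type*} [TopologicalSpace (TotalSpace F V)]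
  [∀ x, NormedAddCommGroup (V x)] [∀ x, InnerProductSpace ℝ (V x)]
  {E : OrientedPlaneBundle F V} {T : X ≃ₜ X}

theorem SkewProduct.injective (f : E.SkewProduct T) : Function.Injective f.1 := by
  intro p q h
  have hb : p.base = q.base := by
    have := congrArg Proj.base h
    rw [f.2.1, f.2.1] at this
    exact T.injective this
  obtain ⟨s, rfl⟩ := exists_cover_eq (someFrame E q.base) hb
  obtain ⟨t, ht⟩ := exists_cover_eq (someFrame E q.base) (p := q) rfl
  obtain ⟨G, -, hGm, hG1, hG⟩ := f.2.2 q.base (someFrame E q.base) (someFrame E (T q.base))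
  refine Eq.trans ?_ ht
  have h' : f.1 (cover (someFrame E q.base) s) = f.1 (cover (someFrame E q.base) t) :=
    h.trans (congrArg f.1 ht.symm)
  rw [hG, hG, cover_eq_cover] at h'
  rw [cover_eq_cover]
  obtain ⟨n, hn⟩ := h'
  rw [← map_add_int_of_map_add_one hGm.monotone hG1] at hn
  exact ⟨n, hGm.injective hn⟩

theorem SkewProduct.base_iterate (f : E.SkewProduct T) (n : ℕ) (p : E.Proj) :
    (f.1^[n] p).base = T^[n] p.base := by
  induction n generalizing p with
  | zero => rfl
  | succ n ih => rw [Function.iterate_succ_apply, ih, f.2.1]; rfl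

/-- The signed angle in `(-1/2, 1/2]` from a line to another one of the same plane. -/
def gap (p q : E.Proj) : ℝ := Complex.arg (rotTo p q : ℂ) / (2 * Real.pi)

theorem turn_gap (p q : E.Proj) : turn (gap p q) = rotTo p q := by
  rw [gap, turn, mul_div_cancel₀ _ (by positivity), Circle.exp_arg]

theorem rotate_zero (p : E.Proj) : rotate 0 p = p := by
  rw [rotate, add_zero, cover_angleIn]

theorem rotate_gap {p q : E.Proj} (h : p.base = q.base) : rotate (gap p q) p = q := by
  obtain ⟨s, hs⟩ := exists_cover_eq (someFrame E q.base) h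
  obtain ⟨t, ht⟩ := exists_cover_eq (someFrame E q.base) (p := q) rfl
  have h1 : turn (gap p q) = turn (t - s) := by
    rw [turn_gap]
    conv_lhs => rw [← hs, ← ht]
    exact rotTo_cover _ _ _
  have h2 : rotate (gap p q) p = cover (someFrame E q.base) (s + gap p q) := by
    conv_lhs => arg 2; rw [← hs]
    rw [rotate_cover]
  rw [h2]
  refine Eq.trans ?_ ht
  rw [cover_eq_cover_iff_turn, turn_add, h1, ← turn_add]
  congr 1; ring

/-- The skew-products that are closer than `ε` to `f`. -/
def uniformBall (f : E.SkewProduct T) (ε : ℝ) : Set (E.SkewProduct T) :=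
  {g | ∀ p, chord (f.1 p) (g.1 p) < ε}

theorem self_mem_uniformBall (f : E.SkewProduct T) {ε : ℝ} (hε : 0 < ε) : f ∈ uniformBall f ε :=
  fun p => by rw [chord_self]; exact hε

theorem rotTo_mem_slitPlane {p q : E.Proj} (h : chord p q < 2) :
    (rotTo p q : ℂ) ∈ Complex.slitPlane := by
  by_contra hn
  have h1 : (rotTo p q : ℂ).re ≤ 0 ∧ (rotTo p q : ℂ).im = 0 := by
    rw [Complex.mem_slitPlane_iff] at hn
    push Not at hn
    exact hn
  have h2 := Circle.normSq_coe (rotTo p q)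
  rw [Complex.normSq_apply, h1.2] at h2
  have h3 : (rotTo p q : ℂ).re = -1 := by nlinarith
  have h4 : (rotTo p q : ℂ) = -1 := Complex.ext (by simpa using h3) (by simpa using h1.2)
  rw [chord_eq_dist_rotTo] at h
  have h5 : dist (rotTo p q) 1 = ‖(rotTo p q : ℂ) - 1‖ := by rw [← dist_eq_norm]; rfl
  rw [h5, h4] at h
  norm_num at h

end Pointwise

section Topology

variable {X : Type*} [TopologicalSpace X] {F : Type*} [NormedAddCommGroup F] [NormedSpace ℝ F]
  {V : X → Type*} [TopologicalSpace (TotalSpace F V)]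
  [∀ x, NormedAddCommGroup (V x)] [∀ x, InnerProductSpace ℝ (V x)]
  [FiberBundle F V] [VectorBundle ℝ F V] [IsContinuousRiemannianBundle F V]
  {E : OrientedPlaneBundle F V} {T : X ≃ₜ X}

theorem continuous_cover {x : X} (b : E.Frame x) : Continuous (cover b) := by
  have h : ∀ t, cover b t = rotate t (cover b 0) := fun t => by rw [rotate_cover, zero_add]
  rw [funext h]
  exact continuous_rotate.comp (continuous_id.prodMk continuous_const)

theorem continuous_gap {Y : Type*} [TopologicalSpace Y] {p q : Y → E.Proj} (hp : Continuous p)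
    (hq : Continuous q) (hb : ∀ y, (p y).base = (q y).base) (hc : ∀ y, chord (p y) (q y) < 2) :
    Continuous fun y => gap (p y) (q y) := by
  have hpq : Continuous fun y => (p y, q y) := hp.prodMk hq
  have h0 : Continuous fun y => rotTo (p y) (q y) :=
    ContinuousOn.comp_continuous (f := fun y => (p y, q y)) continuousOn_rotTo hpq hb
  have h1 : Continuous fun y => (rotTo (p y) (q y) : ℂ) := continuous_subtype_val.comp h0
  rw [continuous_iff_continuousAt]
  intro y
  have h2 : ContinuousAt (fun y => Complex.arg (rotTo (p y) (q y) : ℂ)) y :=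
    ContinuousAt.comp (f := fun y => (rotTo (p y) (q y) : ℂ))
      (Complex.continuousAt_arg (rotTo_mem_slitPlane (hc y))) h1.continuousAt
  exact h2.div_const _

variable [T2Space X] [CompactSpace X]

/-- A function on pairs of lines of the same plane that vanishes on the diagonal is uniformly small
near the diagonal. -/
theorem exists_forall_chord_lt {φ : E.Proj × E.Proj → ℝ}
    (hφ : ContinuousOn φ {z | z.1.base = z.2.base}) (h0 : ∀ p, φ (p, p) = 0) {η : ℝ}
    (hη : 0 < η) :
    ∃ δ > 0, ∀ p q : E.Proj, p.base = q.base → chord p q < δ → φ (p, q) < η := by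
  have hK : IsCompact {z : E.Proj × E.Proj | z.1.base = z.2.base ∧ η ≤ φ z} :=
    (hφ.preimage_isClosed_of_isClosed isClosed_setOf_base_eq isClosed_Ici).isCompact
  rcases eq_empty_or_nonempty {z : E.Proj × E.Proj | z.1.base = z.2.base ∧ η ≤ φ z} with he | hne
  · refine ⟨1, one_pos, fun p q hb _ => ?_⟩
    by_contra! hcon
    exact (he ▸ (⟨hb, hcon⟩ :
      (p, q) ∈ {z : E.Proj × E.Proj | z.1.base = z.2.base ∧ η ≤ φ z}) : (p, q) ∈ (∅ : Set _))
  · obtain ⟨z, hz, hmin⟩ := hK.exists_isMinOn hne (continuousOn_chord.mono fun w hw => hw.1)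
    refine ⟨chord z.1 z.2, chord_pos hz.1 ?_, fun p q hb hlt => ?_⟩
    · intro heq
      have h1 : φ z = 0 := by
        rw [show z = (z.1, z.1) from Prod.ext rfl heq.symm]; exact h0 _
      have := hz.2
      linarith
    · by_contra! hcon
      exact absurd (hmin (show (p, q) ∈ {z : E.Proj × E.Proj | z.1.base = z.2.base ∧ η ≤ φ z}
        from ⟨hb, hcon⟩)) (not_le.2 hlt)

theorem continuous_skewProduct_apply {Y : Type*} [TopologicalSpace Y] {g : Y → E.SkewProduct T}
    {p : Y → E.Proj} (hg : Continuous g) (hp : Continuous p) :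
    Continuous fun y => (g y).1 (p y) := by
  have h1 : Continuous fun y => (g y).1 := continuous_subtype_val.comp hg
  exact h1.eval hp

theorem uniformBall_mem_nhds (f : E.SkewProduct T) {ε : ℝ} (hε : 0 < ε) :
    uniformBall f ε ∈ 𝓝 f := by
  have hcl : IsClosed {z : E.Proj × E.Proj | (f.1 z.1).base = z.2.base ∧
      ε ≤ chord (f.1 z.1) z.2} := by
    have hm : Continuous fun z : E.Proj × E.Proj => (f.1 z.1, z.2) :=
      (f.1.continuous.comp continuous_fst).prodMk continuous_snd
    exact (continuousOn_chord.preimage_isClosed_of_isClosed isClosed_setOf_base_eq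
      isClosed_Ici).preimage hm
  have hopen := ContinuousMap.isOpen_setOfPred_mapsTo (isCompact_univ (X := E.Proj))
      hcl.isOpen_compl
  have hcont : Continuous fun g : E.SkewProduct T => (ContinuousMap.id E.Proj).prodMk g.1 := by
    refine ContinuousMap.continuous_of_continuous_uncurry _ ?_
    exact continuous_snd.prodMk (continuous_skewProduct_apply continuous_fst continuous_snd)
  refine mem_of_superset ((hopen.preimage hcont).mem_nhds ?_) ?_
  · intro p _ hp
    have h2 : ε ≤ chord (f.1 p) (f.1 p) := hp.2
    rw [chord_self] at h2
    linarith
  · intro g hg p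
    by_contra! hcon
    refine hg (mem_univ p) ⟨?_, hcon⟩
    change (f.1 p).base = (g.1 p).base
    rw [f.2.1, g.2.1]

theorem base_apply_eq (f g : E.SkewProduct T) (p : E.Proj) : (f.1 p).base = (g.1 p).base := by
  rw [f.2.1, g.2.1]

/-- The interpolation along short arcs between two nearby skew-products is a skew-product: its
lifts are convex combinations of lifts. -/
theorem isSkewProduct_interpolation {f : E.SkewProduct T} {ε : ℝ} (hε : ε ≤ 2)
    (g : uniformBall f ε) {s : ℝ} (hs0 : 0 ≤ s) (hs1 : s ≤ 1) (h : C(E.Proj, E.Proj))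
    (hh : ∀ p, h p = rotate (s * gap (f.1 p) (g.1.1 p)) (f.1 p)) : E.IsSkewProduct T h := by
  refine ⟨fun p => ?_, fun x b b' => ?_⟩
  · rw [hh, base_rotate, f.2.1]
  obtain ⟨G, hGc, hGm, hG1, hG⟩ := f.2.2 x b b'
  obtain ⟨G', hGc', hGm', hG1', hG'⟩ := g.1.2.2 x b b'
  have hgc : Continuous fun t => gap (f.1 (cover b t)) (g.1.1 (cover b t)) :=
    continuous_gap (f.1.continuous.comp (continuous_cover b))
      (g.1.1.continuous.comp (continuous_cover b)) (fun t => base_apply_eq f g.1 _)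
      fun t => (g.2 _).trans_le hε
  have hint : ∀ t, ∃ n : ℤ, gap (f.1 (cover b t)) (g.1.1 (cover b t)) - (G' t - G t) = n := by
    intro t
    have h1 := turn_gap (f.1 (cover b t)) (g.1.1 (cover b t))
    rw [hG, hG', rotTo_cover, eq_comm, turn_eq_turn] at h1
    obtain ⟨n, hn⟩ := h1
    rw [hG, hG']
    exact ⟨n, by linarith⟩
  obtain ⟨n, hn⟩ := hint 0
  have hconst : ∀ t, gap (f.1 (cover b t)) (g.1.1 (cover b t)) = G' t - G t + n := by
    intro t
    have := eq_of_continuous_of_forall_int (hgc.sub (hGc'.sub hGc)) hint t 0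
    simp only [Pi.sub_apply] at this
    linarith
  refine ⟨fun t => G t + s * (G' t - G t + n), by fun_prop, fun t t' ht => ?_, fun t => ?_,
    fun t => ?_⟩
  · have h1 := hGm ht
    have h2 := hGm' ht
    rcases hs1.lt_or_eq with h3 | rfl
    · simp only
      nlinarith [mul_pos (sub_pos.2 h3) (sub_pos.2 h1), mul_nonneg hs0 (sub_pos.2 h2).le]
    · simp only
      linarith
  · simp only [hG1, hG1']; ring
  · rw [hh, hconst, hG, rotate_cover]

theorem chord_rotate_mul_le (p : E.Proj) {s d : ℝ} (hs0 : 0 ≤ s) (hs1 : s ≤ 1)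
    (hd : |d| ≤ 1 / 2) : chord p (rotate (s * d) p) ≤ chord p (rotate d p) := by
  obtain ⟨t, ht⟩ := exists_cover_eq (someFrame E p.base) (p := p) rfl
  have habs : ∀ u : ℝ, |u| ≤ 1 / 2 → |Real.sin (Real.pi * u)| = Real.sin (Real.pi * |u|) := by
    intro u hu
    have := Real.pi_pos
    rcases abs_cases u with ⟨h1, h2⟩ | ⟨h1, h2⟩
    · rw [h1, abs_of_nonneg]
      exact Real.sin_nonneg_of_nonneg_of_le_pi (by positivity) (by nlinarith)
    · rw [h1, mul_neg, Real.sin_neg, abs_of_nonpos]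
      rw [← neg_nonneg, ← Real.sin_neg]
      exact Real.sin_nonneg_of_nonneg_of_le_pi (by nlinarith) (by nlinarith)
  have hsd : |s * d| ≤ |d| := by
    rw [abs_mul, abs_of_nonneg hs0]
    exact mul_le_of_le_one_left (abs_nonneg _) hs1
  generalize someFrame E p.base = b at ht
  rw [← ht, rotate_cover, rotate_cover, chord_cover, chord_cover, add_sub_cancel_left,
    add_sub_cancel_left, habs _ (hsd.trans hd), habs _ hd]
  have hpi := Real.pi_pos
  refine mul_le_mul_of_nonneg_left (Real.sin_le_sin_of_le_of_le_pi_div_two ?_ ?_ ?_) two_pos.le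
  · nlinarith [abs_nonneg (s * d)]
  · nlinarith
  · exact mul_le_mul_of_nonneg_left hsd hpi.le

theorem abs_gap_le (p q : E.Proj) : |gap p q| ≤ 1 / 2 := by
  rw [gap, abs_div, abs_of_pos (by positivity : 0 < 2 * Real.pi), div_le_iff₀ (by positivity)]
  linarith [Complex.abs_arg_le_pi (rotTo p q : ℂ)]

/-- The point at the fraction `s` of the short arc from `p` to `q`. -/
def arcPoint (s : ℝ) (p q : E.Proj) : E.Proj := rotate (s * gap p q) p

theorem continuous_arcPoint {Y : Type*} [TopologicalSpace Y] {s : Y → ℝ} {p q : Y → E.Proj}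
    (hs : Continuous s) (hp : Continuous p) (hq : Continuous q)
    (hb : ∀ y, (p y).base = (q y).base) (hc : ∀ y, chord (p y) (q y) < 2) :
    Continuous fun y => arcPoint (s y) (p y) (q y) := by
  have h1 : Continuous fun y => (s y * gap (p y) (q y), p y) :=
    (hs.mul (continuous_gap hp hq hb hc)).prodMk hp
  exact continuous_rotate.comp h1

theorem continuous_interpolation {f : E.SkewProduct T} {ε : ℝ} (hε : ε ≤ 2) :
    Continuous fun z : (unitInterval × uniformBall f ε) × E.Proj =>
      arcPoint (z.1.1 : ℝ) (f.1 z.2) (z.1.2.1.1 z.2) := by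
  have h1 : Continuous fun z : (unitInterval × uniformBall f ε) × E.Proj => (z.1.1 : ℝ) :=
    continuous_subtype_val.comp (continuous_fst.comp continuous_fst)
  have h2 : Continuous fun z : (unitInterval × uniformBall f ε) × E.Proj => z.1.2.1 :=
    continuous_subtype_val.comp (continuous_snd.comp continuous_fst)
  exact continuous_arcPoint h1 (f.1.continuous.comp continuous_snd)
    (continuous_skewProduct_apply h2 continuous_snd) (fun z => base_apply_eq f z.1.2.1 z.2)
    fun z => (z.1.2.2 z.2).trans_le hε

/-- The interpolation along short arcs between `f` and a nearby skew-product. -/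
def interpolation (f : E.SkewProduct T) {ε : ℝ} (hε : ε ≤ 2)
    (z : unitInterval × uniformBall f ε) : uniformBall f ε :=
  ⟨⟨⟨fun p => arcPoint (z.1 : ℝ) (f.1 p) (z.2.1.1 p),
      (continuous_interpolation hε).comp ((continuous_const (y := z)).prodMk continuous_id)⟩,
    isSkewProduct_interpolation hε z.2 z.1.2.1 z.1.2.2 _ fun _ => rfl⟩,
    fun p => by
      refine lt_of_le_of_lt ?_ (z.2.2 p)
      have hk : rotate (gap (f.1 p) (z.2.1.1 p)) (f.1 p) = z.2.1.1 p :=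
        rotate_gap (base_apply_eq f z.2.1 p)
      conv_rhs => rw [← hk]
      exact chord_rotate_mul_le _ z.1.2.1 z.1.2.2 (abs_gap_le _ _)⟩

theorem continuous_interpolation_ball (f : E.SkewProduct T) {ε : ℝ} (hε : ε ≤ 2) :
    Continuous (interpolation f hε) := by
  refine Continuous.subtype_mk (Continuous.subtype_mk ?_ _) _
  exact ContinuousMap.continuous_of_continuous_uncurry _ (continuous_interpolation hε)

/-- The uniform balls are simply connected: they are contracted onto their center along short
arcs. -/
theorem isSimplyConnected_uniformBall (f : E.SkewProduct T) {ε : ℝ} (hε0 : 0 < ε) (hε : ε ≤ 2) :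
    IsSimplyConnected (uniformBall f ε) := by
  have hcontr : ContractibleSpace (uniformBall f ε) := by
    rw [contractible_iff_id_nullhomotopic]
    refine ⟨⟨f, self_mem_uniformBall f hε0⟩, ContinuousMap.Homotopic.symm
      ⟨⟨⟨interpolation f hε, continuous_interpolation_ball f hε⟩, ?_, ?_⟩⟩⟩
    · intro g
      refine Subtype.ext (Subtype.ext (ContinuousMap.ext fun p => ?_))
      change rotate (((0 : unitInterval) : ℝ) * gap (f.1 p) (g.1.1 p)) (f.1 p) = f.1 p
      rw [Set.Icc.coe_zero, zero_mul, rotate_zero]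
    · intro g
      refine Subtype.ext (Subtype.ext (ContinuousMap.ext fun p => ?_))
      change rotate (((1 : unitInterval) : ℝ) * gap (f.1 p) (g.1.1 p)) (f.1 p) = g.1.1 p
      rw [Set.Icc.coe_one, one_mul, rotate_gap (base_apply_eq f g.1 p)]
  exact (inferInstance : SimplyConnectedSpace (uniformBall f ε))

end Topology

end OrientedPlaneBundle

/-! ### Stretching of lines and the chord identity -/

namespace LinearCocycle

open OrientedPlaneBundle

section Pointwise

variable {X : Type*} [TopologicalSpace X] {F : Type*}
  {V : X → Type*} [TopologicalSpace (TotalSpace F V)]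
  [∀ x, NormedAddCommGroup (V x)] [∀ x, InnerProductSpace ℝ (V x)]
  {T : X ≃ₜ X} (A : LinearCocycle F V T) {E : OrientedPlaneBundle F V}

/-- The square of the factor by which the cocycle stretches the vectors of a line. The choice of the
unit vector does not matter, by `stretch_cover`. -/
def stretch (p : E.Proj) : ℝ :=
  ‖A.onFiber p.base (ray (someFrame E p.base) (angleIn (someFrame E) p) : V p.base)‖ ^ 2

/-- The restriction of the cocycle to the planes of an invariant bundle. -/
def onPlane (hA : A.PreservesOrientation E) (x : X) : E.fiber x ≃ₗ[ℝ] E.fiber (T x) :=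
  (A.onFiber x).ofSubmodules (E.fiber x) (E.fiber (T x)) (hA.map_fiber x)

theorem coe_onPlane (hA : A.PreservesOrientation E) (x : X) (v : E.fiber x) :
    (A.onPlane hA x v : V (T x)) = A.onFiber x v := rfl

theorem exists_cover_eq_ray {x : X} {b b' : E.Frame x} {s t : ℝ} (h : cover b s = cover b' t) :
    ray b s = ray b' t ∨ ray b s = - ray b' t := by
  obtain ⟨c, hc⟩ := exists_ray_eq_ray_add b b'
  have h1 : cover b' t = cover b (t + c) := by
    exact mk_smul_ray_eq_cover b (ray_ne_zero b' t) (r := 1) (by rw [one_smul, hc])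
  rw [h1, cover_eq_cover] at h
  obtain ⟨n, hn⟩ := h
  rw [hc, hn, ray_add_int]
  rcases Int.even_or_odd n with h2 | h2
  · left
    rw [h2.neg_one_zpow, one_smul]
  · right
    rw [h2.neg_one_zpow, neg_one_smul, neg_neg]

theorem stretch_cover {x : X} (b : E.Frame x) (t : ℝ) :
    stretch A (cover b t) = ‖A.onFiber x (ray b t : V x)‖ ^ 2 := by
  have h := cover_angleIn (someFrame E) (cover b t)
  have h2 : ray (someFrame E x) (angleIn (someFrame E) (cover b t)) = ray b t ∨
      ray (someFrame E x) (angleIn (someFrame E) (cover b t)) = - ray b t :=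
    exists_cover_eq_ray h
  change ‖A.onFiber x (ray (someFrame E x) (angleIn (someFrame E) (cover b t)) : V x)‖ ^ 2 = _
  rcases h2 with h2 | h2
  · rw [h2]
  · rw [h2, Submodule.coe_neg, map_neg, norm_neg]

variable (hA : A.PreservesOrientation E)

theorem exists_onPlane_ray {x : X} (b : E.Frame x) (b' : E.Frame (T x)) (t : ℝ) :
    ∃ r t', 0 < r ∧ A.onPlane hA x (ray b t) = r • ray b' t' ∧
      (A.projectivization hA).1 (cover b t) = cover b' t' ∧ stretch A (cover b t) = r ^ 2 := by
  obtain ⟨t', ht'⟩ := exists_eq_norm_smul_ray b' (A.onPlane hA x (ray b t))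
  have h0 : A.onPlane hA x (ray b t) ≠ 0 :=
    (LinearEquiv.map_ne_zero_iff _).2 (ray_ne_zero b t)
  refine ⟨_, t', norm_pos_iff.2 h0, ht', ?_, ?_⟩
  · rw [← mk_smul_ray_eq_cover b' h0 ht']
    refine congrArg (Proj.mk (T x)) ?_
    exact Projectivization.map_mk _ _ _ _
  · rw [stretch_cover, Submodule.coe_norm, coe_onPlane]

theorem stretch_pos (p : E.Proj) : 0 < stretch A p := by
  have h : A.onFiber p.base (ray (someFrame E p.base) (angleIn (someFrame E) p) : V p.base) ≠ 0 :=
    (LinearEquiv.map_ne_zero_iff _).2 fun h0 => ray_ne_zero _ _ (Subtype.ext h0)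
  have := norm_pos_iff.2 h
  rw [stretch]
  positivity

/-- The area scaling of the cocycle on a plane relates the chords between lines and their
images. -/
theorem exists_stretch_mul_chord (x : X) : ∃ D : ℝ, 0 < D ∧ ∀ p q : E.Proj, p.base = x →
    q.base = x → stretch A p * stretch A q *
      chord ((A.projectivization hA).1 p) ((A.projectivization hA).1 q) ^ 2
        = D ^ 2 * chord p q ^ 2 := by
  set b := someFrame E x
  set b' := someFrame E (T x)
  set L := A.onPlane hA x with hL
  -- the area form of the target plane on the image of the frame
  let D₀ : ℝ := inner ℝ (b'.1 0) (L (b.1 0)) * inner ℝ (b'.1 1) (L (b.1 1))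
    - inner ℝ (b'.1 1) (L (b.1 0)) * inner ℝ (b'.1 0) (L (b.1 1))
  have key : ∀ p q : E.Proj, p.base = x → q.base = x → stretch A p * stretch A q *
      chord ((A.projectivization hA).1 p) ((A.projectivization hA).1 q) ^ 2
        = D₀ ^ 2 * chord p q ^ 2 := by
    intro p q hp hq
    obtain ⟨s, rfl⟩ := exists_cover_eq b hp
    obtain ⟨t, rfl⟩ := exists_cover_eq b hq
    obtain ⟨r, s', hr, hLs, hfs, hss⟩ := A.exists_onPlane_ray hA b b' s
    obtain ⟨r', t', hr', hLt, hft, hst⟩ := A.exists_onPlane_ray hA b b' t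
    rw [hss, hst, hfs, hft, chord_cover, chord_cover, mul_pow, mul_pow, sq_abs, sq_abs]
    have hin : ∀ i u, (inner ℝ (b'.1 i) (L (ray b u)) : ℝ) = Real.cos (Real.pi * u) *
        inner ℝ (b'.1 i) (L (b.1 0)) + Real.sin (Real.pi * u) * inner ℝ (b'.1 i) (L (b.1 1)) := by
      intro i u
      rw [ray, map_add, map_smul, map_smul, inner_add_right, real_inner_smul_right,
        real_inner_smul_right]
    have es0 := hin 0 s
    have es1 := hin 1 s
    have et0 := hin 0 t
    have et1 := hin 1 t
    rw [hLs, real_inner_smul_right, inner_zero_ray] at es0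
    rw [hLs, real_inner_smul_right, inner_one_ray] at es1
    rw [hLt, real_inner_smul_right, inner_zero_ray] at et0
    rw [hLt, real_inner_smul_right, inner_one_ray] at et1
    have h : r * r' * Real.sin (Real.pi * (t' - s')) = D₀ * Real.sin (Real.pi * (t - s)) := by
      rw [mul_sub, mul_sub, Real.sin_sub, Real.sin_sub]
      have : r * r' * (Real.sin (Real.pi * t') * Real.cos (Real.pi * s')
          - Real.cos (Real.pi * t') * Real.sin (Real.pi * s'))
          = (r * Real.cos (Real.pi * s')) * (r' * Real.sin (Real.pi * t'))
            - (r * Real.sin (Real.pi * s')) * (r' * Real.cos (Real.pi * t')) := by ring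
      rw [this, es0, es1, et0, et1]
      simp only [D₀]
      ring
    have h2 := congrArg (fun u => 4 * u ^ 2) h
    simp only [mul_pow] at h2
    linarith
  have hD : D₀ ≠ 0 := by
    intro h0
    have h1 := key (cover b 0) (cover b (1 / 2)) rfl rfl
    rw [h0, zero_pow two_ne_zero, zero_mul] at h1
    have h2 := (A.stretch_pos (cover b 0)).ne'
    have h3 := (A.stretch_pos (cover b (1 / 2))).ne'
    have h4 : chord ((A.projectivization hA).1 (cover b 0))
        ((A.projectivization hA).1 (cover b (1 / 2))) = 0 := by
      rcases mul_eq_zero.1 h1 with h | h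
      · exact absurd h (mul_ne_zero h2 h3)
      · exact pow_eq_zero_iff two_ne_zero |>.1 h
    have h5 := SkewProduct.injective _ ((chord_eq_zero (by rfl)).1 h4)
    rw [← chord_eq_zero (by rfl), chord_cover] at h5
    have h6 : Real.pi * (1 / 2 - 0) = Real.pi / 2 := by ring
    rw [h6, Real.sin_pi_div_two] at h5
    norm_num at h5
  refine ⟨|D₀|, abs_pos.2 hD, fun p q hp hq => ?_⟩
  rw [sq_abs, key p q hp hq]

/-- The area scaling of the cocycle on a plane, measured with the square spanned by a given line
and its orthogonal. -/
def areaRate (p : E.Proj) : ℝ :=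
  Real.sqrt (stretch A p * stretch A (rotate (1 / 2) p) *
    chord ((A.projectivization hA).1 p) ((A.projectivization hA).1 (rotate (1 / 2) p)) ^ 2) / 2

/-- The square of the stretching of a line, normalized by the area scaling. It is the inverse of the
derivative of the projective action along the circle. -/
def rate (p : E.Proj) : ℝ := stretch A p / areaRate A hA p

theorem chord_rotate_half (p : E.Proj) : chord p (rotate (1 / 2) p) = 2 := by
  obtain ⟨t, ht⟩ := exists_cover_eq (someFrame E p.base) (p := p) rfl
  generalize someFrame E p.base = b at ht
  rw [← ht, rotate_cover, chord_cover]
  have h6 : Real.pi * (t + 1 / 2 - t) = Real.pi / 2 := by ring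
  rw [h6, Real.sin_pi_div_two]
  norm_num

/-- The area scaling does not depend on the line of the plane. -/
theorem exists_areaRate (x : X) : ∃ D : ℝ, 0 < D ∧ (∀ p : E.Proj, p.base = x →
    areaRate A hA p = D) ∧ ∀ p q : E.Proj, p.base = x →
    q.base = x → stretch A p * stretch A q *
      chord ((A.projectivization hA).1 p) ((A.projectivization hA).1 q) ^ 2
        = D ^ 2 * chord p q ^ 2 := by
  obtain ⟨D, hD, h⟩ := A.exists_stretch_mul_chord hA x
  refine ⟨D, hD, fun p hp => ?_, h⟩
  rw [areaRate, h p (rotate (1 / 2) p) hp hp, chord_rotate_half, ← mul_pow,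
    Real.sqrt_sq (by positivity)]
  ring

theorem areaRate_pos (p : E.Proj) : 0 < areaRate A hA p := by
  obtain ⟨D, hD, h, -⟩ := A.exists_areaRate hA p.base
  rwa [h p rfl]

theorem rate_pos (p : E.Proj) : 0 < rate A hA p :=
  div_pos (A.stretch_pos p) (A.areaRate_pos hA p)

/-- The chord identity for one iterate. -/
theorem chord_sq_eq_rate_mul {p q : E.Proj} (hpq : p.base = q.base) :
    chord p q ^ 2 = rate A hA p * rate A hA q *
      chord ((A.projectivization hA).1 p) ((A.projectivization hA).1 q) ^ 2 := by
  obtain ⟨D, hD, h1, h2⟩ := A.exists_areaRate hA q.base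
  have h3 := h2 p q hpq rfl
  rw [rate, rate, h1 p hpq, h1 q rfl]
  field_simp
  linarith

/-- The product of the rates along the first `n` iterates. -/
def growth (n : ℕ) (p : E.Proj) : ℝ :=
  ∏ j ∈ Finset.range n, rate A hA ((A.projectivization hA).1^[j] p)

theorem growth_zero (p : E.Proj) : growth A hA 0 p = 1 := by simp [growth]

theorem growth_succ (n : ℕ) (p : E.Proj) :
    growth A hA (n + 1) p = rate A hA p * growth A hA n ((A.projectivization hA).1 p) := by
  rw [growth, Finset.prod_range_succ', mul_comm]
  rfl

theorem growth_succ' (n : ℕ) (p : E.Proj) : growth A hA (n + 1) p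
    = growth A hA n p * rate A hA ((A.projectivization hA).1^[n] p) :=
  Finset.prod_range_succ _ _

theorem growth_pos (n : ℕ) (p : E.Proj) : 0 < growth A hA n p :=
  Finset.prod_pos fun _ _ => A.rate_pos hA _

/-- The chord identity. -/
theorem chord_sq_eq_growth_mul (n : ℕ) {p q : E.Proj} (hpq : p.base = q.base) :
    chord p q ^ 2 = growth A hA n p * growth A hA n q *
      chord ((A.projectivization hA).1^[n] p) ((A.projectivization hA).1^[n] q) ^ 2 := by
  induction n generalizing p q with
  | zero => simp [growth_zero]
  | succ n ih =>
    have hb : ((A.projectivization hA).1 p).base = ((A.projectivization hA).1 q).base :=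
      congrArg T hpq
    rw [A.chord_sq_eq_rate_mul hA hpq, ih hb, growth_succ, growth_succ,
      Function.iterate_succ_apply, Function.iterate_succ_apply]
    ring

theorem iterNorm_smul (n : ℕ) {x : X} (r : ℝ) (u : V x) :
    A.iterNorm n (r • u) = |r| * A.iterNorm n u := by
  induction n generalizing x with
  | zero => exact norm_smul r u
  | succ n ih =>
    have h : ∀ w : V x, A.iterNorm (n + 1) w = A.iterNorm n (A.onFiber x w) := fun w => rfl
    rw [h, h, map_smul, ih]

/-- The norm of the iterates of a unit vector is the square root of the growth of its line, up to
a factor which is the same for all lines of the plane. -/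
theorem exists_iterNorm_ray_sq (n : ℕ) (x : X) : ∃ c : ℝ, 0 < c ∧ ∀ (b : E.Frame x) (t : ℝ),
    A.iterNorm n (ray b t : V x) ^ 2 = c * growth A hA n (cover b t) := by
  induction n generalizing x with
  | zero =>
    refine ⟨1, one_pos, fun b t => ?_⟩
    rw [growth_zero]
    have : A.iterNorm 0 (ray b t : V x) = ‖ray b t‖ := rfl
    rw [this, norm_ray]
    norm_num
  | succ n ih =>
    obtain ⟨c, hc, h⟩ := ih (T x)
    obtain ⟨D, hD, hD', -⟩ := A.exists_areaRate hA x
    refine ⟨D * c, mul_pos hD hc, fun b t => ?_⟩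
    obtain ⟨r, t', hr, h1, h2, h3⟩ := A.exists_onPlane_ray hA b (someFrame E (T x)) t
    have h4 : A.iterNorm (n + 1) (ray b t : V x)
        = A.iterNorm n (A.onPlane hA x (ray b t) : V (T x)) := rfl
    rw [h4, h1, Submodule.coe_smul, iterNorm_smul, mul_pow, h, growth_succ, h2, sq_abs, ← h3, rate,
      hD' _ rfl]
    field_simp

end Pointwise

section Topology

variable {X : Type*} [TopologicalSpace X] {F : Type*} [NormedAddCommGroup F] [NormedSpace ℝ F]
  {V : X → Type*} [TopologicalSpace (TotalSpace F V)]
  [∀ x, NormedAddCommGroup (V x)] [∀ x, InnerProductSpace ℝ (V x)]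
  [FiberBundle F V] [VectorBundle ℝ F V] [IsContinuousRiemannianBundle F V]
  {T : X ≃ₜ X} (A : LinearCocycle F V T) {E : OrientedPlaneBundle F V}

theorem stretch_mk' (v : {v : TotalSpace F V // v.snd ∈ E.fiber v.proj ∧ v.snd ≠ 0}) :
    stretch A (Proj.mk' E v) = (inner ℝ (A.total v.1).snd (A.total v.1).snd : ℝ)
      / (inner ℝ v.1.snd v.1.snd : ℝ) := by
  obtain ⟨⟨x, v⟩, hv, hv0⟩ := v
  have hv0' : (⟨v, hv⟩ : E.fiber x) ≠ 0 := fun h => hv0 (congrArg Subtype.val h)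
  obtain ⟨t, ht⟩ := exists_eq_norm_smul_ray (someFrame E x) ⟨v, hv⟩
  have h1 : Proj.mk' E ⟨⟨x, v⟩, hv, hv0⟩ = cover (someFrame E x) t :=
    mk_smul_ray_eq_cover (someFrame E x) hv0' ht
  have h2 : v = ‖v‖ • (ray (someFrame E x) t : V x) := congrArg Subtype.val ht
  have h3 : (A.total ⟨x, v⟩).snd = A.onFiber x v := rfl
  have h4 : ‖A.onFiber x v‖ = ‖v‖ * ‖A.onFiber x (ray (someFrame E x) t : V x)‖ := by
    conv_lhs => rw [h2]
    rw [map_smul, norm_smul, norm_norm]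
  have h5 : ‖v‖ ≠ 0 := norm_ne_zero_iff.2 hv0
  have h6 : (inner ℝ (A.total ⟨x, v⟩).snd (A.total ⟨x, v⟩).snd : ℝ) = ‖A.onFiber x v‖ ^ 2 :=
    real_inner_self_eq_norm_sq (A.onFiber x v)
  have h7 : (inner ℝ v v : ℝ) = ‖v‖ ^ 2 := real_inner_self_eq_norm_sq v
  refine (congrArg (stretch A) h1).trans ?_
  rw [stretch_cover]
  refine Eq.trans ?_ (congrArg₂ (· / ·) h6 h7).symm
  rw [h4]
  field_simp

theorem continuous_stretch : Continuous (stretch A : E.Proj → ℝ) := by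
  rw [isQuotientMap_mk'.continuous_iff]
  have h : stretch A ∘ Proj.mk' E = fun v => (inner ℝ (A.total v.1).snd (A.total v.1).snd : ℝ)
      / (inner ℝ v.1.snd v.1.snd : ℝ) := funext fun v => stretch_mk' A v
  rw [h]
  have hv : Continuous fun v : {v : TotalSpace F V // v.snd ∈ E.fiber v.proj ∧ v.snd ≠ 0} =>
      (⟨v.1.proj, v.1.snd⟩ : TotalSpace F V) := continuous_subtype_val
  have hA : Continuous fun v : {v : TotalSpace F V // v.snd ∈ E.fiber v.proj ∧ v.snd ≠ 0} =>
      (⟨T v.1.proj, (A.total v.1).snd⟩ : TotalSpace F V) :=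
    A.continuous_total.comp continuous_subtype_val
  exact (Continuous.inner_bundle hA hA).div (Continuous.inner_bundle hv hv) fun v h0 =>
    v.2.2 (inner_self_eq_zero.1 h0)

variable (hA : A.PreservesOrientation E)

theorem continuous_rate : Continuous (rate A hA) := by
  have h1 : Continuous fun p : E.Proj => rotate (1 / 2) p :=
    continuous_rotate.comp (continuous_const.prodMk continuous_id)
  have hf := (A.projectivization hA).1.continuous
  have h2 : Continuous fun p : E.Proj => chord ((A.projectivization hA).1 p)
      ((A.projectivization hA).1 (rotate (1 / 2) p)) := by
    refine ContinuousOn.comp_continuous (f := fun p => ((A.projectivization hA).1 p,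
      (A.projectivization hA).1 (rotate (1 / 2) p))) continuousOn_chord
      (hf.prodMk (hf.comp h1)) fun p => rfl
  refine A.continuous_stretch.div (Continuous.div_const ?_ _) fun p => (A.areaRate_pos hA p).ne'
  exact Real.continuous_sqrt.comp
    ((A.continuous_stretch.mul (A.continuous_stretch.comp h1)).mul (h2.pow 2))

theorem continuous_growth (n : ℕ) : Continuous (growth A hA n) := by
  refine continuous_finsetProd _ fun j _ => (A.continuous_rate hA).comp ?_
  exact (A.projectivization hA).1.continuous.iterate j

end Topology

end LinearCocycle

/-! ### Domination implies mode-locking -/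

theorem exists_pos_forall_le {Y : Type*} [TopologicalSpace Y] [CompactSpace Y] {h : Y → ℝ}
    (hc : Continuous h) (hp : ∀ y, 0 < h y) : ∃ m > 0, ∀ y, m ≤ h y := by
  rcases isEmpty_or_nonempty Y with he | hne
  · exact ⟨1, one_pos, fun y => he.elim y⟩
  · obtain ⟨y, -, hy⟩ := isCompact_univ.exists_isMinOn univ_nonempty hc.continuousOn
    exact ⟨h y, hp y, fun z => hy (mem_univ z)⟩

theorem exists_pos_forall_ge {Y : Type*} [TopologicalSpace Y] [CompactSpace Y] {h : Y → ℝ}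
    (hc : Continuous h) : ∃ M > 0, ∀ y, h y ≤ M := by
  rcases isEmpty_or_nonempty Y with he | hne
  · exact ⟨1, one_pos, fun y => he.elim y⟩
  · obtain ⟨y, -, hy⟩ := isCompact_univ.exists_isMaxOn univ_nonempty hc.continuousOn
    exact ⟨max (h y) 1, by positivity, fun z => (hy (mem_univ z)).trans (le_max_left _ _)⟩

namespace OrientedPlaneBundle

variable {X : Type*} [TopologicalSpace X] {F : Type*} [NormedAddCommGroup F] [NormedSpace ℝ F]
  {V : X → Type*} [TopologicalSpace (TotalSpace F V)]
  [∀ x, NormedAddCommGroup (V x)] [∀ x, InnerProductSpace ℝ (V x)]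
  [FiberBundle F V] [VectorBundle ℝ F V] [IsContinuousRiemannianBundle F V]
  {E : OrientedPlaneBundle F V} {T : X ≃ₜ X}

/-- Paths in a fiber of the projective bundle lift to the universal cover. -/
theorem exists_lift {x : X} {γ : unitInterval → E.Proj} (hγ : Continuous γ)
    (hx : ∀ t, (γ t).base = x) :
    ∃ θ : C(unitInterval, ℝ), ∀ t, γ t = cover (someFrame E x) (θ t) := by
  have h1 : Continuous fun t => rotTo (cover (someFrame E x) 0) (γ t) :=
    ContinuousOn.comp_continuous (f := fun t => (cover (someFrame E x) 0, γ t))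
      continuousOn_rotTo (continuous_const.prodMk hγ) fun t => (hx t).symm
  obtain ⟨e, he⟩ := turn_surjective (rotTo (cover (someFrame E x) 0) (γ 0))
  obtain ⟨Γ, hΓ, -⟩ := Circle.isCoveringMap_exp.exists_path_lifts
    (⟨_, h1⟩ : C(unitInterval, Circle)) (2 * Real.pi * e) he.symm
  refine ⟨⟨fun t => Γ t / (2 * Real.pi), by fun_prop⟩, fun t => ?_⟩
  have h2 : Circle.exp (Γ t) = rotTo (cover (someFrame E x) 0) (γ t) := congrFun hΓ t
  obtain ⟨s, hs⟩ := exists_cover_eq (someFrame E x) (hx t)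
  rw [← hs, rotTo_cover, sub_zero] at h2
  rw [← hs, cover_eq_cover_iff_turn, ← h2]
  change Circle.exp (Γ t) = turn (Γ t / (2 * Real.pi))
  rw [turn, mul_div_cancel₀ _ (by positivity)]

/-- The lifts of two paths in a fiber that never meet have variations that differ by less than
one. -/
theorem abs_sub_sub_lt_one {x : X} {b : E.Frame x} {θ ψ : C(unitInterval, ℝ)}
    (h : ∀ t, cover b (θ t) ≠ cover b (ψ t)) : |(θ 1 - θ 0) - (ψ 1 - ψ 0)| < 1 := by
  have h1 := abs_sub_lt_one_of_forall_ne_int (d := fun t => ψ t - θ t)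
    (ψ.continuous.sub θ.continuous) (fun t n hn => h t (by
      rw [cover_eq_cover]; exact ⟨n, by linarith⟩)) 0 1
  refine lt_of_eq_of_lt ?_ h1
  congr 1; ring

variable [T2Space X] [CompactSpace X]

theorem continuous_path_iterate {f g : E.SkewProduct T} (φ : Path f g) (n : ℕ) (p : E.Proj) :
    Continuous fun t => (φ t).1^[n] p := by
  induction n with
  | zero => exact continuous_const
  | succ n ih =>
    simp only [Function.iterate_succ_apply']
    exact continuous_skewProduct_apply φ.continuous ih

/-- If the orbit of one point under a path of skew-products avoids a sequence of lines which does
not depend on the time of the path, then the rotation number of the path vanishes. -/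
theorem hasRotationNumberAt_zero_of_avoid {f g : E.SkewProduct T} (φ : Path f g) {x : X}
    {p : E.Proj} (hp : p.base = x) (l : ℕ → E.Proj) (hl : ∀ n, (l n).base = T^[n] x)
    (h : ∀ n t, (φ t).1^[n] p ≠ l n) : HasRotationNumberAt φ x 0 := by
  intro u hu
  have hex : ∀ n, ∃ w, IsWindingNumber (fun t => (φ t).1^[n] u) w ∧ |w| < 2 := by
    intro n
    have hbase : ∀ q : E.Proj, q.base = x → ∀ t, ((φ t).1^[n] q).base = T^[n] x := by
      intro q hq t
      rw [SkewProduct.base_iterate, hq]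
    obtain ⟨θ, hθ⟩ := exists_lift (continuous_path_iterate φ n p) (hbase p hp)
    obtain ⟨c, hc⟩ := exists_cover_eq (someFrame E (T^[n] x)) (hl n)
    have h1 : |(θ 1 - θ 0) - (c - c)| < 1 := by
      refine abs_sub_sub_lt_one (b := someFrame E (T^[n] x)) (ψ := ContinuousMap.const _ c)
        fun t heq => h n t ?_
      rw [hθ t, heq, ContinuousMap.const_apply, hc]
    rw [sub_self, sub_zero] at h1
    by_cases hup : u = p
    · subst hup
      exact ⟨_, ⟨_, _, θ, hθ, rfl⟩, h1.trans one_lt_two⟩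
    · obtain ⟨ψ, hψ⟩ := exists_lift (continuous_path_iterate φ n u) (hbase u hu)
      have h2 : |(ψ 1 - ψ 0) - (θ 1 - θ 0)| < 1 := by
        refine abs_sub_sub_lt_one (b := someFrame E (T^[n] x)) fun t heq => hup ?_
        rw [← hθ t, ← hψ t] at heq
        exact ((φ t).injective.iterate n) heq
      refine ⟨_, ⟨_, _, ψ, hψ, rfl⟩, ?_⟩
      have h3 := abs_add_le ((ψ 1 - ψ 0) - (θ 1 - θ 0)) (θ 1 - θ 0)
      rw [sub_add_cancel] at h3
      linarith
  choose w hw hw2 using hex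
  refine ⟨w, hw, squeeze_zero_norm (fun n => ?_) (tendsto_const_div_atTop_nhds_zero_nat 2)⟩
  rw [norm_div, Real.norm_eq_abs, Real.norm_natCast]
  gcongr
  exact (hw2 n).le

/-- Nearby skew-products have nearby iterates. -/
theorem exists_forall_chord_iterate_lt (f : E.SkewProduct T) (N : ℕ) {η : ℝ} (hη : 0 < η) :
    ∃ ε > 0, ε ≤ 2 ∧ ∀ g ∈ uniformBall f ε, ∀ r ≤ N, ∀ p, chord (f.1^[r] p) (g.1^[r] p) < η := by
  induction N generalizing η with
  | zero =>
    refine ⟨1, one_pos, one_le_two, fun g _ r hr p => ?_⟩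
    obtain rfl : r = 0 := by omega
    rw [Function.iterate_zero_apply, Function.iterate_zero_apply, chord_self]
    exact hη
  | succ N ih =>
    have hc : ContinuousOn (fun z : E.Proj × E.Proj => chord (f.1 z.1) (f.1 z.2))
        {z | z.1.base = z.2.base} := by
      refine ContinuousOn.comp (f := fun z : E.Proj × E.Proj => (f.1 z.1, f.1 z.2))
        continuousOn_chord (Continuous.continuousOn ?_) fun z hz => ?_
      · exact (f.1.continuous.comp continuous_fst).prodMk (f.1.continuous.comp continuous_snd)
      · change (f.1 z.1).base = (f.1 z.2).base
        rw [f.2.1, f.2.1]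
        exact congrArg T hz
    obtain ⟨δ, hδ, h1⟩ := exists_forall_chord_lt hc (fun p => chord_self _) (half_pos hη)
    obtain ⟨ε, hε, hε2, h2⟩ := ih (lt_min hδ hη)
    refine ⟨min ε (η / 2), lt_min hε (half_pos hη), (min_le_left _ _).trans hε2,
      fun g hg r hr p => ?_⟩
    have hg' : g ∈ uniformBall f ε := fun p => (hg p).trans_le (min_le_left _ _)
    rcases Nat.lt_succ_iff_lt_or_eq.1 (Nat.lt_succ_of_le hr) with h | rfl
    · exact (h2 g hg' r (by omega) p).trans_le (min_le_right _ _)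
    · rw [Function.iterate_succ_apply', Function.iterate_succ_apply']
      have hb : (f.1^[N] p).base = (g.1^[N] p).base := by
        rw [SkewProduct.base_iterate, SkewProduct.base_iterate]
      have h3 := h1 _ _ hb ((h2 g hg' N le_rfl p).trans_le (min_le_left _ _))
      have h4 := (hg (g.1^[N] p)).trans_le (min_le_right _ _)
      have h5 := chord_triangle (f.1 (f.1^[N] p)) (f.1 (g.1^[N] p)) (g.1 (g.1^[N] p))
      simp only at h3
      linarith

end OrientedPlaneBundle

namespace LinearCocycle

open OrientedPlaneBundle

variable {X : Type*} [TopologicalSpace X] [T2Space X] [CompactSpace X]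
  {F : Type*} [NormedAddCommGroup F] [NormedSpace ℝ F]
  {V : X → Type*} [TopologicalSpace (TotalSpace F V)]
  [∀ x, NormedAddCommGroup (V x)] [∀ x, InnerProductSpace ℝ (V x)]
  [FiberBundle F V] [VectorBundle ℝ F V] [IsContinuousRiemannianBundle F V]
  {T : X ≃ₜ X} (A : LinearCocycle F V T) {E : OrientedPlaneBundle F V}
  (hA : A.PreservesOrientation E)

theorem iterate_section {f : E.SkewProduct T} {S : Set X} (hS : ∀ x ∈ S, T x ∈ S)
    {l : X → E.Proj} (hl : ∀ x ∈ S, f.1 (l x) = l (T x)) (n : ℕ) {x : X} (hx : x ∈ S) :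
    f.1^[n] (l x) = l (T^[n] x) ∧ T^[n] x ∈ S := by
  induction n generalizing x with
  | zero => exact ⟨rfl, hx⟩
  | succ n ih =>
    rw [Function.iterate_succ_apply, hl x hx]
    exact ih (hS x hx)

/-- If the growth of `l₁` is dominated by the one of `l₂`, then under the skew-products that are
close to the projective action, the orbits of `l₂` stay away from `l₁`. -/
theorem exists_uniformBall_avoid {S : Set X} (hS : ∀ x ∈ S, T x ∈ S) {l₁ l₂ : X → E.Proj}
    (hb₁ : ∀ x, (l₁ x).base = x) (hb₂ : ∀ x, (l₂ x).base = x)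
    (hl₁ : ∀ x ∈ S, (A.projectivization hA).1 (l₁ x) = l₁ (T x))
    (hl₂ : ∀ x ∈ S, (A.projectivization hA).1 (l₂ x) = l₂ (T x)) (N : ℕ)
    (hN : ∀ x ∈ S, 4 * growth A hA N (l₁ x) < growth A hA N (l₂ x)) :
    ∃ ε > 0, ε ≤ 2 ∧ ∀ g ∈ uniformBall (A.projectivization hA) ε, ∀ x ∈ S, ∀ n,
      g.1^[n] (l₂ x) ≠ l₁ (T^[n] x) := by
  -- the two lines make an angle bounded from below, because their growths have different sizes
  obtain ⟨m, hm, hgm⟩ := exists_pos_forall_le (A.continuous_growth hA N) (A.growth_pos hA N)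
  obtain ⟨c, hc, hgc⟩ := exists_forall_chord_lt
    (φ := fun z : E.Proj × E.Proj => growth A hA N z.2 - growth A hA N z.1)
    (((A.continuous_growth hA N).comp continuous_snd).sub
      ((A.continuous_growth hA N).comp continuous_fst)).continuousOn (fun p => sub_self _)
    (show 0 < 3 / 4 * m by positivity)
  have hbb : ∀ x, (l₁ x).base = (l₂ x).base := fun x => (hb₁ x).trans (hb₂ x).symm
  have hc12 : ∀ x ∈ S, c ≤ chord (l₁ x) (l₂ x) := by
    intro x hx
    by_contra! hcon
    have h1 := hgc _ _ (hbb x) hcon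
    have h2 := hN x hx
    have h3 := hgm (l₂ x)
    simp only at h1
    linarith
  obtain ⟨M, hM, hgM⟩ := exists_pos_forall_ge
    (continuous_finsetSum (Finset.range (N + 1)) fun r _ => A.continuous_growth hA r)
  have hgM' : ∀ r ≤ N, ∀ p : E.Proj, growth A hA r p ≤ M := fun r hr p =>
    (Finset.single_le_sum (f := fun r => growth A hA r p)
      (fun i _ => (A.growth_pos hA i p).le) (Finset.mem_range.2 (by omega))).trans (hgM p)
  set f := A.projectivization hA with hf
  obtain ⟨ε, hε, hε2, hball⟩ := exists_forall_chord_iterate_lt f N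
    (lt_min (show 0 < c / 6 by positivity) (show 0 < c / (2 * M) by positivity))
  refine ⟨ε, hε, hε2, fun g hg x hx n => ?_⟩
  -- lines closer to `l₂` than to `l₁` are not close to `l₁`
  have hfar : ∀ y ∈ S, ∀ q : E.Proj, chord q (l₂ y) ≤ chord q (l₁ y) → c / 2 ≤ chord q (l₁ y) := by
    intro y hy q hq
    have h1 := chord_triangle (l₁ y) q (l₂ y)
    rw [chord_comm (l₁ y) q] at h1
    linarith [hc12 y hy]
  have hcone : ∀ y ∈ S, ∀ q : E.Proj, q.base = y → chord q (l₂ y) ≤ chord q (l₁ y) →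
      chord (g.1^[N] q) (l₂ (T^[N] y)) ≤ chord (g.1^[N] q) (l₁ (T^[N] y)) := by
    intro y hy q hqy hq
    have e1 := A.chord_sq_eq_growth_mul hA N (hqy.trans (hb₁ y).symm)
    have e2 := A.chord_sq_eq_growth_mul hA N (hqy.trans (hb₂ y).symm)
    rw [← hf, (iterate_section hS hl₁ N hy).1] at e1
    rw [← hf, (iterate_section hS hl₂ N hy).1] at e2
    have h0 : chord q (l₂ y) ^ 2 ≤ chord q (l₁ y) ^ 2 :=
      pow_le_pow_left₀ (chord_nonneg _ _) hq 2
    set c₁ := chord (f.1^[N] q) (l₁ (T^[N] y)) with hc₁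
    set c₂ := chord (f.1^[N] q) (l₂ (T^[N] y)) with hc₂
    have hgq := A.growth_pos hA N q
    have hg1 := A.growth_pos hA N (l₁ y)
    have hg2 := A.growth_pos hA N (l₂ y)
    rw [e1, e2, mul_assoc, mul_assoc] at h0
    have h1 := le_of_mul_le_mul_left h0 hgq
    have h2 : growth A hA N (l₂ y) * (4 * c₂ ^ 2) ≤ growth A hA N (l₂ y) * c₁ ^ 2 := by
      nlinarith [hN y hy, sq_nonneg c₁]
    have h3 : (2 * c₂) ^ 2 ≤ c₁ ^ 2 := by
      have := le_of_mul_le_mul_left h2 hg2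
      linarith
    have h4 : 2 * c₂ ≤ c₁ := (pow_le_pow_iff_left₀
      (mul_nonneg two_pos.le (chord_nonneg _ _)) (chord_nonneg _ _) two_ne_zero).1 h3
    have h5 := (hball g hg N le_rfl q).trans_le (min_le_left _ _)
    have h6 := chord_triangle (g.1^[N] q) (f.1^[N] q) (l₂ (T^[N] y))
    have h7 := chord_triangle (f.1^[N] q) (g.1^[N] q) (l₁ (T^[N] y))
    have h8 := chord_triangle (l₁ (T^[N] y)) (g.1^[N] q) (l₂ (T^[N] y))
    rw [chord_comm (g.1^[N] q) (f.1^[N] q)] at h6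
    rw [chord_comm (l₁ (T^[N] y)) (g.1^[N] q)] at h8
    have h9 := hc12 _ (iterate_section hS hl₁ N hy).2
    linarith
  have hblock : ∀ j, chord (g.1^[N * j] (l₂ x)) (l₂ (T^[N * j] x))
      ≤ chord (g.1^[N * j] (l₂ x)) (l₁ (T^[N * j] x)) := by
    intro j
    induction j with
    | zero =>
      rw [mul_zero, Function.iterate_zero_apply, Function.iterate_zero_apply, chord_self]
      exact chord_nonneg _ _
    | succ j ih =>
      rw [mul_add, mul_one, add_comm, Function.iterate_add_apply, Function.iterate_add_apply]
      refine hcone _ (iterate_section hS hl₁ _ hx).2 _ ?_ ih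
      rw [SkewProduct.base_iterate, hb₂]
  have hN0 : 0 < N := by
    rcases Nat.eq_zero_or_pos N with rfl | h
    · have := hN x hx
      rw [growth_zero, growth_zero] at this
      norm_num at this
    · exact h
  intro heq
  rw [← Nat.mod_add_div n N, Function.iterate_add_apply, Function.iterate_add_apply] at heq
  have hr : n % N ≤ N := (Nat.mod_lt n hN0).le
  have hy := (iterate_section hS hl₁ (N * (n / N)) hx).2
  have hqb : (g.1^[N * (n / N)] (l₂ x)).base = T^[N * (n / N)] x := by
    rw [SkewProduct.base_iterate, hb₂]
  have hq := hfar _ hy _ (hblock (n / N))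
  set y := T^[N * (n / N)] x
  set q := g.1^[N * (n / N)] (l₂ x)
  set r := n % N
  have h1 := (hball g hg r hr q).trans_le (min_le_right _ _)
  rw [heq] at h1
  have e1 := A.chord_sq_eq_growth_mul hA r (hqb.trans (hb₁ y).symm)
  rw [← hf, (iterate_section hS hl₁ r hy).1] at e1
  have h2 : growth A hA r q * growth A hA r (l₁ y) ≤ M * M :=
    mul_le_mul (hgM' r hr _) (hgM' r hr _) (A.growth_pos hA _ _).le hM.le
  have h3 : chord (f.1^[r] q) (l₁ (T^[r] y)) ^ 2 < (c / (2 * M)) ^ 2 :=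
    pow_lt_pow_left₀ h1 (chord_nonneg _ _) two_ne_zero
  have h4 : (c / 2) ^ 2 ≤ chord q (l₁ y) ^ 2 := pow_le_pow_left₀ (by positivity) hq 2
  have h5 : chord q (l₁ y) ^ 2 ≤ M * M * chord (f.1^[r] q) (l₁ (T^[r] y)) ^ 2 := by
    rw [e1]; exact mul_le_mul_of_nonneg_right h2 (sq_nonneg _)
  have h6 : M * M * (c / (2 * M)) ^ 2 = (c / 2) ^ 2 := by field_simp
  have h7 := mul_lt_mul_of_pos_left h3 (mul_pos hM hM)
  linarith

/-- The two lines of a dominated splitting, as invariant sections of the projective bundle. The rank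
of `E` forces the first two bundles of the splitting to be line bundles. -/
theorem HasDominatedSplitting.exists_lines {S : Set X} (hS : ∀ x ∈ S, T x ∈ S)
    (h : A.HasDominatedSplitting E S) : ∃ l₁ l₂ : X → E.Proj,
      (∀ x, (l₁ x).base = x) ∧ (∀ x, (l₂ x).base = x) ∧
      (∀ x ∈ S, (A.projectivization hA).1 (l₁ x) = l₁ (T x)) ∧
      (∀ x ∈ S, (A.projectivization hA).1 (l₂ x) = l₂ (T x)) ∧
      ∃ N, ∀ x ∈ S, 4 * growth A hA N (l₁ x) < growth A hA N (l₂ x) := by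
  obtain ⟨k, hk, r, L, hL, hsum, hinv, N, hN⟩ := h
  let i₁ : Fin k := ⟨0, by omega⟩
  let i₂ : Fin k := ⟨1, by omega⟩
  have hne : i₁ ≠ i₂ := by simp [i₁, i₂]
  have hle : ∀ i, ∀ x ∈ S, L i x ≤ E.fiber x := by
    intro i x hx
    rw [← (hsum x hx).2]
    exact le_iSup (fun i => L i x) i
  have hbot : ∀ i, ∀ x ∈ S, L i x ≠ ⊥ := by
    intro i x hx hbot
    obtain ⟨U, hU, e, -, he⟩ := (hL i).2 x hx
    obtain ⟨h1, h2⟩ := he x ⟨mem_of_mem_nhds hU, hx⟩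
    have h3 : e ⟨0, (hL i).1⟩ x ∈ L i x := by
      rw [← h2]; exact Submodule.subset_span ⟨_, rfl⟩
    rw [hbot, Submodule.mem_bot] at h3
    exact h1.ne_zero _ h3
  have hfin : ∀ x, FiniteDimensional ℝ (E.fiber x) := fun x =>
    (someFrame E x).1.toBasis.finiteDimensional_of_finite
  have hrank : ∀ x, Module.finrank ℝ (E.fiber x) = 2 := fun x => by
    simpa using Module.finrank_eq_card_basis (someFrame E x).1.toBasis
  have hfinL : ∀ i, ∀ x ∈ S, FiniteDimensional ℝ (L i x) := fun i x hx =>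
    Submodule.finiteDimensional_of_le (hle i x hx)
  have hpos : ∀ i, ∀ x ∈ S, 0 < Module.finrank ℝ (L i x) := by
    intro i x hx
    have := hfinL i x hx
    have h1 : Nontrivial (L i x) := Submodule.nontrivial_iff_ne_bot.2 (hbot i x hx)
    exact Module.finrank_pos
  have hone : ∀ x ∈ S, Module.finrank ℝ (L i₁ x) = 1 ∧ Module.finrank ℝ (L i₂ x) = 1 := by
    intro x hx
    have := hfinL i₁ x hx
    have := hfinL i₂ x hx
    have h1 : Disjoint (L i₁ x) (L i₂ x) := (hsum x hx).1.pairwiseDisjoint hne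
    have h2 := Submodule.finrank_sup_add_finrank_inf_eq (L i₁ x) (L i₂ x)
    rw [h1.eq_bot, finrank_bot, add_zero] at h2
    have := hfin x
    have h3 := Submodule.finrank_mono (sup_le (hle i₁ x hx) (hle i₂ x hx))
    rw [hrank] at h3
    have h4 := hpos i₁ x hx
    have h5 := hpos i₂ x hx
    omega
  have hray : ∀ i, ∀ x, ∃ t, x ∈ S → (ray (someFrame E x) t : V x) ∈ L i x := by
    intro i x
    by_cases hx : x ∈ S
    · obtain ⟨v, hv, hv0⟩ := Submodule.exists_mem_ne_zero_of_ne_bot (hbot i x hx)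
      obtain ⟨t, ht⟩ := exists_eq_norm_smul_ray (someFrame E x) ⟨v, hle i x hx hv⟩
      refine ⟨t, fun _ => ?_⟩
      have h1 : v = ‖v‖ • (ray (someFrame E x) t : V x) := congrArg Subtype.val ht
      have h2 : (ray (someFrame E x) t : V x) = ‖v‖⁻¹ • v := by
        conv_rhs => rw [h1]
        rw [norm_smul, norm_norm, smul_smul]
        have h3 : ‖(ray (someFrame E x) t : V x)‖ = 1 := norm_ray _ _
        rw [h3, mul_one, inv_mul_cancel₀ (norm_ne_zero_iff.2 hv0), one_smul]
      rw [h2]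
      exact Submodule.smul_mem _ _ hv
    · exact ⟨0, fun h => absurd h hx⟩
  choose α hα using hray
  have hinvl : ∀ i, (∀ x ∈ S, Module.finrank ℝ (L i x) = 1) → ∀ x ∈ S,
      (A.projectivization hA).1 (cover (someFrame E x) (α i x))
        = cover (someFrame E (T x)) (α i (T x)) := by
    intro i hi x hx
    have h1 : A.onFiber x (ray (someFrame E x) (α i x) : V x) ∈ L i (T x) := by
      rw [← hinv i x hx]
      exact Submodule.mem_map_of_mem (hα i x hx)
    have h2 := hα i (T x) (hS x hx)
    have h3 : (⟨_, h2⟩ : L i (T x)) ≠ 0 := fun h0 => by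
      have h4 : (ray (someFrame E (T x)) (α i (T x)) : V (T x)) = 0 := congrArg Subtype.val h0
      exact ray_ne_zero _ _ (Subtype.ext h4)
    obtain ⟨c, hc⟩ := (finrank_eq_one_iff_of_nonzero' _ h3).1 (hi (T x) (hS x hx)) ⟨_, h1⟩
    have h4 : A.onPlane hA x (ray (someFrame E x) (α i x))
        = c • ray (someFrame E (T x)) (α i (T x)) := Subtype.ext (congrArg Subtype.val hc).symm
    have h5 : A.onPlane hA x (ray (someFrame E x) (α i x)) ≠ 0 :=
      (LinearEquiv.map_ne_zero_iff _).2 (ray_ne_zero _ _)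
    rw [← mk_smul_ray_eq_cover _ h5 h4]
    exact congrArg (Proj.mk (T x)) (Projectivization.map_mk _ _ _ _)
  refine ⟨fun x => cover (someFrame E x) (α i₁ x), fun x => cover (someFrame E x) (α i₂ x),
    fun x => rfl, fun x => rfl, hinvl i₁ fun x hx => (hone x hx).1,
    hinvl i₂ fun x hx => (hone x hx).2, N, fun x hx => ?_⟩
  have h1 := hN x hx i₁ i₂ rfl _ (hα i₁ x hx) _ (hα i₂ x hx) (norm_ray _ _) (norm_ray _ _)
  obtain ⟨c, hc, hgr⟩ := A.exists_iterNorm_ray_sq hA N x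
  have h2 := hgr (someFrame E x) (α i₁ x)
  have h3 := hgr (someFrame E x) (α i₂ x)
  have h4 : (2 * A.iterNorm N (ray (someFrame E x) (α i₁ x) : V x)) ^ 2
      < A.iterNorm N (ray (someFrame E x) (α i₂ x) : V x) ^ 2 := by
    refine pow_lt_pow_left₀ (by linarith) ?_ two_ne_zero
    exact mul_nonneg two_pos.le (norm_nonneg _)
  rw [mul_pow, h2, h3] at h4
  have h5 : c * (4 * growth A hA N (cover (someFrame E x) (α i₁ x)))
      < c * growth A hA N (cover (someFrame E x) (α i₂ x)) := by linarith
  exact lt_of_mul_lt_mul_left h5 hc.le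

end LinearCocycle

section Measure

variable {X : Type*} [MetricSpace X] [MeasurableSpace X] [BorelSpace X] {T : X ≃ₜ X}
  {μ : Measure X}

theorem MeasureTheory.MeasurePreserving.apply_mem_support (hμ : MeasurePreserving T μ μ) {x : X}
    (hx : x ∈ μ.support) : T x ∈ μ.support := by
  rw [Measure.mem_support_iff_forall] at hx ⊢
  intro U hU
  obtain ⟨W, hWU, hW, hxW⟩ := mem_nhds_iff.1 hU
  refine lt_of_lt_of_le ?_ (measure_mono hWU)
  rw [← hμ.measure_preimage hW.measurableSet.nullMeasurableSet]
  exact hx _ ((hW.preimage T.continuous).mem_nhds hxW)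

theorem MeasureTheory.MeasurePreserving.symm_apply_mem_support (hμ : MeasurePreserving T μ μ)
    {x : X} (hx : x ∈ μ.support) : T.symm x ∈ μ.support := by
  rw [Measure.mem_support_iff_forall] at hx ⊢
  intro U hU
  obtain ⟨W, hWU, hW, hxW⟩ := mem_nhds_iff.1 hU
  have hW' : IsOpen (T.symm ⁻¹' W) := hW.preimage T.symm.continuous
  refine lt_of_lt_of_le ?_ (measure_mono hWU)
  have h1 : W = T ⁻¹' (T.symm ⁻¹' W) := by ext; simp
  rw [h1, hμ.measure_preimage hW'.measurableSet.nullMeasurableSet]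
  exact hx _ (hW'.mem_nhds hxW)

open OrientedPlaneBundle in
/-- A dominated splitting over the support implies mode-locking. -/
theorem LinearCocycle.HasDominatedSplitting.isModeLocked [CompactSpace X]
    {F : Type*} [NormedAddCommGroup F] [NormedSpace ℝ F]
    {V : X → Type*} [TopologicalSpace (TotalSpace F V)]
    [∀ x, NormedAddCommGroup (V x)] [∀ x, InnerProductSpace ℝ (V x)]
    [FiberBundle F V] [VectorBundle ℝ F V] [IsContinuousRiemannianBundle F V]
    {A : LinearCocycle F V T} {E : OrientedPlaneBundle F V}
    (h : A.HasDominatedSplitting E μ.support)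
    (hA : A.PreservesOrientation E) (hμ : MeasurePreserving T μ μ) :
    IsModeLocked μ (A.projectivization hA) := by
  obtain ⟨l₁, l₂, hb₁, hb₂, hl₁, hl₂, N, hN⟩ :=
    HasDominatedSplitting.exists_lines A hA (fun x hx => hμ.apply_mem_support hx) h
  obtain ⟨ε, hε, hε2, hav⟩ := A.exists_uniformBall_avoid hA
    (fun x hx => hμ.apply_mem_support hx) hb₁ hb₂ hl₁ hl₂ N hN
  refine ⟨_, uniformBall_mem_nhds _ hε, isSimplyConnected_uniformBall _ hε hε2, _,
    uniformBall_mem_nhds _ hε, Subset.rfl, fun g _ φ hφ => ⟨fun _ => 0, ?_, integrable_zero _ _ _,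
      by simp⟩⟩
  filter_upwards [Measure.support_mem_ae (μ := μ)] with x hx
  exact hasRotationNumberAt_zero_of_avoid φ (hb₂ x) (fun n => l₁ (T^[n] x)) (fun n => hb₁ _)
    fun n t => hav (φ t) (hφ t) x hx n

end Measure

/-! ### Small rotations of a mode-locked skew-product -/

namespace OrientedPlaneBundle

section Pointwise

variable {X : Type*} [TopologicalSpace X] {F : Type*}
  {V : X → Type*} [TopologicalSpace (TotalSpace F V)]
  [∀ x, NormedAddCommGroup (V x)] [∀ x, InnerProductSpace ℝ (V x)]
  {E : OrientedPlaneBundle F V} {T : X ≃ₜ X}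

theorem exists_fiberLift (f : E.SkewProduct T) (x : X) : ∃ G : ℝ → ℝ,
    Continuous G ∧ StrictMono G ∧ (∀ t, G (t + 1) = G t + 1) ∧
      ∀ t, f.1 (cover (someFrame E x) t) = cover (someFrame E (T x)) (G t) :=
  f.2.2 x (someFrame E x) (someFrame E (T x))

/-- A lift of a skew-product to the universal covers of the circles above `x` and `T x`. -/
def fiberLift (f : E.SkewProduct T) (x : X) : ℝ → ℝ := (exists_fiberLift f x).choose

theorem continuous_fiberLift (f : E.SkewProduct T) (x : X) : Continuous (fiberLift f x) :=
  (exists_fiberLift f x).choose_spec.1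

theorem strictMono_fiberLift (f : E.SkewProduct T) (x : X) : StrictMono (fiberLift f x) :=
  (exists_fiberLift f x).choose_spec.2.1

theorem fiberLift_add_one (f : E.SkewProduct T) (x : X) (t : ℝ) :
    fiberLift f x (t + 1) = fiberLift f x t + 1 :=
  (exists_fiberLift f x).choose_spec.2.2.1 t

theorem apply_cover (f : E.SkewProduct T) (x : X) (t : ℝ) :
    f.1 (cover (someFrame E x) t) = cover (someFrame E (T x)) (fiberLift f x t) :=
  (exists_fiberLift f x).choose_spec.2.2.2 t

/-- The lift above the orbit of `x` of the `n`-th iterate of `f` followed by the rotation of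
angle `π s`. -/
def iterLift (f : E.SkewProduct T) (s : ℝ) : ℕ → X → ℝ → ℝ
  | 0, _, t => t
  | n + 1, x, t => iterLift f s n (T x) (fiberLift f x t + s)

variable (f : E.SkewProduct T)

theorem iterLift_zero (s : ℝ) (x : X) (t : ℝ) : iterLift f s 0 x t = t := rfl

theorem iterLift_succ (s : ℝ) (n : ℕ) (x : X) (t : ℝ) :
    iterLift f s (n + 1) x t = iterLift f s n (T x) (fiberLift f x t + s) := rfl

theorem iterLift_add (s : ℝ) (m n : ℕ) (x : X) (t : ℝ) :
    iterLift f s (m + n) x t = iterLift f s n (T^[m] x) (iterLift f s m x t) := by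
  induction m generalizing x t with
  | zero => rw [zero_add]; rfl
  | succ m ih =>
    rw [show m + 1 + n = m + n + 1 by omega, iterLift_succ, ih, iterLift_succ,
      Function.iterate_succ_apply]

theorem iterLift_succ' (s : ℝ) (n : ℕ) (x : X) (t : ℝ) :
    iterLift f s (n + 1) x t = fiberLift f (T^[n] x) (iterLift f s n x t) + s :=
  iterLift_add f s n 1 x t

theorem iterLift_add_one (s : ℝ) (n : ℕ) (x : X) (t : ℝ) :
    iterLift f s n x (t + 1) = iterLift f s n x t + 1 := by
  induction n generalizing x t with
  | zero => rfl
  | succ n ih => rw [iterLift_succ, iterLift_succ, fiberLift_add_one, add_right_comm, ih]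

theorem iterLift_mono {s s' t t' : ℝ} (hs : s ≤ s') (ht : t ≤ t') (n : ℕ) (x : X) :
    iterLift f s n x t ≤ iterLift f s' n x t' := by
  induction n generalizing x t t' with
  | zero => exact ht
  | succ n ih => exact ih (add_le_add ((strictMono_fiberLift f x).monotone ht) hs) (T x)

theorem continuous_iterLift (n : ℕ) (x : X) :
    Continuous fun z : ℝ × ℝ => iterLift f z.1 n x z.2 := by
  induction n generalizing x with
  | zero => exact continuous_snd
  | succ n ih =>
    have h : Continuous fun z : ℝ × ℝ => (z.1, fiberLift f x z.2 + z.1) :=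
      continuous_fst.prodMk (((continuous_fiberLift f x).comp continuous_snd).add continuous_fst)
    exact (ih (T x)).comp h

/-- The variation of the `n`-th iterate when the angle of the added rotation goes from `-π θ`
to `π θ`, measured in turns of the circle of lines. -/
def spread (θ : ℝ) (n : ℕ) (x : X) (t : ℝ) : ℝ := iterLift f θ n x t - iterLift f (-θ) n x t

/-- Once the spread has reached one, it stays larger than one, since the lifts commute with the unit
translation and the last rotation adds `2 θ`. -/
theorem one_lt_spread_succ {θ : ℝ} (hθ : 0 < θ) {n : ℕ} {x : X} {t : ℝ}
    (h : 1 ≤ spread f θ n x t) : 1 < spread f θ (n + 1) x t := by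
  rw [spread] at h ⊢
  rw [iterLift_succ', iterLift_succ']
  have h1 : iterLift f (-θ) n x t + 1 ≤ iterLift f θ n x t := by linarith
  have h2 := (strictMono_fiberLift f (T^[n] x)).monotone h1
  rw [fiberLift_add_one] at h2
  linarith

theorem spread_lt_one_of_le {θ : ℝ} (hθ : 0 < θ) {n : ℕ} {x : X} {t : ℝ}
    (h : spread f θ (n + 1) x t ≤ 1) {k : ℕ} (hk : k ≤ n) : spread f θ k x t < 1 := by
  by_contra! hcon
  have h1 : ∀ m, k ≤ m → 1 ≤ spread f θ m x t := by
    intro m hm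
    induction m, hm using Nat.le_induction with
    | base => exact hcon
    | succ m _ ih => exact (one_lt_spread_succ f hθ ih).le
  exact absurd (one_lt_spread_succ f hθ (h1 n hk)) (not_lt.2 h)

/-- If the spread of the `n`-th iterate is at least one everywhere above `B`, each visit to `B`
adds one to the spread. -/
theorem sum_indicator_le_spread {θ : ℝ} (hθ : 0 < θ) {n : ℕ} {B : Set X}
    (hB : ∀ x ∈ B, ∀ t, 1 ≤ spread f θ n x t) (k : ℕ) (x : X) (t : ℝ) :
    ∑ j ∈ Finset.range k, B.indicator (fun _ => (1 : ℝ)) ((T^[n])^[j] x)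
      ≤ spread f θ (n * k) x t := by
  simp only [spread] at hB ⊢
  induction k generalizing x t with
  | zero => simp [iterLift_zero]
  | succ k ih =>
    rw [Finset.sum_range_succ', mul_add, mul_one, add_comm (n * k) n, iterLift_add, iterLift_add]
    simp only [Function.iterate_succ_apply, Function.iterate_zero_apply]
    have h1 := ih (T^[n] x) (iterLift f (-θ) n x t)
    have h2 : iterLift f θ (n * k) (T^[n] x) (iterLift f (-θ) n x t)
        + B.indicator (fun _ => (1 : ℝ)) x
        ≤ iterLift f θ (n * k) (T^[n] x) (iterLift f θ n x t) := by
      by_cases hx : x ∈ B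
      · rw [indicator_of_mem hx, ← iterLift_add_one]
        exact iterLift_mono f le_rfl (by linarith [hB x hx t]) _ _
      · rw [indicator_of_notMem hx, add_zero]
        exact iterLift_mono f le_rfl (iterLift_mono f (by linarith) le_rfl _ _) _ _
    linarith

/-- The winding number can be computed with any lift, in any frame. -/
theorem isWindingNumber_eq {γ : unitInterval → E.Proj} {w : ℝ} (hw : IsWindingNumber γ w) {x : X}
    (b : E.Frame x) {θ : unitInterval → ℝ} (hθc : Continuous θ) (hθ : ∀ t, γ t = cover b (θ t)) :
    w = θ 1 - θ 0 := by
  obtain ⟨x', b', θ', h', rfl⟩ := hw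
  obtain rfl : x' = x := congrArg Proj.base ((h' 0).symm.trans (hθ 0))
  obtain ⟨c, hc⟩ := exists_cover_eq_cover_add b b'
  have hint : ∀ t, ∃ n : ℤ, θ' t + c - θ t = n := by
    intro t
    have h1 := (hθ t).symm.trans (h' t)
    rw [hc, cover_eq_cover] at h1
    obtain ⟨n, hn⟩ := h1
    exact ⟨n, by linarith⟩
  have h2 := eq_of_continuous_of_forall_int
    ((θ'.continuous.add continuous_const).sub hθc) hint 0 1
  simp only [Pi.add_apply, Pi.sub_apply] at h2
  linarith

end Pointwise

section Topology

variable {X : Type*} [TopologicalSpace X] {F : Type*} [NormedAddCommGroup F] [NormedSpace ℝ F]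
  {V : X → Type*} [TopologicalSpace (TotalSpace F V)]
  [∀ x, NormedAddCommGroup (V x)] [∀ x, InnerProductSpace ℝ (V x)]
  [FiberBundle F V] [VectorBundle ℝ F V] [IsContinuousRiemannianBundle F V]
  {E : OrientedPlaneBundle F V} {T : X ≃ₜ X} (f : E.SkewProduct T)

/-- The skew-product `f` followed by the rotation of angle `π s`. -/
def rotated (s : ℝ) : E.SkewProduct T :=
  ⟨⟨fun p => rotate s (f.1 p),
    continuous_rotate.comp (continuous_const.prodMk f.1.continuous)⟩, by
    refine ⟨fun p => ?_, fun x b b' => ?_⟩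
    · change (rotate s (f.1 p)).base = _
      rw [base_rotate, f.2.1]
    · obtain ⟨G, hGc, hGm, hG1, hG⟩ := f.2.2 x b b'
      refine ⟨fun t => G t + s, by fun_prop, fun t t' h => ?_, fun t => ?_, fun t => ?_⟩
      · simpa using hGm h
      · simp only [hG1]; ring
      · change rotate s (f.1 (cover b t)) = _
        rw [hG, rotate_cover]⟩

theorem rotated_apply (s : ℝ) (p : E.Proj) : (rotated f s).1 p = rotate s (f.1 p) := rfl

theorem rotated_zero : rotated f 0 = f :=
  Subtype.ext (ContinuousMap.ext fun p => by rw [rotated_apply, rotate_zero])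

theorem continuous_rotated : Continuous (rotated f) := by
  refine Continuous.subtype_mk (ContinuousMap.continuous_of_continuous_uncurry _ ?_) _
  exact continuous_rotate.comp
    (continuous_fst.prodMk (f.1.continuous.comp continuous_snd))

theorem rotated_iterate_cover (s : ℝ) (n : ℕ) (x : X) (t : ℝ) :
    (rotated f s).1^[n] (cover (someFrame E x) t)
      = cover (someFrame E (T^[n] x)) (iterLift f s n x t) := by
  induction n generalizing x t with
  | zero => rfl
  | succ n ih =>
    rw [Function.iterate_succ_apply, rotated_apply, apply_cover, rotate_cover, ih]
    rfl

/-- The path of skew-products obtained by adding rotations to `f`. -/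
def rotationPath (θ : ℝ) : Path f (rotated f θ) where
  toFun t := rotated f (t * θ)
  continuous_toFun := (continuous_rotated f).comp (continuous_subtype_val.mul continuous_const)
  source' := by rw [Set.Icc.coe_zero, zero_mul, rotated_zero]
  target' := by rw [Set.Icc.coe_one, one_mul]

/-- Only the difference of the lifts at both ends of the path matters, because `iterLift` is a
continuous lift of the whole path. -/
theorem HasRotationNumberAt.tendsto_iterLift {θ : ℝ} {x : X} {r : ℝ}
    (h : HasRotationNumberAt (rotationPath f θ) x r) (t : ℝ) :
    Tendsto (fun n : ℕ => (iterLift f θ n x t - iterLift f 0 n x t) / n) atTop (𝓝 r) := by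
  obtain ⟨w, hw, hlim⟩ := h (cover (someFrame E x) t) rfl
  refine hlim.congr fun n => ?_
  have h1 := isWindingNumber_eq (hw n) (someFrame E (T^[n] x))
    (θ := fun τ => iterLift f ((τ : ℝ) * θ) n x t)
    ((continuous_iterLift f n x).comp
      ((continuous_subtype_val.mul continuous_const).prodMk continuous_const))
    fun τ => rotated_iterate_cover f _ n x t
  rw [h1, Set.Icc.coe_one, Set.Icc.coe_zero, one_mul, zero_mul]

/-- If the rotation numbers of the paths to both extreme rotations vanish, the lines can spread over
a whole circle only above a negligible set: the spread grows sublinearly almost everywhere, while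
each visit to `B` of the `n`-th iterate of `T` adds one. -/
theorem measure_eq_zero_of_one_le_spread [MeasurableSpace X] {μ : Measure X} [IsFiniteMeasure μ]
    (hμ : MeasurePreserving T μ μ) {θ : ℝ} (hθ : 0 < θ)
    (h1 : HasRotationNumber μ (rotationPath f θ) 0)
    (h2 : HasRotationNumber μ (rotationPath f (-θ)) 0) (n : ℕ) {B : Set X} (hBm : MeasurableSet B)
    (hB : ∀ x ∈ B, ∀ t, 1 ≤ spread f θ n x t) : μ B = 0 := by
  rcases Nat.eq_zero_or_pos n with rfl | hn
  · have : B = ∅ := by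
      refine eq_empty_of_forall_notMem fun x hx => ?_
      have := hB x hx 0
      rw [spread, iterLift_zero, iterLift_zero] at this
      norm_num at this
    rw [this, measure_empty]
  obtain ⟨ρ₁, hρ₁, hi₁, hI₁⟩ := h1
  obtain ⟨ρ₂, hρ₂, hi₂, hI₂⟩ := h2
  have hlim : ∀ᵐ x ∂μ, Tendsto (fun n : ℕ => spread f θ n x 0 / n) atTop (𝓝 (ρ₁ x - ρ₂ x)) := by
    filter_upwards [hρ₁, hρ₂] with x hx1 hx2
    refine ((hx1.tendsto_iterLift f 0).sub (hx2.tendsto_iterLift f 0)).congr fun n => ?_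
    rw [spread, ← sub_div]
    congr 1; ring
  have hspread : ∀ k x t, 0 ≤ spread f θ k x t := fun k x t =>
    sub_nonneg.2 (iterLift_mono f (by linarith) le_rfl _ _)
  have hzero : ∀ᵐ x ∂μ, ρ₁ x - ρ₂ x = 0 := by
    have hnn : 0 ≤ᵐ[μ] fun x => ρ₁ x - ρ₂ x := by
      filter_upwards [hlim] with x hx
      exact ge_of_tendsto' hx fun k => div_nonneg (hspread _ _ _) (Nat.cast_nonneg _)
    refine (integral_eq_zero_iff_of_nonneg_ae hnn (hi₁.sub hi₂)).1 ?_
    rw [integral_sub hi₁ hi₂, hI₁, hI₂, sub_zero]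
  -- the frequencies of the visits to `B` tend to zero
  set c : ℕ → X → ℝ := fun k x =>
    (∑ j ∈ Finset.range k, B.indicator (fun _ => (1 : ℝ)) ((T^[n])^[j] x)) / k with hc
  have hc0 : ∀ k x, 0 ≤ c k x := fun k x => div_nonneg
    (Finset.sum_nonneg fun j _ => indicator_nonneg (fun _ _ => zero_le_one) _) (Nat.cast_nonneg _)
  have hclim : ∀ᵐ x ∂μ, Tendsto (fun k => c k x) atTop (𝓝 0) := by
    filter_upwards [hlim, hzero] with x hx hx0
    rw [hx0] at hx
    have hsub : Tendsto (fun k : ℕ => n * k) atTop atTop :=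
      tendsto_id.const_mul_atTop' hn
    have hx' := (hx.comp hsub).const_mul (n : ℝ)
    rw [mul_zero] at hx'
    refine squeeze_zero (fun k => hc0 k x) (fun k => ?_) hx'
    have hle := sum_indicator_le_spread f hθ hB k x 0
    have hn' : (n : ℝ) ≠ 0 := by exact_mod_cast hn.ne'
    simp only [Function.comp_apply, hc]
    rw [Nat.cast_mul, mul_div_assoc', mul_div_mul_left _ _ hn']
    exact div_le_div_of_nonneg_right hle (Nat.cast_nonneg _)
  have hTn : MeasurePreserving T^[n] μ μ := hμ.iterate n
  have hind : ∀ j, Integrable (fun x => B.indicator (fun _ => (1 : ℝ)) ((T^[n])^[j] x)) μ :=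
    fun j =>
    (hTn.iterate j).integrable_comp_of_integrable ((integrable_const (1 : ℝ)).indicator hBm)
  have hcint : ∀ k, Integrable (c k) μ := fun k =>
    (integrable_finsetSum _ fun j _ => hind j).div_const _
  have hint : ∀ k : ℕ, 0 < k → ∫ x, c k x ∂μ = μ.real B := by
    intro k hk
    have hj : ∀ j, ∫ x, B.indicator (fun _ => (1 : ℝ)) ((T^[n])^[j] x) ∂μ = μ.real B := by
      intro j
      have h3 : (fun x => B.indicator (fun _ => (1 : ℝ)) ((T^[n])^[j] x))
          = ((T^[n])^[j] ⁻¹' B).indicator (fun _ => (1 : ℝ)) := by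
        ext x; rfl
      rw [h3, integral_indicator_const _ ((hTn.iterate j).measurable hBm), smul_eq_mul, mul_one,
        measureReal_def, (hTn.iterate j).measure_preimage hBm.nullMeasurableSet, measureReal_def]
    simp only [hc]
    rw [integral_div, integral_finsetSum _ fun j _ => hind j]
    simp only [hj, Finset.sum_const, Finset.card_range, nsmul_eq_mul]
    have hk' : (k : ℝ) ≠ 0 := by exact_mod_cast hk.ne'
    field_simp
  have hdom := tendsto_integral_of_dominated_convergence (fun _ => (1 : ℝ))
    (fun k => (hcint k).aestronglyMeasurable) (integrable_const (1 : ℝ))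
    (fun k => ae_of_all _ fun x => by
      rw [Real.norm_of_nonneg (hc0 k x)]
      refine div_le_one_of_le₀ ?_ (Nat.cast_nonneg _)
      calc _ ≤ ∑ j ∈ Finset.range k, (1 : ℝ) :=
            Finset.sum_le_sum fun j _ => indicator_le_self' (fun _ _ => zero_le_one) _
        _ = k := by simp) hclim
  rw [integral_zero] at hdom
  have hconst : Tendsto (fun k : ℕ => ∫ x, c k x ∂μ) atTop (𝓝 (μ.real B)) :=
    tendsto_const_nhds.congr' (by
      filter_upwards [eventually_gt_atTop 0] with k hk using (hint k hk).symm)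
  have := tendsto_nhds_unique hconst hdom
  rwa [measureReal_eq_zero_iff] at this

variable [T2Space X] [CompactSpace X]

theorem continuous_rotated_iterate {Y : Type*} [TopologicalSpace Y] {s : Y → ℝ} {p : Y → E.Proj}
    (hs : Continuous s) (hp : Continuous p) (n : ℕ) :
    Continuous fun y => (rotated f (s y)).1^[n] (p y) := by
  have hg : Continuous fun y => rotated f (s y) := (continuous_rotated f).comp hs
  induction n with
  | zero => exact hp
  | succ n ih =>
    simp only [Function.iterate_succ_apply']
    exact continuous_skewProduct_apply hg ih

/-- The spread depends continuously on the line: it is given by a lift of a homotopy. -/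
theorem exists_continuous_spread (θ : ℝ) (n : ℕ) :
    ∃ W : E.Proj → ℝ, Continuous W ∧ ∀ x t, W (cover (someFrame E x) t) = spread f θ n x t := by
  have hs : Continuous fun z : unitInterval × E.Proj => (2 * (z.1 : ℝ) - 1) * θ := by
    fun_prop
  have h1 : Continuous fun z : unitInterval × E.Proj =>
      (rotated f ((2 * (z.1 : ℝ) - 1) * θ)).1^[n] z.2 :=
    continuous_rotated_iterate f hs continuous_snd n
  have h0 : Continuous fun z : unitInterval × E.Proj => (rotated f (-θ)).1^[n] z.2 :=
    continuous_rotated_iterate f continuous_const continuous_snd n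
  have hH : Continuous fun z : unitInterval × E.Proj =>
      rotTo ((rotated f (-θ)).1^[n] z.2) ((rotated f ((2 * (z.1 : ℝ) - 1) * θ)).1^[n] z.2) := by
    refine ContinuousOn.comp_continuous (f := fun z : unitInterval × E.Proj =>
      ((rotated f (-θ)).1^[n] z.2, (rotated f ((2 * (z.1 : ℝ) - 1) * θ)).1^[n] z.2))
      continuousOn_rotTo (h0.prodMk h1) fun z => ?_
    change ((rotated f (-θ)).1^[n] z.2).base = _
    rw [SkewProduct.base_iterate, SkewProduct.base_iterate]
  let H : C(unitInterval × E.Proj, Circle) := ⟨_, hH⟩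
  have hH0 : ∀ p, H (0, p) = Circle.exp ((ContinuousMap.const E.Proj (0 : ℝ)) p) := by
    intro p
    change rotTo ((rotated f (-θ)).1^[n] p)
      ((rotated f ((2 * ((0 : unitInterval) : ℝ) - 1) * θ)).1^[n] p) = _
    rw [Set.Icc.coe_zero, show (2 * (0 : ℝ) - 1) * θ = -θ by ring, rotTo, div_self',
      ContinuousMap.const_apply, Circle.exp_zero]
  let Γ := Circle.isCoveringMap_exp.liftHomotopy H (ContinuousMap.const E.Proj (0 : ℝ)) hH0
  have hΓ := Circle.isCoveringMap_exp.liftHomotopy_lifts H (ContinuousMap.const E.Proj (0 : ℝ)) hH0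
  have hΓ0 := Circle.isCoveringMap_exp.liftHomotopy_zero H (ContinuousMap.const E.Proj (0 : ℝ)) hH0
  refine ⟨fun p => Γ (1, p) / (2 * Real.pi), ?_, fun x t => ?_⟩
  · exact (Γ.continuous.comp (continuous_const.prodMk continuous_id)).div_const _
  · set p := cover (someFrame E x) t
    have hc : Continuous fun τ : unitInterval =>
        iterLift f ((2 * (τ : ℝ) - 1) * θ) n x t - iterLift f (-θ) n x t := by
      refine Continuous.sub ?_ continuous_const
      exact (continuous_iterLift f n x).comp ((by fun_prop : Continuous fun τ : unitInterval =>
        (2 * (τ : ℝ) - 1) * θ).prodMk continuous_const)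
    have hint : ∀ τ : unitInterval, ∃ m : ℤ, (iterLift f ((2 * (τ : ℝ) - 1) * θ) n x t
        - iterLift f (-θ) n x t) - Γ (τ, p) / (2 * Real.pi) = m := by
      intro τ
      have h3 : Circle.exp (Γ (τ, p)) = rotTo ((rotated f (-θ)).1^[n] p)
          ((rotated f ((2 * (τ : ℝ) - 1) * θ)).1^[n] p) := congrFun hΓ (τ, p)
      rw [rotated_iterate_cover, rotated_iterate_cover, rotTo_cover] at h3
      have h4 : Circle.exp (Γ (τ, p)) = turn (Γ (τ, p) / (2 * Real.pi)) := by
        rw [turn, mul_div_cancel₀ _ (by positivity)]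
      rw [h4, turn_eq_turn] at h3
      obtain ⟨m, hm⟩ := h3
      exact ⟨m, by linarith⟩
    have h5 := eq_of_continuous_of_forall_int (hc.sub ((Γ.continuous.comp
      ((continuous_id (X := unitInterval)).prodMk (continuous_const (y := p)))).div_const _))
      hint 1 0
    have h6 : Γ (0, p) = 0 := hΓ0 p
    simp only [Pi.sub_apply, Function.comp_apply, id_eq, Set.Icc.coe_one, Set.Icc.coe_zero,
        h6] at h5
    rw [show (2 * (0 : ℝ) - 1) * θ = -θ by ring, show (2 * (1 : ℝ) - 1) * θ = θ by ring,
      zero_div, sub_self, sub_zero, sub_eq_zero] at h5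
    exact h5.symm

end Topology

variable {X : Type*} [MetricSpace X] [CompactSpace X] [MeasurableSpace X] [BorelSpace X]
  {F : Type*} [NormedAddCommGroup F] [NormedSpace ℝ F]
  {V : X → Type*} [TopologicalSpace (TotalSpace F V)]
  [∀ x, NormedAddCommGroup (V x)] [∀ x, InnerProductSpace ℝ (V x)]
  [FiberBundle F V] [VectorBundle ℝ F V] [IsContinuousRiemannianBundle F V]
  {E : OrientedPlaneBundle F V} {T : X ≃ₜ X} {f : E.SkewProduct T} {μ : Measure X}

/-- Above the support of the measure, a mode-locked skew-product has for all times an orbit whose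
variation under small rotations stays below one turn. -/
theorem IsModeLocked.exists_spread_lt_one [IsFiniteMeasure μ] (h : IsModeLocked μ f)
    (hμ : MeasurePreserving T μ μ) :
    ∃ θ : ℝ, 0 < θ ∧ ∀ x ∈ μ.support, ∀ n, ∃ t, ∀ k ≤ n, spread f θ k x t < 1 := by
  obtain ⟨U, -, -, W, hW, hWU, hrot⟩ := h
  have h1 : rotated f ⁻¹' W ∈ 𝓝 (0 : ℝ) :=
    (continuous_rotated f).continuousAt (by rwa [rotated_zero])
  obtain ⟨ε, hε, hball⟩ := Metric.mem_nhds_iff.1 h1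
  have hmem : ∀ s : ℝ, |s| < ε → rotated f s ∈ W := fun s hs =>
    hball (by rwa [Metric.mem_ball, dist_zero_right, Real.norm_eq_abs])
  have hhas : ∀ s : ℝ, |s| < ε → HasRotationNumber μ (rotationPath f s) 0 := by
    intro s hs
    refine hrot _ (hmem s hs) _ fun t => hWU (hmem _ (lt_of_le_of_lt ?_ hs))
    rw [abs_mul, abs_of_nonneg t.2.1]
    exact mul_le_of_le_one_left (abs_nonneg _) t.2.2
  have hθ : |ε / 2| < ε := by rw [abs_of_pos (half_pos hε)]; linarith
  refine ⟨ε / 2, half_pos hε, fun x hx n => ?_⟩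
  obtain ⟨W', hW'c, hW'⟩ := exists_continuous_spread f (ε / 2) (n + 1)
  have hcl : IsClosed (Proj.base '' {p : E.Proj | W' p ≤ 1}) :=
    ((isClosed_le hW'c continuous_const).isCompact.image continuous_base).isClosed
  by_cases hxB : x ∈ Proj.base '' {p : E.Proj | W' p ≤ 1}
  · obtain ⟨p, hp, hpx⟩ := hxB
    obtain ⟨t, rfl⟩ := exists_cover_eq (someFrame E x) hpx
    refine ⟨t, fun k hk => spread_lt_one_of_le f (half_pos hε) ?_ hk⟩
    rw [← hW']
    exact hp
  · exfalso
    have h0 := measure_eq_zero_of_one_le_spread f hμ (half_pos hε) (hhas _ hθ)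
      (hhas _ (by rwa [abs_neg])) (n + 1) hcl.isOpen_compl.measurableSet fun y hy t => by
        by_contra! hcon
        refine hy ⟨cover (someFrame E y) t, ?_, rfl⟩
        rw [mem_ofPred_eq, hW']
        exact hcon.le
    rw [Measure.mem_support_iff_forall] at hx
    exact (hx _ (hcl.isOpen_compl.mem_nhds hxB)).ne' h0

end OrientedPlaneBundle

/-! ### The quadratic form of an arc -/

/-- The quadratic form `v ↦ det (u, v) * det (v, w) / det (u, w)` on the plane, where `u` and `w`
span the lines of angles `π a` and `π b`, evaluated at the unit vector of angle `π t`. It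
depends on the lines of `u` and `w` only, it is transported by the linear maps of determinant one,
and it is positive inside the arc between `a` and `b` and negative outside. -/
def arcForm (a b t : ℝ) : ℝ :=
  Real.sin (Real.pi * (t - a)) * Real.sin (Real.pi * (b - t)) / Real.sin (Real.pi * (b - a))

theorem sin_pi_mul_pos {t : ℝ} (h0 : 0 < t) (h1 : t < 1) : 0 < Real.sin (Real.pi * t) :=
  Real.sin_pos_of_pos_of_lt_pi (by positivity) (by nlinarith [Real.pi_pos])

theorem sin_pi_mul_le {s t : ℝ} (h0 : 0 ≤ s) (hst : s ≤ t) (ht : t ≤ 1 - s) :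
    Real.sin (Real.pi * s) ≤ Real.sin (Real.pi * t) := by
  have hpi := Real.pi_pos
  rcases le_total t (1 / 2) with h | h
  · exact Real.sin_le_sin_of_le_of_le_pi_div_two (by nlinarith) (by nlinarith) (by nlinarith)
  · rw [← Real.sin_pi_sub (Real.pi * t)]
    exact Real.sin_le_sin_of_le_of_le_pi_div_two (by nlinarith) (by nlinarith) (by nlinarith)

/-- The form in the frame whose first vector is the bisector of the arc. -/
theorem arcForm_eq {a b t : ℝ} (h0 : 0 < b - a) (h1 : b - a < 1) :
    arcForm a b t = (Real.cos (Real.pi * (t - (a + b) / 2)) ^ 2 * Real.tan (Real.pi * (b - a) / 2)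
      - Real.sin (Real.pi * (t - (a + b) / 2)) ^ 2 * (Real.tan (Real.pi * (b - a) / 2))⁻¹) / 2 := by
  have hpi := Real.pi_pos
  set y := Real.pi * (t - (a + b) / 2) with hy
  set h := Real.pi * (b - a) / 2 with hh
  have hs : 0 < Real.sin h := Real.sin_pos_of_pos_of_lt_pi (by positivity) (by nlinarith)
  have hc : 0 < Real.cos h := Real.cos_pos_of_mem_Ioo ⟨by nlinarith, by nlinarith⟩
  rw [arcForm, show Real.pi * (t - a) = h + y by rw [hy, hh]; ring,
    show Real.pi * (b - t) = h - y by rw [hy, hh]; ring,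
    show Real.pi * (b - a) = 2 * h by rw [hh]; ring, Real.sin_two_mul, Real.sin_add, Real.sin_sub,
    Real.tan_eq_sin_div_cos]
  field_simp
  ring

/-- The slope of the sides of an arc with respect to its bisector grows by a definite factor when
the arc is widened. -/
theorem tan_widen {a b θ : ℝ} (h0 : 0 < b - a) (hθ : 0 ≤ θ) (h1 : b - a + 2 * θ < 1) :
    (1 + Real.sin (Real.pi * θ)) * Real.tan (Real.pi * (b - a) / 2)
      ≤ Real.tan (Real.pi * ((b + θ) - (a - θ)) / 2) := by
  have hpi := Real.pi_pos
  set h := Real.pi * (b - a) / 2 with hh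
  have hH : Real.pi * ((b + θ) - (a - θ)) / 2 = h + Real.pi * θ := by rw [hh]; ring
  rw [hH]
  have hs : 0 < Real.sin h := Real.sin_pos_of_pos_of_lt_pi (by positivity) (by nlinarith)
  have hc : 0 < Real.cos h := Real.cos_pos_of_mem_Ioo ⟨by nlinarith, by nlinarith⟩
  have hC : 0 < Real.cos (h + Real.pi * θ) := Real.cos_pos_of_mem_Ioo ⟨by nlinarith, by nlinarith⟩
  have hsθ : 0 ≤ Real.sin (Real.pi * θ) :=
    Real.sin_nonneg_of_nonneg_of_le_pi (by positivity) (by nlinarith)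
  have hdiff : Real.sin (h + Real.pi * θ) * Real.cos h - Real.sin h * Real.cos (h + Real.pi * θ)
      = Real.sin (Real.pi * θ) := by
    rw [mul_comm (Real.sin h), ← Real.sin_sub, add_sub_cancel_left]
  have hprod : Real.sin h * Real.cos (h + Real.pi * θ) ≤ 1 :=
    mul_le_one₀ (Real.sin_le_one _) hC.le (Real.cos_le_one _)
  rw [Real.tan_eq_sin_div_cos, Real.tan_eq_sin_div_cos, ← mul_div_assoc, div_le_div_iff₀ hc hC]
  nlinarith

/-- Widening the arc multiplies the form by a definite factor inside the arc, where the form is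
positive, and divides it by this factor outside. -/
theorem arcForm_widen {a b θ : ℝ} (h0 : 0 < b - a) (hθ : 0 ≤ θ) (h1 : b - a + 2 * θ < 1) (t : ℝ) :
    (1 + Real.sin (Real.pi * θ)) * arcForm a b t ≤ arcForm (a - θ) (b + θ) t ∧
      (1 + Real.sin (Real.pi * θ))⁻¹ * arcForm a b t ≤ arcForm (a - θ) (b + θ) t := by
  have hpi := Real.pi_pos
  rw [arcForm_eq h0 (by linarith), arcForm_eq (a := a - θ) (b := b + θ) (by linarith)
    (by linarith), show a - θ + (b + θ) = a + b by ring]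
  have htan := tan_widen h0 hθ h1
  have hu : 0 < Real.tan (Real.pi * (b - a) / 2) :=
    Real.tan_pos_of_pos_of_lt_pi_div_two (by positivity) (by nlinarith)
  have hlam : 0 ≤ Real.sin (Real.pi * θ) :=
    Real.sin_nonneg_of_nonneg_of_le_pi (by positivity) (by nlinarith)
  set u := Real.tan (Real.pi * (b - a) / 2)
  set v := Real.tan (Real.pi * ((b + θ) - (a - θ)) / 2)
  set c := Real.cos (Real.pi * (t - (a + b) / 2)) ^ 2
  set s := Real.sin (Real.pi * (t - (a + b) / 2)) ^ 2
  have hc : 0 ≤ c := sq_nonneg _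
  have hs : 0 ≤ s := sq_nonneg _
  set l := 1 + Real.sin (Real.pi * θ)
  have hl : 1 ≤ l := by linarith
  have hl0 : 0 < l := by linarith
  have hli : l⁻¹ ≤ 1 := inv_le_one_of_one_le₀ hl
  have hv : v⁻¹ ≤ l⁻¹ * u⁻¹ := by
    rw [← mul_inv]
    exact inv_anti₀ (by positivity) htan
  have hui : 0 < u⁻¹ := inv_pos.2 hu
  have h2 : l⁻¹ * u⁻¹ ≤ l * u⁻¹ := mul_le_mul_of_nonneg_right (hli.trans hl) hui.le
  have h3 : l⁻¹ * u ≤ v := (mul_le_mul_of_nonneg_right (hli.trans hl) hu.le).trans htan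
  constructor
  · have e1 := mul_le_mul_of_nonneg_left htan hc
    have e2 := mul_le_mul_of_nonneg_left (hv.trans h2) hs
    linarith
  · have e1 := mul_le_mul_of_nonneg_left h3 hc
    have e2 := mul_le_mul_of_nonneg_left hv hs
    linarith

theorem sin_sq_le_arcForm {a b t θ : ℝ} (hθ : 0 < θ) (h1 : b - a < 1) (hat : a + θ ≤ t)
    (htb : t ≤ b - θ) : Real.sin (Real.pi * θ) ^ 2 ≤ arcForm a b t := by
  have h2 := sin_pi_mul_pos (t := b - a) (by linarith) h1
  have h3 := sin_pi_mul_le (s := θ) (t := t - a) hθ.le (by linarith) (by linarith)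
  have h4 := sin_pi_mul_le (s := θ) (t := b - t) hθ.le (by linarith) (by linarith)
  have h5 := sin_pi_mul_pos (t := θ) hθ (by linarith)
  rw [arcForm, le_div_iff₀ h2, sq]
  calc _ ≤ Real.sin (Real.pi * θ) * Real.sin (Real.pi * θ) * 1 :=
        mul_le_mul_of_nonneg_left (Real.sin_le_one _) (by positivity)
    _ ≤ _ := by rw [mul_one]; exact mul_le_mul h3 h4 h5.le (h5.le.trans h3)

theorem sin_sq_le_neg_arcForm {a b t θ : ℝ} (hθ : 0 < θ) (h0 : 0 < b - a) (hat : b + θ ≤ t)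
    (htb : t ≤ a + 1 - θ) : Real.sin (Real.pi * θ) ^ 2 ≤ -arcForm a b t := by
  have h2 := sin_pi_mul_pos (t := b - a) h0 (by linarith)
  have h3 := sin_pi_mul_le (s := θ) (t := t - a) hθ.le (by linarith) (by linarith)
  have h4 := sin_pi_mul_le (s := θ) (t := t - b) hθ.le (by linarith) (by linarith)
  have h5 := sin_pi_mul_pos (t := θ) hθ (by linarith)
  rw [arcForm, ← neg_div, ← mul_neg, ← Real.sin_neg, show -(Real.pi * (b - t))
    = Real.pi * (t - b) by ring, le_div_iff₀ h2, sq]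
  calc _ ≤ Real.sin (Real.pi * θ) * Real.sin (Real.pi * θ) * 1 :=
        mul_le_mul_of_nonneg_left (Real.sin_le_one _) (by positivity)
    _ ≤ _ := by rw [mul_one]; exact mul_le_mul h3 h4 h5.le (h5.le.trans h3)

theorem arcForm_le {a b θ : ℝ} (hθ : 0 < θ) (h0 : 0 < b - a) (h1 : b - a + 2 * θ < 1) (t : ℝ) :
    arcForm a b t ≤ (2 * Real.sin (Real.pi * θ))⁻¹ := by
  have hpi := Real.pi_pos
  rw [arcForm_eq h0 (by linarith)]
  set h := Real.pi * (b - a) / 2 with hh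
  have hcos : Real.sin (Real.pi * θ) ≤ Real.cos h := by
    rw [← Real.cos_pi_div_two_sub]
    exact Real.cos_le_cos_of_nonneg_of_le_pi (by positivity) (by nlinarith) (by nlinarith)
  have h5 := sin_pi_mul_pos (t := θ) hθ (by linarith)
  have hu : 0 < Real.tan h := Real.tan_pos_of_pos_of_lt_pi_div_two (by positivity) (by nlinarith)
  have htan : Real.tan h ≤ (Real.sin (Real.pi * θ))⁻¹ := by
    rw [Real.tan_eq_sin_div_cos, div_eq_mul_inv]
    calc _ ≤ 1 * (Real.cos h)⁻¹ := mul_le_mul_of_nonneg_right (Real.sin_le_one _)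
          (inv_nonneg.2 (h5.le.trans hcos))
      _ ≤ _ := by rw [one_mul]; exact inv_anti₀ h5 hcos
  rw [mul_inv]
  have e1 : Real.cos (Real.pi * (t - (a + b) / 2)) ^ 2 * Real.tan h ≤ 1 * Real.tan h :=
    mul_le_mul_of_nonneg_right (Real.cos_sq_le_one _) hu.le
  have e2 : 0 ≤ Real.sin (Real.pi * (t - (a + b) / 2)) ^ 2 * (Real.tan h)⁻¹ := by positivity
  linarith

theorem neg_arcForm_le {a b : ℝ} (h0 : 0 < b - a) (h1 : b - a < 1) (t : ℝ) :
    -arcForm a b t ≤ (Real.sin (Real.pi * (b - a)))⁻¹ := by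
  have h2 := sin_pi_mul_pos h0 h1
  rw [arcForm, ← neg_div, ← one_div, div_le_div_iff_of_pos_right h2]
  refine (neg_le_abs _).trans ?_
  rw [abs_mul]
  exact mul_le_one₀ (Real.abs_sin_le_one _) (abs_nonneg _) (Real.abs_sin_le_one _)

/-- The transformation rule of the form under an increasing lift which satisfies the chord
identity with the factor `r`. -/
theorem arcForm_eq_mul {G r : ℝ → ℝ} (hG : StrictMono G) (hG1 : ∀ t, G (t + 1) = G t + 1)
    (hr : ∀ t, 0 < r t)
    (h : ∀ s t, Real.sin (Real.pi * (t - s)) ^ 2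
      = r s * r t * Real.sin (Real.pi * (G t - G s)) ^ 2)
    {a b t : ℝ} (hab : a < b) (hba : b < a + 1) (hat : a ≤ t) (hta : t ≤ a + 1) :
    arcForm a b t = r t * arcForm (G a) (G b) (G t) := by
  have hpi := Real.pi_pos
  have hsin : ∀ s t, s ≤ t → t ≤ s + 1 → Real.sin (Real.pi * (t - s))
      = √(r s) * √(r t) * Real.sin (Real.pi * (G t - G s)) := by
    intro s t hst hts
    have h1 := hG.monotone hst
    have h2 := hG.monotone hts
    rw [hG1] at h2
    have h3 : 0 ≤ Real.sin (Real.pi * (t - s)) :=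
      Real.sin_nonneg_of_nonneg_of_le_pi (by nlinarith) (by nlinarith)
    have h4 : 0 ≤ Real.sin (Real.pi * (G t - G s)) :=
      Real.sin_nonneg_of_nonneg_of_le_pi (by nlinarith) (by nlinarith)
    rw [← Real.sqrt_sq h3, h s t, Real.sqrt_mul (mul_pos (hr s) (hr t)).le,
      Real.sqrt_mul (hr s).le, Real.sqrt_sq h4]
  have hsin' : Real.sin (Real.pi * (b - t))
      = √(r t) * √(r b) * Real.sin (Real.pi * (G b - G t)) := by
    rcases le_total t b with htb | hbt
    · exact hsin t b htb (by linarith)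
    · have := hsin b t hbt (by linarith)
      rw [show Real.pi * (b - t) = -(Real.pi * (t - b)) by ring, Real.sin_neg, this,
        show Real.pi * (G b - G t) = -(Real.pi * (G t - G b)) by ring, Real.sin_neg]
      ring
  have hGab : 0 < Real.sin (Real.pi * (G b - G a)) := by
    have h1 := hG hab
    have h2 := hG hba
    rw [hG1] at h2
    exact sin_pi_mul_pos (by linarith) (by linarith)
  have hra := Real.sqrt_pos.2 (hr a)
  have hrb := Real.sqrt_pos.2 (hr b)
  rw [arcForm, arcForm, hsin a t hat hta, hsin', hsin a b hab.le hba.le]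
  field_simp
  rw [Real.sq_sqrt (hr t).le]
  ring

/-! ### Contraction and expansion along strips of arcs -/

namespace LinearCocycle

open OrientedPlaneBundle

variable {X : Type*} [TopologicalSpace X] {F : Type*}
  {V : X → Type*} [TopologicalSpace (TotalSpace F V)]
  [∀ x, NormedAddCommGroup (V x)] [∀ x, InnerProductSpace ℝ (V x)]
  {T : X ≃ₜ X} (A : LinearCocycle F V T) {E : OrientedPlaneBundle F V}

section Strips

variable (hA : A.PreservesOrientation E)

local notation "Φ" => projectivization A hA

theorem arcForm_eq_rate_mul (x : X) {a b t : ℝ} (hab : a < b) (hba : b < a + 1) (hat : a ≤ t)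
    (hta : t ≤ a + 1) : arcForm a b t = rate A hA (cover (someFrame E x) t)
      * arcForm (fiberLift Φ x a) (fiberLift Φ x b) (fiberLift Φ x t) := by
  refine arcForm_eq_mul (r := fun t => rate A hA (cover (someFrame E x) t))
    (strictMono_fiberLift Φ x) (fiberLift_add_one Φ x) (fun t => rate_pos A hA _)
    (fun s t => ?_) hab hba hat hta
  have h := chord_sq_eq_rate_mul A hA (p := cover (someFrame E x) s)
    (q := cover (someFrame E x) t) rfl
  rw [apply_cover, apply_cover, chord_cover, chord_cover, mul_pow, mul_pow, sq_abs, sq_abs] at h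
  linarith

variable {A hA} {θ m M : ℝ}

/-- A strip of arcs which widens by `θ` on both sides at each step and never covers a whole circle
has an orbit in its complement, which the cocycle contracts. -/
theorem exists_growth_le_of_strip (hθ : 0 < θ) (hmin : ∀ p, m ≤ rate A hA p)
    (n : ℕ) (x : X) {a b : ℝ} (hab : a < b)
    (hstrip : ∀ k ≤ n, iterLift Φ θ k x b - iterLift Φ (-θ) k x a < 1) :
    ∃ α, b ≤ α ∧ α ≤ a + 1 ∧ ∀ k < n, growth A hA k (cover (someFrame E x) α)
      * (m * Real.sin (Real.pi * θ) ^ 2)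
        ≤ (1 + Real.sin (Real.pi * θ))⁻¹ ^ k * -arcForm a b α := by
  induction n generalizing x a b with
  | zero =>
    have h0 := hstrip 0 le_rfl
    rw [iterLift_zero, iterLift_zero] at h0
    exact ⟨b, le_rfl, by linarith, fun k hk => absurd hk (Nat.not_lt_zero k)⟩
  | succ n ih =>
    have h0 := hstrip 0 (Nat.zero_le _)
    have h1 := hstrip 1 (by omega)
    simp only [iterLift_succ, iterLift_zero] at h0 h1
    have hG := strictMono_fiberLift Φ x
    have hGab := hG hab
    obtain ⟨α', hbα, hαa, hgrow⟩ := ih (T x) (a := fiberLift Φ x a + -θ)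
      (b := fiberLift Φ x b + θ) (by linarith) fun k hk => hstrip (k + 1) (by omega)
    obtain ⟨α, rfl⟩ : ∃ α, fiberLift Φ x α = α' := by
      have hGa1 : fiberLift Φ x b ≤ fiberLift Φ x (a + 1) := by rw [fiberLift_add_one]; linarith
      obtain ⟨α, -, h⟩ := intermediate_value_Icc (hG.le_iff_le.1 hGa1)
        (continuous_fiberLift Φ x).continuousOn
        (⟨by linarith, by rw [fiberLift_add_one]; linarith⟩ : α' ∈ Icc _ _)
      exact ⟨α, h⟩
    have hα1 : b ≤ α := hG.le_iff_le.1 (by linarith)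
    have hα2 : α ≤ a + 1 := hG.le_iff_le.1 (by rw [fiberLift_add_one]; linarith)
    have hform := arcForm_eq_rate_mul A hA x (t := α) hab (by linarith) (by linarith) hα2
    have hν := rate_pos A hA (cover (someFrame E x) α)
    refine ⟨α, hα1, hα2, fun k hk => ?_⟩
    rcases k with _ | k
    · have h3 := sin_sq_le_neg_arcForm hθ (a := fiberLift Φ x a) (b := fiberLift Φ x b)
        (t := fiberLift Φ x α) (by linarith) (by linarith) (by linarith)
      rw [growth_zero, one_mul, pow_zero, one_mul, hform, ← mul_neg]
      exact mul_le_mul (hmin _) h3 (sq_nonneg _) hν.le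
    · have h3 := hgrow k (by omega)
      have h4 := (arcForm_widen (a := fiberLift Φ x a) (b := fiberLift Φ x b) (by linarith) hθ.le
        (by linarith) (fiberLift Φ x α)).2
      have hl : 0 < 1 + Real.sin (Real.pi * θ) := by
        linarith [sin_pi_mul_pos hθ (by linarith)]
      rw [← sub_eq_add_neg] at h3
      rw [growth_succ, apply_cover, hform, pow_succ]
      set l := (1 + Real.sin (Real.pi * θ))⁻¹
      have hl' : 0 < l := inv_pos.2 hl
      calc _ = rate A hA (cover (someFrame E x) α)
              * (growth A hA k (cover (someFrame E (T x)) (fiberLift Φ x α))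
                * (m * Real.sin (Real.pi * θ) ^ 2)) := by ring
        _ ≤ rate A hA (cover (someFrame E x) α) * (l ^ k
              * (l * -arcForm (fiberLift Φ x a) (fiberLift Φ x b) (fiberLift Φ x α))) := by
            refine mul_le_mul_of_nonneg_left (h3.trans ?_) hν.le
            exact mul_le_mul_of_nonneg_left (by linarith) (pow_nonneg hl'.le _)
        _ = _ := by ring

/-- The cocycle expands along the orbits which stay inside such a strip. -/
theorem le_growth_of_strip (hθ : 0 < θ) (hmax : ∀ p, rate A hA p ≤ M)
    (n : ℕ) (x : X) {a b α : ℝ} (hab : a < b)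
    (hstrip : ∀ k ≤ n, iterLift Φ θ k x b - iterLift Φ (-θ) k x a < 1) (haα : a ≤ α) (hαb : α ≤ b)
    {k : ℕ} (hk : k < n) : (1 + Real.sin (Real.pi * θ)) ^ k * arcForm a b α
      ≤ growth A hA k (cover (someFrame E x) α) * (M * (2 * Real.sin (Real.pi * θ))⁻¹) := by
  induction k generalizing n x a b α with
  | zero =>
    have h0 := hstrip 0 (Nat.zero_le _)
    have h1 := hstrip 1 (by omega)
    simp only [iterLift_succ, iterLift_zero] at h0 h1
    have hGab := strictMono_fiberLift Φ x hab
    have hν := rate_pos A hA (cover (someFrame E x) α)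
    have hs := sin_pi_mul_pos hθ (by linarith)
    rw [growth_zero, pow_zero, one_mul, one_mul,
      arcForm_eq_rate_mul A hA x (t := α) hab (by linarith) haα (by linarith)]
    calc _ ≤ rate A hA (cover (someFrame E x) α) * (2 * Real.sin (Real.pi * θ))⁻¹ :=
          mul_le_mul_of_nonneg_left (arcForm_le hθ (by linarith) (by linarith) _) hν.le
      _ ≤ _ := mul_le_mul_of_nonneg_right (hmax _) (by positivity)
  | succ k ih =>
    have h0 := hstrip 0 (Nat.zero_le _)
    have h1 := hstrip 1 (by omega)
    simp only [iterLift_succ, iterLift_zero] at h0 h1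
    have hG := strictMono_fiberLift Φ x
    have hGab := hG hab
    have hν := rate_pos A hA (cover (someFrame E x) α)
    have hs := sin_pi_mul_pos hθ (by linarith)
    have h2 := ih (n - 1) (T x) (a := fiberLift Φ x a + -θ) (b := fiberLift Φ x b + θ)
      (α := fiberLift Φ x α) (by linarith) (fun j hj => hstrip (j + 1) (by omega))
      (by linarith [hG.monotone haα]) (by linarith [hG.monotone hαb]) (by omega)
    have h4 := (arcForm_widen (a := fiberLift Φ x a) (b := fiberLift Φ x b) (by linarith) hθ.le
      (by linarith) (fiberLift Φ x α)).1
    rw [← sub_eq_add_neg] at h2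
    rw [growth_succ, apply_cover, pow_succ,
      arcForm_eq_rate_mul A hA x (t := α) hab (by linarith) haα (by linarith)]
    set l := 1 + Real.sin (Real.pi * θ)
    have hl : 0 < l := by positivity
    calc _ = rate A hA (cover (someFrame E x) α) * (l ^ k
              * (l * arcForm (fiberLift Φ x a) (fiberLift Φ x b) (fiberLift Φ x α))) := by ring
      _ ≤ rate A hA (cover (someFrame E x) α)
            * (growth A hA k (cover (someFrame E (T x)) (fiberLift Φ x α))
              * (M * (2 * Real.sin (Real.pi * θ))⁻¹)) := by
          refine mul_le_mul_of_nonneg_left (le_trans ?_ h2) hν.le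
          exact mul_le_mul_of_nonneg_left h4 (pow_nonneg hl.le _)
      _ = _ := by ring

/-- The expansion from the time `i` on along an orbit which starts inside the strip with a margin:
the form stays bounded from below, because the orbit never comes closer than `θ` to the boundary. -/
theorem le_growth_iterate_of_strip (hθ : 0 < θ) (hmax : ∀ p, rate A hA p ≤ M)
    (i n : ℕ) (x : X) {a b α : ℝ}
    (hstrip : ∀ k ≤ n, iterLift Φ θ k x b - iterLift Φ (-θ) k x a < 1) (haα : a + θ ≤ α)
    (hαb : α ≤ b - θ) {k : ℕ} (hk : i + k < n) :
    (1 + Real.sin (Real.pi * θ)) ^ k * Real.sin (Real.pi * θ) ^ 2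
      ≤ growth A hA k ((Φ).1^[i] (cover (someFrame E x) α))
        * (M * (2 * Real.sin (Real.pi * θ))⁻¹) := by
  induction i generalizing n x a b α with
  | zero =>
    have h0 := hstrip 0 (Nat.zero_le _)
    rw [iterLift_zero, iterLift_zero] at h0
    have hs := sin_pi_mul_pos hθ (by linarith)
    refine le_trans (mul_le_mul_of_nonneg_left (sin_sq_le_arcForm hθ h0 haα hαb)
      (by positivity)) ?_
    exact le_growth_of_strip hθ hmax n x (by linarith) hstrip (by linarith) (by linarith)
      (by omega)
  | succ i ih =>
    have hG := (strictMono_fiberLift Φ x).monotone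
    rw [Function.iterate_succ_apply, apply_cover]
    refine ih (n - 1) (T x) (a := fiberLift Φ x a + -θ) (b := fiberLift Φ x b + θ)
      (fun j hj => hstrip (j + 1) (by omega)) ?_ ?_ (by omega)
    · linarith [hG (show a ≤ α by linarith)]
    · linarith [hG (show α ≤ b by linarith)]

end Strips

end LinearCocycle

/-! ### Contracted and expanded lines -/

namespace LinearCocycle

open OrientedPlaneBundle

section Pointwise

variable {X : Type*} [TopologicalSpace X] {F : Type*}
  {V : X → Type*} [TopologicalSpace (TotalSpace F V)]
  [∀ x, NormedAddCommGroup (V x)] [∀ x, InnerProductSpace ℝ (V x)]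
  {T : X ≃ₜ X} (A : LinearCocycle F V T) {E : OrientedPlaneBundle F V}
  (hA : A.PreservesOrientation E)

/-- The growth of the line `p` under the iterates of the cocycle is at most `C * l⁻¹ ^ k`. -/
def IsContracted (l C : ℝ) (p : E.Proj) : Prop :=
  ∀ k, growth A hA k p ≤ C * l⁻¹ ^ k

/-- The line `p` has preimages of all orders, which grow at least by `c * l ^ k` until they
reach `p`. -/
def IsExpanded (l c : ℝ) (p : E.Proj) : Prop :=
  ∀ k, ∃ q, (A.projectivization hA).1^[k] q = p ∧ c * l ^ k ≤ growth A hA k q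

variable {A hA} {l : ℝ}

theorem IsContracted.apply {C : ℝ} {p : E.Proj} (h : A.IsContracted hA l C p) :
    ∃ C', A.IsContracted hA l C' ((A.projectivization hA).1 p) := by
  refine ⟨C * l⁻¹ / rate A hA p, fun k => ?_⟩
  have h1 := h (k + 1)
  rw [growth_succ] at h1
  have hν := A.rate_pos hA p
  rw [div_mul_eq_mul_div, le_div_iff₀ hν]
  calc _ = rate A hA p * growth A hA k ((A.projectivization hA).1 p) := mul_comm _ _
    _ ≤ _ := h1.trans_eq (by ring)

theorem IsExpanded.apply (hl : 1 < l) {c : ℝ} (hc : 0 < c) {p : E.Proj}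
    (h : A.IsExpanded hA l c p) :
    ∃ c' > 0, A.IsExpanded hA l c' ((A.projectivization hA).1 p) := by
  have hν := A.rate_pos hA p
  have hl0 : 0 < l := by linarith
  refine ⟨min 1 (c * rate A hA p / l), lt_min one_pos (by positivity), fun k => ?_⟩
  rcases k with _ | k
  · refine ⟨_, rfl, ?_⟩
    rw [pow_zero, mul_one, growth_zero]
    exact min_le_left _ _
  · obtain ⟨q, hq, hg⟩ := h k
    refine ⟨q, by rw [Function.iterate_succ_apply', hq], ?_⟩
    rw [growth_succ', hq]
    calc _ ≤ c * rate A hA p / l * l ^ (k + 1) :=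
          mul_le_mul_of_nonneg_right (min_le_right _ _) (by positivity)
      _ = c * l ^ k * rate A hA p := by rw [pow_succ]; field_simp
      _ ≤ _ := mul_le_mul_of_nonneg_right hg hν.le

theorem eq_of_chord_sq_le (hl : 1 < l) {p q : E.Proj} (hpq : p.base = q.base) {C : ℝ}
    (h : ∀ k : ℕ, chord p q ^ 2 ≤ C * ((l⁻¹) ^ 2) ^ k) : p = q := by
  have hli : l⁻¹ ^ 2 < 1 := pow_lt_one₀ (by positivity) (inv_lt_one_of_one_lt₀ hl) two_ne_zero
  have hlim := (tendsto_pow_atTop_nhds_zero_of_lt_one (by positivity) hli).const_mul C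
  rw [mul_zero] at hlim
  have h0 := ge_of_tendsto' hlim h
  exact (chord_eq_zero hpq).1 (pow_eq_zero_iff two_ne_zero |>.1 (le_antisymm h0 (sq_nonneg _)))

theorem chord_sq_le_four (p q : E.Proj) : chord p q ^ 2 ≤ 4 := by
  nlinarith [chord_nonneg p q, chord_le_two p q]

/-- Two lines of the same plane cannot both be contracted: the chord between their iterates would
be unbounded. -/
theorem IsContracted.eq (hl : 1 < l) {p q : E.Proj} (hpq : p.base = q.base) {C D : ℝ}
    (hp : A.IsContracted hA l C p) (hq : A.IsContracted hA l D q) : p = q := by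
  refine eq_of_chord_sq_le hl hpq (C := C * D * 4) fun k => ?_
  have hgp := A.growth_pos hA k p
  have hgq := A.growth_pos hA k q
  rw [A.chord_sq_eq_growth_mul hA k hpq]
  calc _ ≤ (C * l⁻¹ ^ k) * (D * l⁻¹ ^ k) * 4 :=
        mul_le_mul (mul_le_mul (hp k) (hq k) hgq.le (hgp.le.trans (hp k)))
          (chord_sq_le_four _ _) (sq_nonneg _)
          (mul_nonneg (hgp.le.trans (hp k)) (hgq.le.trans (hq k)))
    _ = _ := by rw [← pow_mul, mul_comm 2 k, pow_mul]; ring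

/-- Two lines of the same plane cannot both be expanded: the chord between their preimages would be
unbounded. -/
theorem IsExpanded.eq (hl : 1 < l) {p q : E.Proj} (hpq : p.base = q.base) {c d : ℝ} (hc : 0 < c)
    (hd : 0 < d) (hp : A.IsExpanded hA l c p) (hq : A.IsExpanded hA l d q) : p = q := by
  have hl0 : 0 < l := by linarith
  refine eq_of_chord_sq_le hl hpq (C := 4 / (c * d)) fun k => ?_
  obtain ⟨p', hp', hgp⟩ := hp k
  obtain ⟨q', hq', hgq⟩ := hq k
  have hb : p'.base = q'.base := by
    have h1 : T^[k] p'.base = T^[k] q'.base := by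
      rw [← SkewProduct.base_iterate (A.projectivization hA), hp', hpq, ← hq',
        SkewProduct.base_iterate]
    exact T.injective.iterate k h1
  have h2 := A.chord_sq_eq_growth_mul hA k hb
  rw [hp', hq'] at h2
  have h3 : c * l ^ k * (d * l ^ k) * chord p q ^ 2 ≤ 4 := by
    refine le_trans ?_ (h2.symm.trans_le (chord_sq_le_four p' q'))
    exact mul_le_mul_of_nonneg_right (mul_le_mul hgp hgq (by positivity)
      (A.growth_pos hA k p').le) (sq_nonneg _)
  have h4 : 4 / (c * d) * (l⁻¹ ^ 2) ^ k = 4 / (c * l ^ k * (d * l ^ k)) := by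
    rw [← pow_mul, mul_comm 2 k, pow_mul, inv_pow]
    field_simp
  rw [h4, le_div_iff₀ (by positivity)]
  linarith

theorem span_ray_eq_of_cover_eq {x : X} {b b' : E.Frame x} {s t : ℝ} (h : cover b s = cover b' t) :
    Submodule.span ℝ {(ray b s : V x)} = Submodule.span ℝ {(ray b' t : V x)} := by
  rcases exists_cover_eq_ray h with h1 | h1
  · rw [h1]
  · rw [h1, Submodule.coe_neg, ← neg_one_smul ℝ,
      Submodule.span_singleton_smul_eq (by simp : IsUnit (-1 : ℝ))]

end Pointwise

variable {X : Type*} [TopologicalSpace X] {F : Type*} [NormedAddCommGroup F] [NormedSpace ℝ F]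
  {V : X → Type*} [TopologicalSpace (TotalSpace F V)]
  [∀ x, NormedAddCommGroup (V x)] [∀ x, InnerProductSpace ℝ (V x)]
  [FiberBundle F V] [VectorBundle ℝ F V] [IsContinuousRiemannianBundle F V]
  {T : X ≃ₜ X} {A : LinearCocycle F V T} {E : OrientedPlaneBundle F V}
  {hA : A.PreservesOrientation E}

section Compact

variable [T2Space X] [CompactSpace X]

theorem isClosed_setOf_isContracted (l C : ℝ) : IsClosed {p | A.IsContracted hA l C p} := by
  rw [show {p | A.IsContracted hA l C p} = ⋂ k, {p | growth A hA k p ≤ C * l⁻¹ ^ k} by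
    ext p; simp [IsContracted]]
  exact isClosed_iInter fun k => isClosed_le (A.continuous_growth hA k) continuous_const

/-- The set is closed as the image of a closed set by a continuous map of a compact space. -/
theorem isClosed_setOf_exists_le_growth (c : ℝ) (k : ℕ) :
    IsClosed {p | ∃ q, (A.projectivization hA).1^[k] q = p ∧ c ≤ growth A hA k q} := by
  have h1 : IsClosed {q | c ≤ growth A hA k q} :=
    isClosed_le continuous_const (A.continuous_growth hA k)
  have h2 := (h1.isCompact.image ((A.projectivization hA).1.continuous.iterate k)).isClosed
  convert h2 using 1
  ext p
  simp only [mem_ofPred_eq, mem_image]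
  exact exists_congr fun q => and_comm

theorem isClosed_setOf_isExpanded (l c : ℝ) : IsClosed {p | A.IsExpanded hA l c p} := by
  rw [show {p | A.IsExpanded hA l c p} = ⋂ k, {p | ∃ q, (A.projectivization hA).1^[k] q = p ∧
      c * l ^ k ≤ growth A hA k q} by ext p; simp [IsExpanded]]
  exact isClosed_iInter fun k => isClosed_setOf_exists_le_growth _ k

/-- If closed conditions can be satisfied by finitely many at a time by lines of a given plane, they
can all be satisfied by one line. -/
theorem exists_forall_of_forall_lt {P : ℕ → E.Proj → Prop} (hP : ∀ k, IsClosed {p | P k p}) (x : X)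
    (h : ∀ n, ∃ p : E.Proj, p.base = x ∧ ∀ k < n, P k p) :
    ∃ p : E.Proj, p.base = x ∧ ∀ k, P k p := by
  have hK : ∀ n, IsClosed {p : E.Proj | p.base = x ∧ ∀ k < n, P k p} := by
    intro n
    rw [show {p : E.Proj | p.base = x ∧ ∀ k < n, P k p}
      = Proj.base ⁻¹' {x} ∩ ⋂ k, ⋂ _ : k < n, {p | P k p} by ext p; simp]
    exact (isClosed_singleton.preimage continuous_base).inter
      (isClosed_iInter fun k => isClosed_iInter fun _ => hP k)
  obtain ⟨p, hp⟩ := IsCompact.nonempty_iInter_of_sequence_nonempty_isCompact_isClosed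
    (fun n => {p : E.Proj | p.base = x ∧ ∀ k < n, P k p})
    (fun n p hp => ⟨hp.1, fun k hk => hp.2 k (by omega)⟩) h (hK 0).isCompact hK
  rw [mem_iInter] at hp
  exact ⟨p, (hp 0).1, fun k => (hp (k + 1)).2 k k.lt_succ_self⟩

/-- A section of the projective bundle with a closed graph is continuous. -/
theorem continuousOn_of_isClosed {S : Set X} (hS : IsClosed S) {K : Set E.Proj} (hK : IsClosed K)
    {ℓ : X → E.Proj} (hb : ∀ x ∈ S, (ℓ x).base = x) (hmem : ∀ x ∈ S, ℓ x ∈ K)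
    (huniq : ∀ p ∈ K, p.base ∈ S → p = ℓ p.base) : ContinuousOn ℓ S := by
  rw [continuousOn_iff_isClosed]
  intro Z hZ
  refine ⟨Proj.base '' (K ∩ Z ∩ Proj.base ⁻¹' S), (((hK.inter hZ).inter
    (hS.preimage continuous_base)).isCompact.image continuous_base).isClosed, ?_⟩
  ext x
  constructor
  · rintro ⟨hx, hxS⟩
    refine ⟨⟨ℓ x, ⟨⟨hmem x hxS, hx⟩, ?_⟩, hb x hxS⟩, hxS⟩
    rw [mem_preimage, hb x hxS]
    exact hxS
  · rintro ⟨⟨p, ⟨⟨hpK, hpZ⟩, hpS⟩, rfl⟩, -⟩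
    exact ⟨by rw [mem_preimage, ← huniq p hpK hpS]; exact hpZ, hpS⟩

/-- If the spread stays below one along some orbit above each point of `S`, then there are
continuous invariant sections of contracted and of expanded lines over `S`. -/
theorem exists_sections {S : Set X} (hS : IsClosed S) (hST : ∀ x ∈ S, T x ∈ S)
    (hST' : ∀ x ∈ S, T.symm x ∈ S) {θ : ℝ} (hθ : 0 < θ)
    (h : ∀ x ∈ S, ∀ n, ∃ t, ∀ k ≤ n, spread (A.projectivization hA) θ k x t < 1) :
    ∃ ℓ₁ ℓ₂ : X → E.Proj, (∀ x ∈ S, (ℓ₁ x).base = x) ∧ (∀ x ∈ S, (ℓ₂ x).base = x) ∧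
      ContinuousOn ℓ₁ S ∧ ContinuousOn ℓ₂ S ∧
      (∀ x ∈ S, (A.projectivization hA).1 (ℓ₁ x) = ℓ₁ (T x)) ∧
      (∀ x ∈ S, (A.projectivization hA).1 (ℓ₂ x) = ℓ₂ (T x)) ∧ (∀ x ∈ S, ℓ₁ x ≠ ℓ₂ x) ∧
      ∃ N, ∀ x ∈ S, 4 * growth A hA N (ℓ₁ x) < growth A hA N (ℓ₂ x) := by
  rcases S.eq_empty_or_nonempty with rfl | ⟨x₀, hx₀⟩
  · rcases isEmpty_or_nonempty X with hX | ⟨⟨x₁⟩⟩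
    · refine ⟨fun x => (hX.false x).elim, fun x => (hX.false x).elim, ?_⟩
      simp
    · exact ⟨fun _ => cover (someFrame E x₁) 0, fun _ => cover (someFrame E x₁) 0, by simp⟩
  set f := A.projectivization hA with hf
  -- after one step, a point becomes an arc of length `2 θ`
  have hstrip : ∀ x ∈ S, ∀ n, ∃ α, ∀ k ≤ n,
      iterLift f θ k x (α + θ) - iterLift f (-θ) k x (α - θ) < 1 := by
    intro x hx n
    obtain ⟨t, ht⟩ := h (T.symm x) (hST' x hx) (n + 1)
    refine ⟨fiberLift f (T.symm x) t, fun k hk => ?_⟩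
    have := ht (k + 1) (by omega)
    rwa [spread, iterLift_succ, iterLift_succ, T.apply_symm_apply] at this
  have hθ1 : 2 * θ < 1 := by
    obtain ⟨α, hα⟩ := hstrip x₀ hx₀ 0
    have := hα 0 le_rfl
    rw [iterLift_zero, iterLift_zero] at this
    linarith
  obtain ⟨m, hm, hmin⟩ := exists_pos_forall_le (A.continuous_rate hA) (A.rate_pos hA)
  obtain ⟨M, hM, hmax⟩ := exists_pos_forall_ge (A.continuous_rate hA)
  have hs := sin_pi_mul_pos hθ (by linarith)
  have hs2 := sin_pi_mul_pos (t := 2 * θ) (by linarith) hθ1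
  set l := 1 + Real.sin (Real.pi * θ) with hl_def
  have hl : 1 < l := by linarith
  have hl0 : 0 < l := by linarith
  set C := (Real.sin (Real.pi * (2 * θ)))⁻¹ / (m * Real.sin (Real.pi * θ) ^ 2) with hC
  set c := Real.sin (Real.pi * θ) ^ 2 / (M * (2 * Real.sin (Real.pi * θ))⁻¹) with hc
  have hC0 : 0 < C := by positivity
  have hc0 : 0 < c := by positivity
  -- a contracted line comes from strips above the future of `x`
  have hex₁ : ∀ x ∈ S, ∃ p : E.Proj, p.base = x ∧ A.IsContracted hA l C p := by
    intro x hx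
    refine exists_forall_of_forall_lt (P := fun k p => growth A hA k p ≤ C * l⁻¹ ^ k)
      (fun k => isClosed_le (A.continuous_growth hA k) continuous_const) x fun n => ?_
    obtain ⟨α, hα⟩ := hstrip x hx n
    obtain ⟨β, -, -, hβ⟩ := exists_growth_le_of_strip hθ hmin n x (by linarith) hα
    refine ⟨cover (someFrame E x) β, rfl, fun k hk => ?_⟩
    have h1 := hβ k hk
    have h2 := neg_arcForm_le (a := α - θ) (b := α + θ) (by linarith) (by linarith) β
    rw [show α + θ - (α - θ) = 2 * θ by ring] at h2
    rw [hC, div_mul_eq_mul_div, le_div_iff₀ (by positivity)]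
    refine h1.trans ?_
    rw [mul_comm]
    exact mul_le_mul_of_nonneg_right h2 (by positivity)
  have hSn : ∀ n, ∀ x ∈ S, T.symm^[n] x ∈ S := by
    intro n
    induction n with
    | zero => exact fun x hx => hx
    | succ n ih => exact fun x hx => ih _ (hST' x hx)
  -- for an expanded line, the strip starts in the past of `x` and its central line is followed
  have hex₂ : ∀ x ∈ S, ∃ p : E.Proj, p.base = x ∧ A.IsExpanded hA l c p := by
    intro x hx
    refine exists_forall_of_forall_lt (P := fun k p => ∃ q, f.1^[k] q = p ∧
      c * l ^ k ≤ growth A hA k q) (fun k => isClosed_setOf_exists_le_growth _ k) x fun n => ?_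
    have hinv : T^[n] (T.symm^[n] x) = x :=
      (Function.LeftInverse.iterate T.apply_symm_apply n) x
    obtain ⟨α, hα⟩ := hstrip _ (hSn n x hx) (n + 1)
    refine ⟨f.1^[n] (cover (someFrame E (T.symm^[n] x)) α), ?_, fun k hk => ?_⟩
    · rw [SkewProduct.base_iterate, base_cover, hinv]
    · refine ⟨f.1^[n - k] (cover (someFrame E (T.symm^[n] x)) α), ?_, ?_⟩
      · rw [← Function.iterate_add_apply, Nat.add_sub_cancel' hk.le]
      · have h1 := le_growth_iterate_of_strip hθ hmax (n - k) (n + 1) (T.symm^[n] x) (α := α) hα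
          (by linarith) (by linarith) (k := k) (by omega)
        rw [hc, div_mul_eq_mul_div, div_le_iff₀ (by positivity), mul_comm]
        exact h1
  have : Nonempty E.Proj := ⟨cover (someFrame E x₀) 0⟩
  have hbase : ∀ p : E.Proj, (f.1 p).base = T p.base := f.2.1
  obtain ⟨ℓ₁, hℓ₁⟩ : ∃ ℓ : X → E.Proj, ∀ x ∈ S, (ℓ x).base = x ∧ A.IsContracted hA l C (ℓ x) := by
    choose! ℓ hℓ using hex₁
    exact ⟨ℓ, hℓ⟩
  obtain ⟨ℓ₂, hℓ₂⟩ : ∃ ℓ : X → E.Proj, ∀ x ∈ S, (ℓ x).base = x ∧ A.IsExpanded hA l c (ℓ x) := by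
    choose! ℓ hℓ using hex₂
    exact ⟨ℓ, hℓ⟩
  have hinv₁ : ∀ x ∈ S, f.1 (ℓ₁ x) = ℓ₁ (T x) := by
    intro x hx
    obtain ⟨C', hC'⟩ := (hℓ₁ x hx).2.apply
    refine hC'.eq hl ?_ (hℓ₁ _ (hST x hx)).2
    rw [(hℓ₁ _ (hST x hx)).1, hbase, (hℓ₁ x hx).1]
  have hinv₂ : ∀ x ∈ S, f.1 (ℓ₂ x) = ℓ₂ (T x) := by
    intro x hx
    obtain ⟨c', hc', hexp⟩ := (hℓ₂ x hx).2.apply hl hc0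
    refine hexp.eq hl ?_ hc' hc0 (hℓ₂ _ (hST x hx)).2
    rw [(hℓ₂ _ (hST x hx)).1, hbase, (hℓ₂ x hx).1]
  -- the preimage of the expanded line that grows is the expanded line of the preimage
  have hgrow₂ : ∀ k, ∀ x ∈ S, c * l ^ k ≤ growth A hA k (ℓ₂ x) := by
    intro k x hx
    obtain ⟨h1, h2⟩ := iterate_section hST hinv₂ k hx
    obtain ⟨q, hq, hg⟩ := (hℓ₂ _ h2).2 k
    rw [← h1] at hq
    rwa [← (SkewProduct.injective f).iterate k hq]
  obtain ⟨N, hN⟩ : ∃ N : ℕ, 4 * (C * l⁻¹ ^ N) < c * l ^ N := by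
    obtain ⟨N, hN⟩ := pow_unbounded_of_one_lt (4 * C / c) hl
    refine ⟨N, ?_⟩
    have h1 : l⁻¹ ^ N ≤ 1 := pow_le_one₀ (by positivity) (inv_le_one_of_one_le₀ hl.le)
    rw [div_lt_iff₀ hc0] at hN
    nlinarith
  have hdom : ∀ x ∈ S, 4 * growth A hA N (ℓ₁ x) < growth A hA N (ℓ₂ x) := fun x hx =>
    (mul_le_mul_of_nonneg_left ((hℓ₁ x hx).2 N) (by norm_num)).trans_lt
      (hN.trans_le (hgrow₂ N x hx))
  refine ⟨ℓ₁, ℓ₂, fun x hx => (hℓ₁ x hx).1, fun x hx => (hℓ₂ x hx).1, ?_, ?_, hinv₁, hinv₂,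
    fun x hx heq => ?_, N, hdom⟩
  · exact continuousOn_of_isClosed hS (isClosed_setOf_isContracted l C) (fun x hx => (hℓ₁ x hx).1)
      (fun x hx => (hℓ₁ x hx).2) fun p hp hpS =>
        IsContracted.eq hl (hℓ₁ _ hpS).1.symm hp (hℓ₁ _ hpS).2
  · exact continuousOn_of_isClosed hS (isClosed_setOf_isExpanded l c) (fun x hx => (hℓ₂ x hx).1)
      (fun x hx => (hℓ₂ x hx).2) fun p hp hpS =>
        IsExpanded.eq hl (hℓ₂ _ hpS).1.symm hc0 hc0 hp (hℓ₂ _ hpS).2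
  · have h1 := hdom x hx
    rw [heq] at h1
    linarith [A.growth_pos hA N (ℓ₂ x)]

end Compact

/-! ### Line bundles spanned by sections, and the dominated splitting -/

/-- A continuous section of the projective bundle spans a continuous line bundle. -/
theorem isContinuousSubbundle_span_ray {S : Set X} {ℓ : X → E.Proj} (hℓ : ContinuousOn ℓ S)
    {α : X → ℝ} (hα : ∀ x ∈ S, cover (someFrame E x) (α x) = ℓ x) :
    IsContinuousSubbundle F S 1 fun x => Submodule.span ℝ {(ray (someFrame E x) (α x) : V x)} := by
  intro x₀ hx₀
  have hb : ∀ x ∈ S, (ℓ x).base = x := fun x hx => by rw [← hα x hx, base_cover]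
  obtain ⟨U, hU, hxU, b, hbc⟩ := exists_isContinuousFrame (E := E) x₀
  obtain ⟨t₀, ht₀⟩ := turn_surjective (chart b (ℓ x₀))
  have hz : ContinuousOn (fun x => ((chart b (ℓ x) / chart b (ℓ x₀) : Circle) : ℂ)) (U ∩ S) := by
    refine continuous_subtype_val.comp_continuousOn ?_
    have h1 : ContinuousOn (fun x => chart b (ℓ x)) (U ∩ S) :=
      (hbc.continuousOn_chart hU).comp (hℓ.mono inter_subset_right) fun x hx => by
        rw [mem_preimage, hb x hx.2]; exact hx.1
    exact h1.div' continuousOn_const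
  have hev : ∀ᶠ x in 𝓝[U ∩ S] x₀,
      ((chart b (ℓ x) / chart b (ℓ x₀) : Circle) : ℂ) ∈ Complex.slitPlane := by
    refine (hz x₀ ⟨hxU, hx₀⟩).eventually (Complex.isOpen_slitPlane.mem_nhds ?_)
    simp
  obtain ⟨W, hW, hxW, hWsub⟩ := mem_nhdsWithin.1 hev
  set s : X → ℝ := fun x =>
    t₀ + Complex.arg ((chart b (ℓ x) / chart b (ℓ x₀) : Circle) : ℂ) / (2 * Real.pi) with hs
  have hsc : ContinuousOn s (W ∩ U ∩ S) := by
    intro x hx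
    have h1 : ContinuousWithinAt (fun x => ((chart b (ℓ x) / chart b (ℓ x₀) : Circle) : ℂ))
        (W ∩ U ∩ S) x := (hz x ⟨hx.1.2, hx.2⟩).mono fun y hy => ⟨hy.1.2, hy.2⟩
    have h2 := (Complex.continuousAt_arg (hWsub ⟨hx.1.1, hx.1.2, hx.2⟩)).comp_continuousWithinAt
      (f := fun x => ((chart b (ℓ x) / chart b (ℓ x₀) : Circle) : ℂ)) h1
    exact continuousWithinAt_const.add (h2.div_const _)
  have hcov : ∀ x ∈ S, cover (b x) (s x) = cover (someFrame E x) (α x) := by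
    intro x hx
    have h1 : turn (s x) = chart b (ℓ x) := by
      rw [hs, turn_add, ht₀, turn, mul_div_cancel₀ _ (by positivity), Circle.exp_arg,
        mul_div_cancel]
    have h2 := cover_eq_of_turn_eq b h1
    rw [hα x hx, ← h2, hb x hx]
  refine ⟨W ∩ U, inter_mem (hW.mem_nhds hxW) (hU.mem_nhds hxU), fun _ x => ray (b x) (s x),
    fun _ => ?_, fun x hx => ⟨?_, ?_⟩⟩
  · exact hbc.continuousOn_ray.comp (f := fun x => (x, s x)) (continuousOn_id.prodMk hsc)
      fun x hx => ⟨hx.1.2, mem_univ _⟩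
  · rw [linearIndependent_unique_iff]
    simpa using ray_ne_zero (b x) (s x)
  · rw [range_const]
    exact span_ray_eq_of_cover_eq (hcov x hx.2)

section Lines

variable {x : X}

theorem disjoint_span_ray {b : E.Frame x} {s t : ℝ} (h : cover b s ≠ cover b t) :
    Disjoint (Submodule.span ℝ {(ray b s : V x)}) (Submodule.span ℝ {(ray b t : V x)}) := by
  have h0 : (ray b t : V x) ≠ 0 := by simpa using ray_ne_zero b t
  rw [Submodule.disjoint_span_singleton' h0]
  intro hmem
  obtain ⟨r, hr⟩ := Submodule.mem_span_singleton.1 hmem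
  have h1 : ray b t = r • ray b s := Subtype.ext hr.symm
  exact h (mk_smul_ray_eq_cover b (ray_ne_zero b t) h1).symm

theorem span_ray_sup_span_ray {b : E.Frame x} {s t : ℝ} (h : cover b s ≠ cover b t) :
    Submodule.span ℝ {(ray b s : V x)} ⊔ Submodule.span ℝ {(ray b t : V x)} = E.fiber x := by
  have hfin : FiniteDimensional ℝ (E.fiber x) := Module.Finite.of_basis b.1.toBasis
  have hle : ∀ t, Submodule.span ℝ {(ray b t : V x)} ≤ E.fiber x := fun t => by
    rw [Submodule.span_singleton_le_iff_mem]; exact (ray b t).2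
  have h0 : ∀ t, (ray b t : V x) ≠ 0 := fun t => by simpa using ray_ne_zero b t
  have hrank := Submodule.finrank_sup_add_finrank_inf_eq (Submodule.span ℝ {(ray b s : V x)})
    (Submodule.span ℝ {(ray b t : V x)})
  rw [(disjoint_span_ray h).eq_bot, finrank_bot, finrank_span_singleton (h0 s),
    finrank_span_singleton (h0 t)] at hrank
  refine Submodule.eq_of_le_of_finrank_eq (sup_le (hle s) (hle t)) ?_
  rw [Module.finrank_eq_card_basis b.1.toBasis, Fintype.card_fin]
  exact hrank

theorem map_span_ray {b : E.Frame x} {b' : E.Frame (T x)} {s t : ℝ}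
    (h : (A.projectivization hA).1 (cover b s) = cover b' t) :
    (Submodule.span ℝ {(ray b s : V x)}).map (A.onFiber x : V x →ₗ[ℝ] V (T x))
      = Submodule.span ℝ {(ray b' t : V (T x))} := by
  obtain ⟨r, t', hr, h1, h2, -⟩ := A.exists_onPlane_ray hA b b' s
  have h3 : (A.onFiber x : V x →ₗ[ℝ] V (T x)) (ray b s : V x) = r • (ray b' t' : V (T x)) :=
    congrArg Subtype.val h1
  rw [Submodule.map_span, image_singleton, h3,
    Submodule.span_singleton_smul_eq (isUnit_iff_ne_zero.2 hr.ne')]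
  exact span_ray_eq_of_cover_eq (h2.symm.trans h)

theorem iterNorm_sq_of_mem_span_ray {n : ℕ} {c : ℝ}
    (hc : ∀ (b : E.Frame x) (t : ℝ),
      A.iterNorm n (ray b t : V x) ^ 2 = c * growth A hA n (cover b t))
    {b : E.Frame x} {t : ℝ} {u : V x} (hu : u ∈ Submodule.span ℝ {(ray b t : V x)})
    (hu1 : ‖u‖ = 1) : A.iterNorm n u ^ 2 = c * growth A hA n (cover b t) := by
  obtain ⟨r, rfl⟩ := Submodule.mem_span_singleton.1 hu
  have h1 : ‖(ray b t : V x)‖ = 1 := norm_ray b t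
  rw [norm_smul, h1, mul_one, Real.norm_eq_abs] at hu1
  rw [iterNorm_smul, hu1, one_mul, hc]

end Lines

end LinearCocycle

open OrientedPlaneBundle in
/-- Mode-locking implies a dominated splitting over the support. -/
theorem LinearCocycle.hasDominatedSplitting_of_isModeLocked
    {X : Type*} [MetricSpace X] [CompactSpace X] [MeasurableSpace X] [BorelSpace X]
    {F : Type*} [NormedAddCommGroup F] [NormedSpace ℝ F]
    {V : X → Type*} [TopologicalSpace (TotalSpace F V)]
    [∀ x, NormedAddCommGroup (V x)] [∀ x, InnerProductSpace ℝ (V x)]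
    [FiberBundle F V] [VectorBundle ℝ F V] [IsContinuousRiemannianBundle F V]
    {T : X ≃ₜ X} {A : LinearCocycle F V T} {E : OrientedPlaneBundle F V}
    {hA : A.PreservesOrientation E} {μ : Measure X} [IsFiniteMeasure μ]
    (h : IsModeLocked μ (A.projectivization hA)) (hμ : MeasurePreserving T μ μ) :
    A.HasDominatedSplitting E μ.support := by
  obtain ⟨θ, hθ, hspread⟩ := h.exists_spread_lt_one hμ
  have hST : ∀ x ∈ μ.support, T x ∈ μ.support := fun x hx => hμ.apply_mem_support hx
  obtain ⟨ℓ₁, ℓ₂, hb₁, hb₂, hc₁, hc₂, hinv₁, hinv₂, hne, N, hN⟩ := LinearCocycle.exists_sections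
    Measure.isClosed_support hST (fun x hx => hμ.symm_apply_mem_support hx) hθ hspread
  choose! α₁ hα₁ using fun x (hx : x ∈ μ.support) => exists_cover_eq (someFrame E x) (hb₁ x hx)
  choose! α₂ hα₂ using fun x (hx : x ∈ μ.support) => exists_cover_eq (someFrame E x) (hb₂ x hx)
  have hne' : ∀ x ∈ μ.support, cover (someFrame E x) (α₁ x) ≠ cover (someFrame E x) (α₂ x) :=
    fun x hx => by rw [hα₁ x hx, hα₂ x hx]; exact hne x hx
  refine ⟨2, le_rfl, fun _ => 1,
    ![fun x => Submodule.span ℝ {(ray (someFrame E x) (α₁ x) : V x)},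
      fun x => Submodule.span ℝ {(ray (someFrame E x) (α₂ x) : V x)}],
    Fin.forall_fin_two.2 ⟨⟨one_pos, ?_⟩, ⟨one_pos, ?_⟩⟩, fun x hx => ⟨?_, ?_⟩,
    Fin.forall_fin_two.2 ⟨fun x hx => ?_, fun x hx => ?_⟩, N,
    fun x hx i j hij u hu v hv hu1 hv1 => ?_⟩
  · exact LinearCocycle.isContinuousSubbundle_span_ray hc₁ hα₁
  · exact LinearCocycle.isContinuousSubbundle_span_ray hc₂ hα₂
  · rw [iSupIndep_pair (i := 0) (j := 1) (by decide) (by decide)]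
    exact LinearCocycle.disjoint_span_ray (hne' x hx)
  · rw [← LinearCocycle.span_ray_sup_span_ray (hne' x hx)]
    exact le_antisymm (iSup_le (Fin.forall_fin_two.2 ⟨le_sup_left, le_sup_right⟩))
      (sup_le (le_iSup_of_le 0 le_rfl) (le_iSup_of_le 1 le_rfl))
  · exact LinearCocycle.map_span_ray (hA := hA) (by rw [hα₁ x hx, hα₁ _ (hST x hx), hinv₁ x hx])
  · exact LinearCocycle.map_span_ray (hA := hA) (by rw [hα₂ x hx, hα₂ _ (hST x hx), hinv₂ x hx])
  · obtain ⟨rfl, rfl⟩ : i = 0 ∧ j = 1 := by omega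
    obtain ⟨c, hc, hgrow⟩ := A.exists_iterNorm_ray_sq hA N x
    have h1 := LinearCocycle.iterNorm_sq_of_mem_span_ray hgrow hu hu1
    have h2 := LinearCocycle.iterNorm_sq_of_mem_span_ray hgrow hv hv1
    rw [hα₁ x hx] at h1
    rw [hα₂ x hx] at h2
    have h3 := mul_lt_mul_of_pos_left (hN x hx) hc
    have h4 : 0 ≤ A.iterNorm N u := norm_nonneg _
    have h5 : 0 ≤ A.iterNorm N v := norm_nonneg _
    refine lt_of_pow_lt_pow_left₀ 2 (by positivity) ?_
    rw [mul_pow, h1, h2]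
    linarith

end

theorem propositionp {X : Type*} [MetricSpace X] [CompactSpace X] [MeasurableSpace X]
    [BorelSpace X]
    {F : Type*} [NormedAddCommGroup F] [NormedSpace ℝ F] [FiniteDimensional ℝ F]
    {V : X → Type*} [TopologicalSpace (TotalSpace F V)]
    [∀ x, NormedAddCommGroup (V x)] [∀ x, InnerProductSpace ℝ (V x)]
    [FiberBundle F V] [VectorBundle ℝ F V] [IsContinuousRiemannianBundle F V]
    (T : X ≃ₜ X) (A : LinearCocycle F V T) (E : OrientedPlaneBundle F V)
    (hA : A.PreservesOrientation E)
    (μ : Measure X) [IsFiniteMeasure μ] (hμ : MeasurePreserving T μ μ) :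
    OrientedPlaneBundle.IsModeLocked μ (A.projectivization hA) ↔
      A.HasDominatedSplitting E μ.support :=
  ⟨fun h => LinearCocycle.hasDominatedSplitting_of_isModeLocked h hμ,
    fun h => h.isModeLocked hA hμ⟩
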